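/- **Proposition (Trace augmentation).** Let $d\ge 1$ and $\ell\ge 0$ be integers. For a nondegenerate closed simplex $K\subset\mathbb{R}^d$ let $h_K$ be its diameter, $\rho_K$ the maximum diameter of a ball contained in $K$, $|K|$ its $d$-dimensional Lebesgue measure, $|\partial K|$ the $(d-1)$-dimensional Hausdorff measure of its boundary, and $\mathbb{P}_\ell(K)$ the space of polynomials of degree at most $\ell$ on $K$. For $\varepsilon>0$ and $w\in H^1(A)$ put $|||w|||_A^2:=\|w\|_{L^2(A)}^2+\varepsilon\|\nabla w\|_{L^2(A)}^2$, where $H^1(A)$ and $L^2(A)$ refer to the interior of $A$, and let $\|w\|_{\partial K}$ be the $L^2(\partial K)$-norm of the trace of $w\in H^1(K)$. For $u\in H^1(K)$ set $$ e_K(u):=\inf_{P\in\mathbb{P}_\ell(K)}\Big(|||u-P|||_K^2+\frac{|K|}{|\partial K|}\,\|u-P\|_{\partial K}^2\Big)^{1/2}. $$ Let $K_1,K_2$ be two such simplices whose intersection $F=K_1\cap K_2$ is a common $(d-1)$-dimensional face of both, let $\omega=K_1\cup K_2$, $\sigma_F:=\max\{h_{K_1},h_{K_2}\}/\min\{\rho_{K_1},\rho_{K_2}\}$,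 and let $S|_\omega$ be the space of continuous functions on $\omega$ whose restriction to $K_i$ belongs to $\mathbb{P}_\ell(K_i)$, $i=1,2$. Then for any $u\in H^1(\omega)$ $$ \inf_{P\in S|_\omega}|||u-P|||_\omega\;\le\; C\sum_{i=1}^2 e_{K_i}(u), $$ where $C$ depends only on $\ell$, $d$ and (an upper bound for) $\sigma_F$; in particular it is independent of $\varepsilon$. Moreover, let $\mathcal{T}$ be a finite conforming simplicial mesh (distinct elements have disjoint interiors and intersect in the convex hull of their common vertices), let $\Omega$ be the interior of the union of its elements, let $\mathcal{F}$ be the set of faces shared by two elements, and for $F\in\mathcal{F}$ let $\omega_F$ be the union of these two elements. Then for any $u\in H^1(\Omega)$ $$ \Big(\sum_{F\in\mathcal{F}}\inf_{P\in S|_{\omega_F}}|||u-P|||_{\omega_F}^2\Big)^{1/2}\;\le\; C\Big(\sum_{K\in\mathcal{T}}e_K(u)^2\Big)^{1/2}, $$ where $C$ depends only on $\ell$, $d$ and (an upper bound for) $\max_{F\in\mathcal{F}}\sigma_F$. -/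

import Mathlib

open MeasureTheory Filter Topology
open scoped ContDiff

noncomputable section

namespace TraceAug

/-- `d`-dimensional Euclidean space. -/
abbrev Eu (d : ℕ) : Type := EuclideanSpace ℝ (Fin d)

/-! ### Sobolev functions -/

/-- `G` is a weak gradient of `u` on the open set `U`. -/
def IsWeakGradient {d : ℕ} (U : Set (Eu d)) (u : Eu d → ℝ) (G : Eu d → Eu d) : Prop :=
  ∀ φ : Eu d → ℝ, ContDiff ℝ ∞ φ → HasCompactSupport φ → tsupport φ ⊆ U →
    ∫ x in U, u x • gradient φ x = -∫ x in U, φ x • G x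

/-- `u ∈ H¹(U)`: `u` is in `L²(U)` and has a weak gradient in `L²(U)`. -/
def MemH1 {d : ℕ} (U : Set (Eu d)) (u : Eu d → ℝ) : Prop :=
  MemLp u 2 (volume.restrict U) ∧
    ∃ G : Eu d → Eu d, MemLp G 2 (volume.restrict U) ∧ IsWeakGradient U u G

open Classical in
/-- The weak gradient of `u ∈ H¹(U)` (unique almost everywhere on `U`). -/
def weakGradient {d : ℕ} (U : Set (Eu d)) (u : Eu d → ℝ) : Eu d → Eu d :=
  if h : ∃ G : Eu d → Eu d, MemLp G 2 (volume.restrict U) ∧ IsWeakGradient U u G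
  then h.choose else 0

/-- The reaction-diffusion norm `(‖w‖² + ε ‖∇w‖²)^{1/2}` over (the interior of) `A`. -/
def rdNorm {d : ℕ} (ε : ℝ) (A : Set (Eu d)) (w : Eu d → ℝ) : ℝ :=
  Real.sqrt ((∫ x in interior A, w x ^ 2) +
    ε * ∫ x in interior A, ‖weakGradient (interior A) w x‖ ^ 2)

/-- The surface measure on `∂A`: the `(d-1)`-dimensional Hausdorff measure, in the Euclidean
normalization, restricted to the boundary of `A`. -/
def surf {d : ℕ} (A : Set (Eu d)) : Measure (Eu d) :=
  (Measure.euclideanHausdorffMeasure (d - 1)).restrict (frontier A)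

/-- `g ∈ L²(∂A)` is the trace on `∂A` of `w ∈ H¹(A)`: there are smooth functions that converge to
`w` in `H¹(A)` and whose restrictions to `∂A` converge to `g` in `L²(∂A)`. -/
def IsTrace {d : ℕ} (A : Set (Eu d)) (w g : Eu d → ℝ) : Prop :=
  MemH1 (interior A) w ∧ MemLp g 2 (surf A) ∧
    ∃ φ : ℕ → Eu d → ℝ, (∀ n, ContDiff ℝ ∞ (φ n)) ∧
      Tendsto (fun n => eLpNorm (fun x => φ n x - w x) 2 (volume.restrict (interior A)))
        atTop (𝓝 0) ∧
      Tendsto (fun n => eLpNorm (fun x => gradient (φ n) x - weakGradient (interior A) w x) 2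
        (volume.restrict (interior A))) atTop (𝓝 0) ∧
      Tendsto (fun n => eLpNorm (fun x => φ n x - g x) 2 (surf A)) atTop (𝓝 0)

open Classical in
/-- The trace operator (used for simplices `A`, where every `w ∈ H¹(A)` has a trace, unique
almost everywhere on `∂A`). -/
def trace {d : ℕ} (A : Set (Eu d)) (w : Eu d → ℝ) : Eu d → ℝ :=
  if h : ∃ g, IsTrace A w g then h.choose else 0

/-! ### Simplices and polynomials -/

/-- The closed set underlying a nondegenerate `d`-simplex, i.e. the convex hull of its vertices. -/
def el {d : ℕ} (s : Affine.Simplex ℝ (Eu d) d) : Set (Eu d) :=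
  convexHull ℝ (Set.range s.points)

/-- The face of `s` opposite to the vertex with index `k`. -/
def face {d : ℕ} (s : Affine.Simplex ℝ (Eu d) d) (k : Fin (d + 1)) : Set (Eu d) :=
  convexHull ℝ (s.points '' {k}ᶜ)

/-- The intersection of the two elements is a common face of both. -/
def IsPair {d : ℕ} (s t : Affine.Simplex ℝ (Eu d) d) : Prop :=
  (∃ k, face s k = el s ∩ el t) ∧ ∃ k, face t k = el s ∩ el t

/-- The maximum diameter of a ball inscribed in the element. -/
def rho {d : ℕ} (s : Affine.Simplex ℝ (Eu d) d) : ℝ :=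
  sSup {δ : ℝ | 0 ≤ δ ∧ ∃ x, Metric.closedBall x (δ / 2) ⊆ el s}

/-- The shape parameter of a pair of elements. -/
def shapePar {d : ℕ} (s t : Affine.Simplex ℝ (Eu d) d) : ℝ :=
  max (Metric.diam (el s)) (Metric.diam (el t)) / min (rho s) (rho t)

/-- Real polynomials in `d` variables of total degree at most `ℓ`. -/
abbrev Poly (d ℓ : ℕ) : Submodule ℝ (MvPolynomial (Fin d) ℝ) :=
  MvPolynomial.restrictTotalDegree (Fin d) ℝ ℓ

/-- The polynomial function on Euclidean space of a polynomial. -/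
def polyFun {d ℓ : ℕ} (p : Poly d ℓ) (x : Eu d) : ℝ :=
  MvPolynomial.eval (fun i => x i) (p : MvPolynomial (Fin d) ℝ)

/-- Continuous functions on the union of two elements that are polynomials of degree at most `ℓ`
on each of them (only the values on the union matter). -/
def pairSpace {d : ℕ} (ℓ : ℕ) (s t : Affine.Simplex ℝ (Eu d) d) : Set (Eu d → ℝ) :=
  {v | ContinuousOn v (el s ∪ el t) ∧
    (∃ p : Poly d ℓ, Set.EqOn v (polyFun p) (el s)) ∧
    ∃ p : Poly d ℓ, Set.EqOn v (polyFun p) (el t)}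

/-- The best error on the pair in the reaction-diffusion norm. -/
def pairError {d : ℕ} (ε : ℝ) (ℓ : ℕ) (s t : Affine.Simplex ℝ (Eu d) d) (u : Eu d → ℝ) : ℝ :=
  ⨅ v : pairSpace ℓ s t, rdNorm ε (el s ∪ el t) (fun x => u x - (v : Eu d → ℝ) x)

/-- The best error on a single element `K` in the trace-augmented norm whose square is
`|||w|||²_K + (|K| / |∂K|) ‖w‖²_{∂K}`. -/
def elError {d : ℕ} (ε : ℝ) (ℓ : ℕ) (s : Affine.Simplex ℝ (Eu d) d) (u : Eu d → ℝ) : ℝ :=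
  ⨅ p : Poly d ℓ, Real.sqrt (rdNorm ε (el s) (fun x => u x - polyFun p x) ^ 2 +
    volume.real (el s) / (surf (el s)).real Set.univ *
      ∫ x, trace (el s) (fun y => u y - polyFun p y) x ^ 2 ∂(surf (el s)))

/-- Conforming simplicial meshes: distinct elements do not overlap, and they meet in the convex
hull of their common vertices. -/
def IsConforming {d n : ℕ} (K : Fin n → Affine.Simplex ℝ (Eu d) d) : Prop :=
  ∀ i j, i ≠ j → Disjoint (interior (el (K i))) (interior (el (K j))) ∧
    el (K i) ∩ el (K j) = convexHull ℝ (Set.range (K i).points ∩ Set.range (K j).points)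

open Classical in
/-- The interelement faces of a mesh, each one given by the two elements that share it. -/
def interFaces {d n : ℕ} (K : Fin n → Affine.Simplex ℝ (Eu d) d) : Finset (Fin n × Fin n) :=
  Finset.univ.filter fun q => q.1 < q.2 ∧ IsPair (K q.1) (K q.2)

end TraceAug

end

noncomputable section

namespace TraceAug

section

variable {d : ℕ}

/-! ### Gradients and weak gradients -/

/-! Let `K₁`, `K₂` share the face `F`, and take arbitrary polynomials `P₁`, `P₂` on the two
elements. It is enough to find corrections `qᵢ` such that `P₁ + q₁` and `P₂ + q₂` agree on `F`, with
`∑ ‖qᵢ‖²` bounded by `∑ |Kᵢ|/|∂Kᵢ| ‖u - Pᵢ‖²_{∂Kᵢ}` and `∑ ‖∇qᵢ‖²` bounded by `∑ ‖∇(u - Pᵢ)‖²_{Kᵢ}`.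
The first bound sees no gradient and the second no boundary term, which is why the constant does not
depend on `ε`.

The correction is built in `exists_base_correction`. Let `cᵢ` be the mean of `u - Pᵢ` over `F`. As
`u` has the same trace from both sides, the jump of `Pᵢ + cᵢ` across `F` is the difference of the
mean-free errors `u - P₂ - c₂` and `u - P₁ - c₁`. It is a polynomial on `F`; let `r` be its lift to
the element of smaller volume, say `K₁`, and put `q₁ = c₁ - r`, `q₂ = c₂`. By scaling and an inverse
inequality (`exists_lift`), `‖r‖²` and `ρ² ‖∇r‖²` are at most a constant times `|K₁|/|F|` times the
squared norm of the jump on `F`. Subtracting the mean does not increase the norm on `F`, which gives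
the `L²` bound; the Poincaré-type inequality `|K|/|F| ‖w - c‖²_F ≲ h² ‖∇w‖²_K` of
`exists_mean_bounds` gives the gradient bound, the quotients `h/ρ` being controlled by the shape
parameter. The choice of the smaller element turns the weight `|K₁|` into `|K₂|` where the error of
`P₂` appears. Finally `|∂K|/|F|` is bounded by `surf_univ_le`.

The Poincaré inequality comes from integrating along segments: two points of `F` are joined through
a third point inside the simplex that depends on both symmetrically (`lintegral_oscillation_le`).

All these inequalities are proved for a smooth `φ` in place of `u`. A single approximating sequence
that is smooth across `F` exists because `K₁ ∪ K₂` is star-shaped with respect to a small ball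
around the barycenter of `F` (`exists_ball_star`, `MemH1.exists_smooth_tendsto`). The corrections
depend on `φ`, but the resulting bound on the best error contains only `φ - Pᵢ` and passes to the
limit (`exists_pairError_sq_le`). That the glued polynomial is admissible, with the piecewise
gradient as its weak gradient, is `isWeakGradient_glue`.

For a mesh, the local estimates are squared and summed; an element has at most one neighbour per
face (`IsConforming.card_neighbours_le`). -/

theorem inner_gradient (f : Eu d → ℝ) (x v : Eu d) :
    inner ℝ (gradient f x) v = fderiv ℝ f x v := by
  simp [gradient]

theorem norm_gradient (f : Eu d → ℝ) (x : Eu d) : ‖gradient f x‖ = ‖fderiv ℝ f x‖ := by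
  simp [gradient]

theorem gradient_sub' {f g : Eu d → ℝ} {x : Eu d} (hf : DifferentiableAt ℝ f x)
    (hg : DifferentiableAt ℝ g x) :
    gradient (fun y => f y - g y) x = gradient f x - gradient g x := by
  simp [gradient, fderiv_fun_sub hf hg]

theorem gradient_add' {f g : Eu d → ℝ} {x : Eu d} (hf : DifferentiableAt ℝ f x)
    (hg : DifferentiableAt ℝ g x) :
    gradient (fun y => f y + g y) x = gradient f x + gradient g x := by
  simp [gradient, fderiv_fun_add hf hg]

theorem gradient_mul' {f g : Eu d → ℝ} {x : Eu d} (hf : DifferentiableAt ℝ f x)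
    (hg : DifferentiableAt ℝ g x) :
    gradient (fun y => f y * g y) x = f x • gradient g x + g x • gradient f x := by
  simp [gradient, fderiv_fun_mul hf hg]

theorem continuous_gradient {f : Eu d → ℝ} (hf : ContDiff ℝ ∞ f) : Continuous (gradient f) :=
  (InnerProductSpace.toDual ℝ (Eu d)).symm.continuous.comp (hf.continuous_fderiv (by simp))

theorem HasCompactSupport.gradient' {f : Eu d → ℝ} (hf : HasCompactSupport f) :
    HasCompactSupport (gradient f) := by
  refine (hf.fderiv ℝ).mono fun x hx => ?_
  simp only [Function.mem_support, ne_eq] at hx ⊢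
  contrapose! hx
  simp [gradient, hx]

theorem tsupport_gradient_subset (f : Eu d → ℝ) : tsupport (gradient f) ⊆ tsupport f := by
  refine (closure_mono fun x hx => ?_ : _ ⊆ tsupport (fderiv ℝ f)).trans (tsupport_fderiv_subset ℝ)
  simp only [Function.mem_support, ne_eq] at hx ⊢
  contrapose! hx
  simp [gradient, hx]

theorem integrable_smul_of_memLp_two {α F : Type*} [MeasurableSpace α] [NormedAddCommGroup F]
    [NormedSpace ℝ F] {μ : Measure α} {φ : α → ℝ} {G : α → F} (hφ : MemLp φ 2 μ)
    (hG : MemLp G 2 μ) : Integrable (fun x => φ x • G x) μ :=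
  memLp_one_iff_integrable.1 (hG.smul hφ)

theorem Continuous.memLp_two_restrict {F : Type*} [NormedAddCommGroup F] {f : Eu d → F}
    {μ : Measure (Eu d)} [IsFiniteMeasureOnCompacts μ] (hf : Continuous f)
    (hs : HasCompactSupport f) (U : Set (Eu d)) : MemLp f 2 (μ.restrict U) :=
  (hf.memLp_of_hasCompactSupport hs).restrict U

theorem IsWeakGradient.mono {U V : Set (Eu d)} {u : Eu d → ℝ} {G : Eu d → Eu d}
    (h : IsWeakGradient V u G) (hUV : U ⊆ V) : IsWeakGradient U u G := by
  intro φ hφ hc hs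
  have h1 := h φ hφ hc (hs.trans hUV)
  have key : ∀ (W : Set (Eu d)) (f : Eu d → Eu d), tsupport φ ⊆ W → (∀ x, x ∉ tsupport φ → f x = 0) →
      ∫ x in W, f x = ∫ x, f x := fun W f hW hf =>
    setIntegral_eq_integral_of_forall_compl_eq_zero fun x hx => hf x fun hx' => hx (hW hx')
  have e1 : ∀ x, x ∉ tsupport φ → u x • gradient φ x = 0 := fun x hx => by
    rw [image_eq_zero_of_notMem_tsupport fun h => hx (tsupport_gradient_subset φ h), smul_zero]
  have e2 : ∀ x, x ∉ tsupport φ → φ x • G x = 0 := fun x hx => by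
    rw [image_eq_zero_of_notMem_tsupport hx, zero_smul]
  rwa [key V _ (hs.trans hUV) e1, key V _ (hs.trans hUV) e2, ← key U _ hs e1,
    ← key U _ hs e2] at h1

theorem MemH1.mono {U V : Set (Eu d)} {u : Eu d → ℝ} (h : MemH1 V u) (hUV : U ⊆ V) :
    MemH1 U u := by
  obtain ⟨hu, G, hG, hw⟩ := h
  exact ⟨hu.mono_measure (Measure.restrict_mono hUV le_rfl), G,
    hG.mono_measure (Measure.restrict_mono hUV le_rfl), hw.mono hUV⟩

theorem IsWeakGradient.sub {U : Set (Eu d)} {u v : Eu d → ℝ} {G H : Eu d → Eu d}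
    (hu : MemLp u 2 (volume.restrict U)) (hv : MemLp v 2 (volume.restrict U))
    (hG : MemLp G 2 (volume.restrict U)) (hH : MemLp H 2 (volume.restrict U))
    (h1 : IsWeakGradient U u G) (h2 : IsWeakGradient U v H) :
    IsWeakGradient U (fun x => u x - v x) (fun x => G x - H x) := by
  intro φ hφ hc hs
  have g1 : MemLp (gradient φ) 2 (volume.restrict U) :=
    Continuous.memLp_two_restrict (continuous_gradient hφ) (HasCompactSupport.gradient' hc) U
  have g0 : MemLp φ 2 (volume.restrict U) := Continuous.memLp_two_restrict hφ.continuous hc U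
  simp only [sub_smul, smul_sub]
  rw [integral_sub (integrable_smul_of_memLp_two hu g1) (integrable_smul_of_memLp_two hv g1),
    integral_sub (integrable_smul_of_memLp_two g0 hG) (integrable_smul_of_memLp_two g0 hH),
    h1 φ hφ hc hs, h2 φ hφ hc hs]
  abel

theorem MemLp.locallyIntegrableOn_of_restrict {F : Type*} [NormedAddCommGroup F] {U : Set (Eu d)}
    {G : Eu d → F} (hG : MemLp G 2 (volume.restrict U)) : LocallyIntegrableOn G U := by
  intro x _
  refine ⟨U ∩ Metric.ball x 1, inter_mem_nhdsWithin U (Metric.ball_mem_nhds x one_pos), ?_⟩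
  have : MemLp G 2 (volume.restrict (U ∩ Metric.ball x 1)) :=
    hG.mono_measure (Measure.restrict_mono Set.inter_subset_left le_rfl)
  have : IsFiniteMeasure (volume.restrict (U ∩ Metric.ball x 1)) :=
    ⟨by
      rw [Measure.restrict_apply_univ]
      exact (measure_mono Set.inter_subset_right).trans_lt Metric.isBounded_ball.measure_lt_top⟩
  exact MemLp.integrable (q := 2) (by norm_num) ‹_›

theorem IsWeakGradient.ae_eq {U : Set (Eu d)} (hU : IsOpen U) {u : Eu d → ℝ} {G H : Eu d → Eu d}
    (hG : MemLp G 2 (volume.restrict U)) (hH : MemLp H 2 (volume.restrict U))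
    (h1 : IsWeakGradient U u G) (h2 : IsWeakGradient U u H) : G =ᵐ[volume.restrict U] H := by
  have hl : LocallyIntegrableOn (fun x => G x - H x) U :=
    MemLp.locallyIntegrableOn_of_restrict (hG.sub hH)
  have := hU.ae_eq_zero_of_integral_contDiff_smul_eq_zero hl fun φ hφ hc hs => by
    have g0 : MemLp φ 2 (volume.restrict U) := Continuous.memLp_two_restrict hφ.continuous hc U
    rw [← setIntegral_eq_integral_of_forall_compl_eq_zero (s := U) fun x hx => by
      rw [image_eq_zero_of_notMem_tsupport fun h => hx (hs h), zero_smul]]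
    simp only [smul_sub]
    rw [integral_sub (integrable_smul_of_memLp_two g0 hG) (integrable_smul_of_memLp_two g0 hH),
      sub_eq_zero]
    exact neg_injective ((h1 φ hφ hc hs).symm.trans (h2 φ hφ hc hs))
  rw [EventuallyEq, ae_restrict_iff' hU.measurableSet]
  filter_upwards [this] with x hx hxU
  exact sub_eq_zero.1 (hx hxU)

theorem MemH1.weakGradient_spec {U : Set (Eu d)} {u : Eu d → ℝ} (h : MemH1 U u) :
    MemLp (weakGradient U u) 2 (volume.restrict U) ∧ IsWeakGradient U u (weakGradient U u) := by
  rw [weakGradient, dif_pos h.2]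
  exact h.2.choose_spec

theorem weakGradient_ae_eq {U : Set (Eu d)} (hU : IsOpen U) {u : Eu d → ℝ} {G : Eu d → Eu d}
    (hG : MemLp G 2 (volume.restrict U)) (h : IsWeakGradient U u G) :
    weakGradient U u =ᵐ[volume.restrict U] G := by
  have h' : ∃ G : Eu d → Eu d, MemLp G 2 (volume.restrict U) ∧ IsWeakGradient U u G := ⟨G, hG, h⟩
  rw [weakGradient, dif_pos h']
  exact h'.choose_spec.2.ae_eq hU h'.choose_spec.1 hG h

/-! ### Gluing smooth functions along a hyperplane -/

/-- A segment between the two sides meets the hyperplane at a point where `f` and `g` agree, and the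
Lipschitz bounds on its two pieces add up, so the constant does not grow. -/
theorem lipschitzWith_glue {lam : Eu d →ᵃ[ℝ] ℝ} {f g : Eu d → ℝ} {C : NNReal}
    (hf : LipschitzWith C f) (hg : LipschitzWith C g) (hfg : ∀ x, lam x = 0 → f x = g x) :
    LipschitzWith C fun x => if 0 ≤ lam x then f x else g x := by
  have key : ∀ x y, 0 ≤ lam x → lam y < 0 → dist (f x) (g y) ≤ C * dist x y := by
    intro x y hx hy
    set t : ℝ := lam x / (lam x - lam y) with ht
    have hpos : 0 < lam x - lam y := by linarith
    have ht0 : 0 ≤ t := div_nonneg hx hpos.le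
    have ht1 : t ≤ 1 := (div_le_one hpos).2 (by linarith)
    set z := AffineMap.lineMap x y t with hz
    have hlz : lam z = 0 := by
      rw [hz, AffineMap.apply_lineMap, AffineMap.lineMap_apply_ring', ht]
      field_simp
      ring
    have h1 := hf.dist_le_mul x z
    have h2 := hg.dist_le_mul z y
    rw [hz, dist_left_lineMap, ← hz, Real.norm_of_nonneg ht0] at h1
    rw [hz, dist_lineMap_right, ← hz, Real.norm_of_nonneg (sub_nonneg.2 ht1)] at h2
    calc dist (f x) (g y) ≤ dist (f x) (f z) + dist (g z) (g y) := by
          rw [← hfg z hlz]; exact dist_triangle _ _ _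
      _ ≤ C * (t * dist x y) + C * ((1 - t) * dist x y) := add_le_add h1 h2
      _ = C * dist x y := by ring
  refine LipschitzWith.of_dist_le_mul fun x y => ?_
  by_cases hx : 0 ≤ lam x <;> by_cases hy : 0 ≤ lam y
  · simpa only [hx, hy, if_true] using hf.dist_le_mul x y
  · simpa only [hx, hy, if_true, if_false] using key x y hx (not_le.1 hy)
  · simpa only [hx, hy, if_true, if_false, dist_comm] using key y x hy (not_le.1 hx)
  · simpa only [hx, hy, if_false] using hg.dist_le_mul x y

theorem volume_zeroSet {lam : Eu d →ᵃ[ℝ] ℝ} (hl : lam.linear ≠ 0) :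
    volume {x | lam x = 0} = 0 := by
  have hset : {x | lam x = 0} = ((AffineSubspace.mk' (0 : ℝ) ⊥).comap lam : AffineSubspace ℝ (Eu d)) := by
    ext x
    simp [AffineSubspace.mem_mk']
  rw [hset]
  refine Measure.addHaar_affineSubspace _ _ fun htop => hl ?_
  have h0 : ∀ x, lam x = 0 := fun x => by
    have : x ∈ {x | lam x = 0} := by rw [hset, htop]; trivial
    exact this
  ext1 v
  have := lam.linearMap_vsub v 0
  simpa [h0] using this

theorem AffineMap.continuous' (lam : Eu d →ᵃ[ℝ] ℝ) : Continuous lam :=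
  lam.continuous_of_finiteDimensional

/-- Multiplied by a test function, the glued function is Lipschitz with compact support, so its
derivative in any direction has integral zero. Off the hyperplane, a null set, that derivative is
given by the product rule on one side. -/
theorem isWeakGradient_glue {lam : Eu d →ᵃ[ℝ] ℝ} (hl : lam.linear ≠ 0) {f g : Eu d → ℝ}
    (hf : ContDiff ℝ ∞ f) (hg : ContDiff ℝ ∞ g) (hfg : ∀ x, lam x = 0 → f x = g x)
    (U : Set (Eu d)) :
    IsWeakGradient U (fun x => if 0 ≤ lam x then f x else g x)
      (fun x => if 0 ≤ lam x then gradient f x else gradient g x) := by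
  refine IsWeakGradient.mono (V := Set.univ) ?_ (Set.subset_univ U)
  intro φ hφ hc _
  simp only [Measure.restrict_univ]
  have hS : MeasurableSet {x | 0 ≤ lam x} := (isClosed_le continuous_const
    (AffineMap.continuous' lam)).measurableSet
  have hint : ∀ {p q : Eu d → Eu d}, Continuous p → Continuous q → HasCompactSupport p →
      HasCompactSupport q → Integrable (fun x => if 0 ≤ lam x then p x else q x) := by
    intro p q hp hq hp' hq'
    classical
    refine (Integrable.piecewise hS (hp.integrable_of_hasCompactSupport hp').integrableOn
      (hq.integrable_of_hasCompactSupport hq').integrableOn).congr (ae_of_all _ fun x => ?_)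
    simp [Set.piecewise]
  have hgφ := continuous_gradient hφ
  have hcφ := HasCompactSupport.gradient' hc
  have i1 : Integrable fun x => (if 0 ≤ lam x then f x else g x) • gradient φ x := by
    simp only [ite_smul]
    exact hint (p := fun x => f x • gradient φ x) (q := fun x => g x • gradient φ x)
      (hf.continuous.smul hgφ) (hg.continuous.smul hgφ) (hcφ.smul_left (f := f))
      (hcφ.smul_left (f := g))
  have i2 : Integrable fun x => φ x • (if 0 ≤ lam x then gradient f x else gradient g x) := by
    simp only [smul_ite]
    exact hint (p := fun x => φ x • gradient f x) (q := fun x => φ x • gradient g x)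
      (hφ.continuous.smul (continuous_gradient hf)) (hφ.continuous.smul (continuous_gradient hg))
      (hc.smul_right (f' := gradient f)) (hc.smul_right (f' := gradient g))
  rw [← add_eq_zero_iff_eq_neg, ← integral_add i1 i2]
  refine ext_inner_left ℝ fun v => ?_
  have i3 : Integrable fun x => (if 0 ≤ lam x then f x else g x) • gradient φ x +
      φ x • (if 0 ≤ lam x then gradient f x else gradient g x) := i1.add i2
  rw [← integral_inner i3, inner_zero_right]
  have c1 : ContDiff ℝ ∞ fun x => f x * φ x := hf.mul hφ
  have c2 : ContDiff ℝ ∞ fun x => g x * φ x := hg.mul hφ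
  obtain ⟨C1, hC1⟩ := c1.lipschitzWith_of_hasCompactSupport hc.mul_left (by simp)
  obtain ⟨C2, hC2⟩ := c2.lipschitzWith_of_hasCompactSupport hc.mul_left (by simp)
  have hL : LipschitzWith (max C1 C2) fun x => if 0 ≤ lam x then f x * φ x else g x * φ x :=
    lipschitzWith_glue (hC1.weaken (le_max_left _ _)) (hC2.weaken (le_max_right _ _))
      fun x hx => by rw [hfg x hx]
  have hLc : HasCompactSupport fun x => if 0 ≤ lam x then f x * φ x else g x * φ x := by
    refine hc.mono fun x hx hx' => hx ?_
    simp [hx']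
  -- Integration by parts against the constant function 1, whose derivative vanishes.
  have hI := LipschitzWith.integral_lineDeriv_mul_eq (μ := (volume : Measure (Eu d)))
    (LipschitzWith.const (1 : ℝ)) hL hLc (-v)
  simp only [neg_neg, mul_one] at hI
  have h0 : (fun x => lineDeriv ℝ (fun _ : Eu d => (1 : ℝ)) x (-v) *
      (if 0 ≤ lam x then f x * φ x else g x * φ x)) = fun _ => 0 := by
    ext x; simp [lineDeriv]
  rw [h0, integral_zero] at hI
  refine (integral_congr_ae ?_).trans hI.symm
  have hz : ∀ᵐ x : Eu d, lam x ≠ 0 := by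
    rw [ae_iff]; simpa using volume_zeroSet hl
  filter_upwards [hz] with x hx
  have hlin : ∀ (p q : Eu d → ℝ), ContDiff ℝ ∞ p → (fun x => q x) =ᶠ[𝓝 x] (fun x => p x * φ x) →
      lineDeriv ℝ q x v = inner ℝ v (p x • gradient φ x + φ x • gradient p x) := by
    intro p q hp hq
    have hd : DifferentiableAt ℝ (fun x => p x * φ x) x :=
      ((hp.mul hφ).differentiable (by simp)).differentiableAt
    rw [hq.lineDeriv_eq, hd.lineDeriv_eq_fderiv, ← gradient_mul'
      (hp.differentiable (by simp)).differentiableAt (hφ.differentiable (by simp)).differentiableAt,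
      real_inner_comm, inner_gradient]
  rcases lt_or_gt_of_ne hx with h | h
  · have hx' : ¬ (0 ≤ lam x) := not_le.2 h
    simp only [hx', if_false]
    refine (hlin g _ hg ?_).symm
    filter_upwards [(AffineMap.continuous' lam).continuousAt.eventually_lt_const h] with y hy
    simp [not_le.2 hy]
  · simp only [h.le, if_true]
    refine (hlin f _ hf ?_).symm
    filter_upwards [(AffineMap.continuous' lam).continuousAt.eventually_const_lt h] with y hy
    simp [le_of_lt hy]

end

section

variable {d : ℕ}

/-! ### Approximation by smooth functions on star-shaped domains -/

section Mollify

open scoped Convolution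
open ContinuousLinearMap (lsmul)

variable {F : Type*} [NormedAddCommGroup F] [NormedSpace ℝ F]

theorem lintegral_comp_smul_add {E : Type*} [NormedAddCommGroup E] [NormedSpace ℝ E]
    [FiniteDimensional ℝ E] [MeasurableSpace E] [BorelSpace E] (μ : Measure E)
    [μ.IsAddHaarMeasure] {c : ℝ} (hc : c ≠ 0) (b : E) {f : E → ENNReal} (hf : Measurable f) :
    ∫⁻ x, f (c • x + b) ∂μ = ENNReal.ofReal |(c ^ Module.finrank ℝ E)⁻¹| * ∫⁻ x, f x ∂μ := by
  rw [← lintegral_map (μ := μ) (f := fun x => f (x + b)) (g := fun x => c • x) (by fun_prop)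
    (by fun_prop), Measure.map_addHaar_smul μ hc, lintegral_smul_measure,
    lintegral_add_right_eq_self f b, smul_eq_mul]

/-- Jensen's inequality: `k` is the density of a probability measure, for which the `L¹` norm is at
most the `L²` norm. -/
theorem enorm_sq_integral_smul_le {α : Type*} [MeasurableSpace α] {μ : Measure α} {k : α → ℝ}
    (hk : Measurable k) (hk0 : ∀ x, 0 ≤ k x) (hki : Integrable k μ) (hk1 : ∫ x, k x ∂μ = 1)
    {f : α → F} (hf : StronglyMeasurable f) :
    ‖∫ x, k x • f x ∂μ‖ₑ ^ 2 ≤ ∫⁻ x, ENNReal.ofReal (k x) * ‖f x‖ₑ ^ 2 ∂μ := by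
  have hm : Measurable fun x => ENNReal.ofReal (k x) := hk.ennreal_ofReal
  set P := μ.withDensity fun x => ENNReal.ofReal (k x) with hP
  have hprob : IsProbabilityMeasure P := ⟨by
    rw [hP, withDensity_apply _ MeasurableSet.univ, Measure.restrict_univ,
      ← ofReal_integral_eq_lintegral_ofReal hki (ae_of_all _ hk0), hk1, ENNReal.ofReal_one]⟩
  have h1 : ‖∫ x, k x • f x ∂μ‖ₑ ≤ eLpNorm f 1 P := by
    refine (enorm_integral_le_lintegral_enorm _).trans_eq ?_
    rw [eLpNorm_one_eq_lintegral_enorm, hP, lintegral_withDensity_eq_lintegral_mul _ hm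
      hf.enorm]
    refine lintegral_congr fun x => ?_
    simp [enorm_smul, Real.enorm_of_nonneg (hk0 x)]
  have h2 := h1.trans (eLpNorm_le_eLpNorm_of_exponent_le (q := 2) (by norm_num)
    hf.aestronglyMeasurable)
  calc ‖∫ x, k x • f x ∂μ‖ₑ ^ 2 ≤ eLpNorm f 2 P ^ 2 := by gcongr
    _ = ∫⁻ x, ‖f x‖ₑ ^ 2 ∂P := by
      have := eLpNorm_nnreal_pow_eq_lintegral (μ := P) (f := f) (p := 2) (by norm_num)
      simpa using this
    _ = _ := by
      rw [hP, lintegral_withDensity_eq_lintegral_mul _ hm (hf.enorm.pow_const 2)]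
      rfl

/-- Young's inequality for a kernel of mass one: Jensen at each point, then Tonelli and translation
invariance. -/
theorem lintegral_enorm_sq_convolution_le (φ : ContDiffBump (0 : Eu d)) {f : Eu d → F}
    (hf : AEStronglyMeasurable f volume) :
    ∫⁻ x, ‖(φ.normed volume ⋆[lsmul ℝ ℝ, volume] f) x‖ₑ ^ 2 ≤ ∫⁻ x, ‖f x‖ₑ ^ 2 := by
  rw [convolution_congr (lsmul ℝ ℝ) (ae_eq_refl _) hf.ae_eq_mk]
  have hfm := hf.stronglyMeasurable_mk
  have e : ∫⁻ x, ‖f x‖ₑ ^ 2 = ∫⁻ x, ‖hf.mk f x‖ₑ ^ 2 :=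
    lintegral_congr_ae (hf.ae_eq_mk.mono fun x hx => by simp only [hx])
  rw [e]
  set g := hf.mk f
  have hk : Measurable (φ.normed volume) := φ.continuous_normed.measurable
  calc ∫⁻ x, ‖(φ.normed volume ⋆[lsmul ℝ ℝ, volume] g) x‖ₑ ^ 2
      ≤ ∫⁻ x, ∫⁻ z, ENNReal.ofReal (φ.normed volume z) * ‖g (x - z)‖ₑ ^ 2 :=
        lintegral_mono fun x => enorm_sq_integral_smul_le hk φ.nonneg_normed φ.integrable_normed
          φ.integral_normed (hfm.comp_measurable (by fun_prop))
    _ = ∫⁻ z, ∫⁻ x, ENNReal.ofReal (φ.normed volume z) * ‖g (x - z)‖ₑ ^ 2 := by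
        refine lintegral_lintegral_swap (Measurable.aemeasurable ?_)
        have h1 : Measurable fun p : Eu d × Eu d => ‖g (p.1 - p.2)‖ₑ ^ 2 :=
          (hfm.enorm.pow_const 2).comp (by fun_prop)
        exact (hk.comp measurable_snd).ennreal_ofReal.mul h1
    _ = ∫⁻ z, ENNReal.ofReal (φ.normed volume z) * ∫⁻ x, ‖g x‖ₑ ^ 2 := by
        refine lintegral_congr fun z => ?_
        have h1 : Measurable fun x => ‖g (x - z)‖ₑ ^ 2 := (hfm.enorm.pow_const 2).comp (by fun_prop)
        rw [lintegral_const_mul _ h1, lintegral_sub_right_eq_self (fun x => ‖g x‖ₑ ^ 2) z]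
    _ = ∫⁻ x, ‖g x‖ₑ ^ 2 := by
        rw [lintegral_mul_const _ hk.ennreal_ofReal, ← ofReal_integral_eq_lintegral_ofReal
          φ.integrable_normed (ae_of_all _ φ.nonneg_normed), φ.integral_normed,
          ENNReal.ofReal_one, one_mul]

/-- The average of `f` over the shifts of the contraction of `x` towards `a`. -/
def mollify (φ : ContDiffBump (0 : Eu d)) (t : ℝ) (a : Eu d) (f : Eu d → F) (x : Eu d) : F :=
  (φ.normed volume ⋆[lsmul ℝ ℝ, volume] f) ((1 - t) • x + t • a)

theorem eLpNorm_two_sq {α G : Type*} [MeasurableSpace α] [NormedAddCommGroup G] (μ : Measure α)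
    (f : α → G) : eLpNorm f 2 μ ^ 2 = ∫⁻ x, ‖f x‖ₑ ^ 2 ∂μ := by
  simpa using eLpNorm_nnreal_pow_eq_lintegral (μ := μ) (f := f) (p := 2) (by norm_num)

theorem contDiff_mollify (φ : ContDiffBump (0 : Eu d)) (t : ℝ) (a : Eu d) {f : Eu d → F}
    (hf : LocallyIntegrable f) : ContDiff ℝ ∞ (mollify φ t a f) := by
  have h : ContDiff ℝ (⊤ : ℕ∞) (φ.normed volume ⋆[lsmul ℝ ℝ, volume] f) :=
    φ.hasCompactSupport_normed.contDiff_convolution_left _ φ.contDiff_normed hf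
  exact h.comp (by fun_prop)

/-- The substitution costs `(1 - t)⁻ᵈ ≤ 2ᵈ` in the squared norm. The constant here is cruder; only
its uniformity in `t` and `φ` matters. -/
theorem eLpNorm_mollify_le (φ : ContDiffBump (0 : Eu d)) {t : ℝ} (ht : t ≤ 1 / 2) (a : Eu d)
    {f : Eu d → F} (hf : LocallyIntegrable f) :
    eLpNorm (mollify φ t a f) 2 volume ≤ 2 ^ d * eLpNorm f 2 volume := by
  have hpos : 0 < 1 - t := by linarith
  have hm : Measurable fun x => ‖(φ.normed volume ⋆[lsmul ℝ ℝ, volume] f) x‖ₑ ^ 2 := by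
    have : Continuous (φ.normed volume ⋆[lsmul ℝ ℝ, volume] f) :=
      (φ.hasCompactSupport_normed.contDiff_convolution_left (n := 0) _ φ.contDiff_normed
        hf).continuous
    exact this.enorm.measurable.pow_const 2
  have key : eLpNorm (mollify φ t a f) 2 volume ^ 2 ≤ (2 ^ d * eLpNorm f 2 volume) ^ 2 := by
    rw [mul_pow, eLpNorm_two_sq, eLpNorm_two_sq]
    unfold mollify
    rw [lintegral_comp_smul_add volume hpos.ne' (t • a) hm]
    refine mul_le_mul' ?_ (lintegral_enorm_sq_convolution_le φ hf.aestronglyMeasurable)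
    rw [finrank_euclideanSpace_fin, abs_of_pos (by positivity), ← inv_pow,
      ENNReal.ofReal_pow (by positivity), ← pow_mul, mul_comm d 2, pow_mul]
    gcongr
    refine (ENNReal.ofReal_le_ofReal (inv_le_of_inv_le₀ (by norm_num) (a := 2) ?_)).trans ?_
    · linarith
    · norm_num
  exact (ENNReal.pow_le_pow_left_iff two_ne_zero).1 key

variable [CompleteSpace F]

theorem tendsto_mollify {φ : ℕ → ContDiffBump (0 : Eu d)} {t : ℕ → ℝ}
    (ht : Tendsto t atTop (𝓝 0)) (hφ : Tendsto (fun n => (φ n).rOut) atTop (𝓝 0)) (a : Eu d)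
    {g : Eu d → F} (hg : Continuous g) (x : Eu d) :
    Tendsto (fun n => mollify (φ n) (t n) a g x) atTop (𝓝 (g x)) := by
  refine ContDiffBump.convolution_tendsto_right (x₀ := x) hφ
    (Eventually.of_forall fun n => hg.aestronglyMeasurable) (hg.tendsto x |>.comp tendsto_snd) ?_
  have : Tendsto (fun n => (1 - t n) • x + t n • a) atTop (𝓝 ((1 - (0 : ℝ)) • x + (0 : ℝ) • a)) :=
    ((tendsto_const_nhds.sub ht).smul_const x).add (ht.smul_const a)
  simpa using this

/-- Dominated convergence: the mollified functions converge pointwise, are uniformly bounded, and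
vanish outside a common ball. -/
theorem tendsto_eLpNorm_mollify_of_continuous {φ : ℕ → ContDiffBump (0 : Eu d)} {t : ℕ → ℝ}
    (ht : Tendsto t atTop (𝓝 0)) (ht0 : ∀ n, 0 ≤ t n) (ht1 : ∀ n, t n ≤ 1 / 2)
    (hφ : Tendsto (fun n => (φ n).rOut) atTop (𝓝 0)) (hφ1 : ∀ n, (φ n).rOut ≤ 1) (a : Eu d)
    {g : Eu d → F} (hg : Continuous g) (hgs : HasCompactSupport g) :
    Tendsto (fun n => eLpNorm (fun x => mollify (φ n) (t n) a g x - g x) 2 volume)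
      atTop (𝓝 0) := by
  obtain ⟨M, hM⟩ := hg.bounded_above_of_compact_support hgs
  have hM0 : 0 ≤ M := (norm_nonneg _).trans (hM 0)
  obtain ⟨R, hR⟩ := hgs.isCompact.isBounded.subset_closedBall (0 : Eu d)
  have hR' : ∀ x, R < ‖x‖ → g x = 0 := fun x hx => by
    by_contra h
    have := hR (subset_tsupport g h)
    simp at this
    linarith
  -- If `‖x‖ > R'` and `t ≤ 1/2`, the contracted point has norm at least `|R| + 1`, so that a bump
  -- of radius at most 1 around it misses the support of `g`.
  set R' : ℝ := 2 * (|R| + ‖a‖ + 1) with hR'def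
  have hbound : ∀ n x, ‖mollify (φ n) (t n) a g x - g x‖ₑ ^ 2 ≤
      (Metric.closedBall (0 : Eu d) R').indicator (fun _ => ENNReal.ofReal ((4 * M) ^ 2)) x := by
    intro n x
    set X := (1 - t n) • x + t n • a with hX
    by_cases hx : x ∈ Metric.closedBall (0 : Eu d) R'
    · rw [Set.indicator_of_mem hx, ← ofReal_norm, ← ENNReal.ofReal_pow (norm_nonneg _)]
      refine ENNReal.ofReal_le_ofReal (pow_le_pow_left₀ (norm_nonneg _) ?_ 2)
      have h1 : dist (mollify (φ n) (t n) a g x) (g X) ≤ 2 * M :=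
        (φ n).dist_normed_convolution_le hg.aestronglyMeasurable fun z _ => by
          rw [dist_eq_norm]
          linarith [norm_sub_le (g z) (g X), hM z, hM X]
      calc ‖mollify (φ n) (t n) a g x - g x‖
          = ‖(mollify (φ n) (t n) a g x - g X) + (g X - g x)‖ := by congr 1; abel
        _ ≤ 2 * M + (M + M) := (norm_add_le _ _).trans (add_le_add (by rwa [← dist_eq_norm])
            ((norm_sub_le _ _).trans (add_le_add (hM _) (hM _))))
        _ = 4 * M := by ring
    · rw [Set.indicator_of_notMem hx]
      have hx' : R' < ‖x‖ := by simpa using hx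
      have hXn : |R| + 1 ≤ ‖X‖ := by
        have h1 : ‖(1 - t n) • x‖ ≤ ‖X‖ + ‖t n • a‖ := by
          have := norm_sub_le X (t n • a)
          rwa [hX, add_sub_cancel_right, ← hX] at this
        rw [norm_smul, norm_smul, Real.norm_of_nonneg (ht0 n),
          Real.norm_of_nonneg (by linarith [ht1 n])] at h1
        nlinarith [ht0 n, ht1 n, norm_nonneg a, norm_nonneg x, abs_nonneg R]
      have hz : ∀ z ∈ Metric.ball X (φ n).rOut, g z = 0 := fun z hz => hR' z <| by
        have h1 := norm_sub_norm_le X z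
        rw [Metric.mem_ball, dist_comm, dist_eq_norm] at hz
        linarith [hφ1 n, le_abs_self R]
      have hgX := hz X (Metric.mem_ball_self (φ n).rOut_pos)
      have hgx : g x = 0 := hR' x (by linarith [le_abs_self R, abs_nonneg R, norm_nonneg a])
      have : mollify (φ n) (t n) a g x = 0 :=
        ((φ n).normed_convolution_eq_right fun z h => (hz z h).trans hgX.symm).trans hgX
      simp [this, hgx]
  have hlim : Tendsto (fun n => ∫⁻ x, ‖mollify (φ n) (t n) a g x - g x‖ₑ ^ 2) atTop (𝓝 0) := by
    have : Tendsto (fun n => ∫⁻ x, ‖mollify (φ n) (t n) a g x - g x‖ₑ ^ 2) atTop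
        (𝓝 (∫⁻ _ : Eu d, 0)) := by
      refine tendsto_lintegral_of_dominated_convergence _ (fun n => ?_) (fun n => ae_of_all _
        (hbound n)) ?_ (ae_of_all _ fun x => ?_)
      · exact (((contDiff_mollify (φ n) (t n) a hg.locallyIntegrable).continuous.sub
          hg).enorm.measurable.pow_const 2)
      · rw [lintegral_indicator_const Metric.isClosed_closedBall.measurableSet]
        exact ENNReal.mul_ne_top ENNReal.ofReal_ne_top
          (isCompact_closedBall _ _).measure_lt_top.ne
      · have h1 := ((tendsto_mollify ht hφ a hg x).sub_const (g x)).enorm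
        rw [sub_self, enorm_zero] at h1
        simpa [Function.comp_def] using (ENNReal.continuous_pow 2).tendsto 0 |>.comp h1
    simpa using this
  have h2 : Tendsto (fun n => (∫⁻ x, ‖mollify (φ n) (t n) a g x - g x‖ₑ ^ 2) ^ (1 / 2 : ℝ)) atTop
      (𝓝 0) := by
    have := (ENNReal.continuous_rpow_const (y := (1 / 2 : ℝ))).tendsto 0 |>.comp hlim
    simpa [Function.comp_def] using this
  refine h2.congr fun n => ?_
  rw [← eLpNorm_two_sq, ← ENNReal.rpow_natCast, ← ENNReal.rpow_mul]
  norm_num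

theorem tendsto_eLpNorm_mollify {φ : ℕ → ContDiffBump (0 : Eu d)} {t : ℕ → ℝ}
    (ht : Tendsto t atTop (𝓝 0)) (ht0 : ∀ n, 0 ≤ t n) (ht1 : ∀ n, t n ≤ 1 / 2)
    (hφ : Tendsto (fun n => (φ n).rOut) atTop (𝓝 0)) (hφ1 : ∀ n, (φ n).rOut ≤ 1) (a : Eu d)
    {f : Eu d → F} (hf : MemLp f 2 volume) :
    Tendsto (fun n => eLpNorm (fun x => mollify (φ n) (t n) a f x - f x) 2 volume)
      atTop (𝓝 0) := by
  have h12 : (1 : ENNReal) ≤ 2 := by norm_num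
  rw [ENNReal.tendsto_nhds_zero]
  intro ε hε
  have hK : (2 ^ d + 2 : ENNReal) ≠ ⊤ := by finiteness
  -- The mollification of `f - g` costs `2ᵈ δ`, the error for the continuous `g` costs `δ`, and `g -
  -- f` costs another `δ`.
  set δ := ε / (2 ^ d + 2) with hδ
  have hδ0 : δ ≠ 0 := (ENNReal.div_pos hε.ne' hK).ne'
  obtain ⟨g, hgs, hgle, hgc, hgL⟩ := hf.exists_hasCompactSupport_eLpNorm_sub_le (by norm_num) hδ0
  have hfg : LocallyIntegrable (f - g) := (hf.sub hgL).locallyIntegrable h12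
  filter_upwards [(ENNReal.tendsto_nhds_zero.1 (tendsto_eLpNorm_mollify_of_continuous ht ht0 ht1 hφ
    hφ1 a hgc hgs)) δ (pos_iff_ne_zero.2 hδ0)] with n hn
  have hadd : mollify (φ n) (t n) a f = mollify (φ n) (t n) a (f - g) + mollify (φ n) (t n) a g := by
    ext x
    have hc := (φ n).hasCompactSupport_normed (μ := (volume : Measure (Eu d)))
    have := (hc.convolutionExists_left (lsmul ℝ ℝ) (φ n).continuous_normed hfg
      ((1 - t n) • x + t n • a)).distrib_add (hc.convolutionExists_left (lsmul ℝ ℝ)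
        (φ n).continuous_normed hgc.locallyIntegrable ((1 - t n) • x + t n • a))
    rw [sub_add_cancel] at this
    exact this
  have hsm : ∀ {h : Eu d → F}, LocallyIntegrable h →
      AEStronglyMeasurable (mollify (φ n) (t n) a h) volume := fun hh =>
    (contDiff_mollify (φ n) (t n) a hh).continuous.aestronglyMeasurable
  calc eLpNorm (fun x => mollify (φ n) (t n) a f x - f x) 2 volume
      = eLpNorm (mollify (φ n) (t n) a (f - g) + ((fun x => mollify (φ n) (t n) a g x - g x)
          + (g - f))) 2 volume := by
        congr 1
        ext x
        simp only [hadd, Pi.add_apply, Pi.sub_apply]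
        abel
    _ ≤ 2 ^ d * δ + (δ + δ) := by
        refine (eLpNorm_add_le (hsm hfg) (((hsm hgc.locallyIntegrable).sub
          hgc.aestronglyMeasurable).add (hgL.1.sub hf.1)) h12).trans (add_le_add ?_ ?_)
        · exact (eLpNorm_mollify_le (φ n) (ht1 n) a hfg).trans (by gcongr)
        · refine (eLpNorm_add_le ((hsm hgc.locallyIntegrable).sub
            hgc.aestronglyMeasurable) (hgL.1.sub hf.1) h12).trans (add_le_add hn ?_)
          rwa [eLpNorm_sub_comm]
    _ = (2 ^ d + 2) * δ := by ring
    _ = ε := ENNReal.mul_div_cancel (by positivity) hK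

/-- Functions that are smooth on the whole space are dense in the Sobolev space of a domain that
is star-shaped with respect to a ball. -/
theorem MemH1.exists_smooth_tendsto {U : Set (Eu d)} (hU : IsOpen U) {a : Eu d} {r : ℝ} (hr : 0 < r)
    (hstar : ∀ x ∈ U, ∀ y ∈ Metric.closedBall a r, ∀ t ∈ Set.Ioo (0 : ℝ) 1,
      (1 - t) • x + t • y ∈ U)
    {u : Eu d → ℝ} {G : Eu d → Eu d} (hu : MemLp u 2 (volume.restrict U))
    (hG : MemLp G 2 (volume.restrict U)) (hw : IsWeakGradient U u G) :
    ∃ f : ℕ → Eu d → ℝ, (∀ n, ContDiff ℝ ∞ (f n)) ∧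
      Tendsto (fun n => eLpNorm (fun x => f n x - u x) 2 (volume.restrict U)) atTop (𝓝 0) ∧
      Tendsto (fun n => eLpNorm (fun x => gradient (f n) x - G x) 2 (volume.restrict U))
        atTop (𝓝 0) := by
  have h12 : (1 : ENNReal) ≤ 2 := by norm_num
  set u' := U.indicator u with hu'
  set G' := U.indicator G with hG'
  have hu'L : MemLp u' 2 volume := (memLp_indicator_iff_restrict hU.measurableSet).2 hu
  have hG'L : MemLp G' 2 volume := (memLp_indicator_iff_restrict hU.measurableSet).2 hG
  have hul : LocallyIntegrable u' := hu'L.locallyIntegrable h12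
  have hGl : LocallyIntegrable G' := hG'L.locallyIntegrable h12
  set r' := min r 1 with hr'
  have hr'0 : 0 < r' := lt_min hr one_pos
  set t : ℕ → ℝ := fun n => 1 / ((n : ℝ) + 2) with ht
  have ht0 : ∀ n, 0 < t n := fun n => by simp only [ht]; positivity
  have ht1 : ∀ n, t n ≤ 1 / 2 := fun n => by
    simp only [ht]
    gcongr
    linarith [(Nat.cast_nonneg n : (0 : ℝ) ≤ n)]
  have htl : Tendsto t atTop (𝓝 0) := by
    have := (tendsto_add_atTop_iff_nat (f := fun n : ℕ => 1 / ((n : ℝ))) 2).2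
      tendsto_one_div_atTop_nhds_zero_nat
    simpa [ht] using this
  -- The radius is proportional to `t`: a point within `r' t` of `(1 - t) x + t a` equals `(1 - t) x
  -- + t y` with `y` in the ball of radius `r` around `a`. Hence for `x ∈ U` the average only sees
  -- points of `U`, and the jump of the zero extension across `∂U` does no harm.
  set φ : ℕ → ContDiffBump (0 : Eu d) := fun n =>
    ⟨r' * t n / 2, r' * t n, by have := ht0 n; positivity, by
      have := ht0 n; exact half_lt_self (by positivity)⟩ with hφ
  have hrout : ∀ n, (φ n).rOut = r' * t n := fun n => rfl
  have hφl : Tendsto (fun n => (φ n).rOut) atTop (𝓝 0) := by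
    simpa [hrout] using htl.const_mul r'
  have hφ1 : ∀ n, (φ n).rOut ≤ 1 := fun n => by
    rw [hrout]
    nlinarith [ht0 n, ht1 n, min_le_right r 1]
  refine ⟨fun n => mollify (φ n) (t n) a u', fun n => contDiff_mollify _ _ _ hul, ?_, ?_⟩
  · refine tendsto_of_tendsto_of_tendsto_of_le_of_le tendsto_const_nhds
      (tendsto_eLpNorm_mollify htl (fun n => (ht0 n).le) ht1 hφl hφ1 a hu'L)
      (fun n => zero_le) fun n => ?_
    refine (eLpNorm_congr_ae ?_).trans_le (eLpNorm_mono_measure _ Measure.restrict_le_self)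
    filter_upwards [ae_restrict_mem hU.measurableSet] with x hx
    simp [hu', hx]
  · have hgrad : ∀ n, ∀ x ∈ U, gradient (mollify (φ n) (t n) a u') x =
        (1 - t n) • mollify (φ n) (t n) a G' x := by
      intro n x hx
      set X := (1 - t n) • x + t n • a with hX
      set κ : Eu d → ℝ := (φ n).normed volume with hκ
      have hκc : HasCompactSupport κ := (φ n).hasCompactSupport_normed
      have hκs : ContDiff ℝ ∞ κ := (φ n).contDiff_normed (n := ⊤)
      have hκd : Differentiable ℝ κ := hκs.differentiable (by simp)
      refine ext_inner_right ℝ fun v => ?_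
      have hder := hκc.hasFDerivAt_convolution_left (lsmul ℝ ℝ) (hκs.of_le (by simp)) hul X
      have haff : HasFDerivAt (fun x : Eu d => (1 - t n) • x + t n • a)
          ((1 - t n) • ContinuousLinearMap.id ℝ (Eu d)) x :=
        ((hasFDerivAt_id x).const_smul (1 - t n)).add_const _
      have hcomp : HasFDerivAt (mollify (φ n) (t n) a u') _ x := hder.comp x haff
      have hex : ConvolutionExistsAt (fderiv ℝ κ) u' X ((lsmul ℝ ℝ).precompL (Eu d)) volume :=
        (hκc.fderiv ℝ).convolutionExists_left _ (hκs.continuous_fderiv (by simp)) hul X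
      have hsub : tsupport (fun z => κ (X - z)) ⊆ U := by
        intro z hz
        have h1 : X - z ∈ tsupport κ := by
          have := tsupport_comp_subset_preimage κ (f := fun z => X - z) (by fun_prop) hz
          exact this
        rw [hκ, (φ n).tsupport_normed_eq, mem_closedBall_zero_iff, hrout] at h1
        have h2 : z = (1 - t n) • x + t n • (a - (t n)⁻¹ • (X - z)) := by
          rw [smul_sub, smul_smul, mul_inv_cancel₀ (ht0 n).ne', one_smul, hX]
          abel
        rw [h2]
        refine hstar x hx _ ?_ _ ⟨ht0 n, by linarith [ht1 n]⟩
        rw [Metric.mem_closedBall, dist_eq_norm, sub_sub_cancel_left, norm_neg, norm_smul,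
          norm_inv, Real.norm_of_nonneg (ht0 n).le, inv_mul_le_iff₀ (ht0 n)]
        nlinarith [min_le_left r 1, ht0 n]
      have hφs : ContDiff ℝ ∞ (fun z => κ (X - z)) := hκs.comp (by fun_prop)
      have hφc : HasCompactSupport (fun z => κ (X - z)) :=
        hκc.comp_homeomorph (Homeomorph.subLeft X)
      have hweak := hw _ hφs hφc hsub
      have hgr : ∀ z, inner ℝ v (gradient (fun z => κ (X - z)) z) = -fderiv ℝ κ (X - z) v := by
        intro z
        rw [real_inner_comm, inner_gradient]
        have := (hκd (X - z)).hasFDerivAt.comp z ((hasFDerivAt_id z).const_sub X)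
        rw [HasFDerivAt.fderiv (f := fun z => κ (X - z)) this]
        simp
      have e1 : fderiv ℝ (mollify (φ n) (t n) a u') x v =
          (1 - t n) * ∫ z in U, u z * fderiv ℝ κ (X - z) v := by
        rw [hcomp.fderiv]
        simp only [ContinuousLinearMap.comp_apply, _root_.smul_apply,
          ContinuousLinearMap.id_apply, map_smul, smul_eq_mul]
        congr 1
        rw [convolution_def, ContinuousLinearMap.integral_apply hex,
          ← integral_sub_left_eq_self _ _ X, ← integral_indicator hU.measurableSet]
        refine integral_congr_ae (ae_of_all _ fun z => ?_)
        by_cases hz : z ∈ U <;> simp [hu', hz, mul_comm, ContinuousLinearMap.precompL_apply]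
      have g1 : MemLp (gradient fun z => κ (X - z)) 2 (volume.restrict U) :=
        Continuous.memLp_two_restrict (continuous_gradient hφs) (HasCompactSupport.gradient' hφc) U
      have g0 : MemLp (fun z => κ (X - z)) 2 (volume.restrict U) :=
        Continuous.memLp_two_restrict hφs.continuous hφc U
      have e2 := congrArg (inner ℝ v) hweak
      rw [← integral_inner (integrable_smul_of_memLp_two hu g1)] at e2
      simp only [inner_smul_right, hgr, mul_neg, integral_neg, inner_neg_right, neg_inj] at e2
      rw [inner_gradient, e1, e2, inner_smul_left, real_inner_comm]
      simp only [conj_trivial]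
      congr 2
      unfold mollify
      rw [convolution_eq_swap, ← integral_indicator hU.measurableSet]
      refine integral_congr_ae (ae_of_all _ fun z => ?_)
      by_cases hz : z ∈ U <;> simp [hG', hz, hX, hκ]
    -- The second term absorbs the difference between the factor `1 - t` and 1.
    have hlim : Tendsto (fun n => eLpNorm (fun x => mollify (φ n) (t n) a G' x - G' x) 2 volume +
        ENNReal.ofReal (t n) * eLpNorm G' 2 volume) atTop (𝓝 0) := by
      have h1 := tendsto_eLpNorm_mollify htl (fun n => (ht0 n).le) ht1 hφl hφ1 a hG'L
      have h2 : Tendsto (fun n => ENNReal.ofReal (t n) * eLpNorm G' 2 volume) atTop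
          (𝓝 (ENNReal.ofReal 0 * eLpNorm G' 2 volume)) :=
        ENNReal.Tendsto.mul_const (ENNReal.tendsto_ofReal htl) (Or.inr hG'L.2.ne)
      simpa using h1.add h2
    refine tendsto_of_tendsto_of_tendsto_of_le_of_le tendsto_const_nhds hlim
      (fun n => zero_le) fun n => ?_
    have hsm : AEStronglyMeasurable (fun x => mollify (φ n) (t n) a G' x - G' x) volume :=
      (contDiff_mollify (φ n) (t n) a hGl).continuous.aestronglyMeasurable.sub hG'L.1
    calc eLpNorm (fun x => gradient (mollify (φ n) (t n) a u') x - G x) 2 (volume.restrict U)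
        = eLpNorm ((1 - t n) • (fun x => mollify (φ n) (t n) a G' x - G' x) + (-t n) • G') 2
          (volume.restrict U) := by
          refine eLpNorm_congr_ae ?_
          filter_upwards [ae_restrict_mem hU.measurableSet] with x hx
          have : G' x = G x := by simp [hG', hx]
          change _ = (1 - t n) • (mollify (φ n) (t n) a G' x - G' x) + (-t n) • G' x
          rw [hgrad n x hx, this]
          module
      _ ≤ eLpNorm ((1 - t n) • (fun x => mollify (φ n) (t n) a G' x - G' x) + (-t n) • G') 2
          volume := eLpNorm_mono_measure _ Measure.restrict_le_self
      _ ≤ _ := by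
          refine (eLpNorm_add_le (hsm.const_smul _) (hG'L.1.const_smul _) h12).trans
            (add_le_add ?_ ?_)
          · rw [eLpNorm_const_smul]
            refine mul_le_of_le_one_left zero_le ?_
            rw [← ofReal_norm, Real.norm_of_nonneg (by linarith [ht1 n])]
            exact ENNReal.ofReal_le_one.2 (by linarith [ht0 n])
          · rw [eLpNorm_const_smul, enorm_neg, ← ofReal_norm, Real.norm_of_nonneg (ht0 n).le]

end Mollify

end

section

/-! ### Parametrization of a simplex and of one of its faces -/

/-- The reference face, a standard simplex. -/
def refFace (m : ℕ) : Set (Fin m → ℝ) := {y | (∀ i, 0 ≤ y i) ∧ ∑ i, y i ≤ 1}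

/-- The reference simplex, with the reference face in the hyperplane where the first coordinate
vanishes. -/
def refSimplex (m : ℕ) : Set (ℝ × (Fin m → ℝ)) :=
  {p | 0 ≤ p.1 ∧ (∀ i, 0 ≤ p.2 i) ∧ p.1 + ∑ i, p.2 i ≤ 1}

variable {m : ℕ}

/-- The simplex spanned by an affine basis. -/
def hull (b : AffineBasis (Fin (m + 2)) ℝ (Eu (m + 1))) : Set (Eu (m + 1)) :=
  convexHull ℝ (Set.range b)

/-- The face opposite to the vertex with index zero. -/
def base (b : AffineBasis (Fin (m + 2)) ℝ (Eu (m + 1))) : Set (Eu (m + 1)) :=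
  convexHull ℝ (Set.range fun i : Fin (m + 1) => b i.succ)

/-- The linear part of the parametrization of a simplex. -/
def paramLin (b : AffineBasis (Fin (m + 2)) ℝ (Eu (m + 1))) :
    (ℝ × (Fin m → ℝ)) →ₗ[ℝ] Eu (m + 1) where
  toFun p := p.1 • (b 0 - b 1) + ∑ i, p.2 i • (b i.succ.succ - b 1)
  map_add' p q := by
    simp only [Prod.fst_add, Prod.snd_add, Pi.add_apply, add_smul, Finset.sum_add_distrib]
    abel
  map_smul' c p := by
    simp only [Prod.smul_fst, Prod.smul_snd, Pi.smul_apply, smul_eq_mul, mul_smul, smul_add,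
      Finset.smul_sum, RingHom.id_apply]

theorem paramLin_apply (b : AffineBasis (Fin (m + 2)) ℝ (Eu (m + 1))) (p : ℝ × (Fin m → ℝ)) :
    paramLin b p = p.1 • (b 0 - b 1) + ∑ i, p.2 i • (b i.succ.succ - b 1) := rfl

/-- The affine parametrization of a simplex over the reference simplex. -/
def param (b : AffineBasis (Fin (m + 2)) ℝ (Eu (m + 1))) (p : ℝ × (Fin m → ℝ)) : Eu (m + 1) :=
  b 1 + paramLin b p

variable (b : AffineBasis (Fin (m + 2)) ℝ (Eu (m + 1)))

theorem coord_linear_vertex (j k l : Fin (m + 2)) :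
    (b.coord j).linear (b k - b l) = b.coord j (b k) - b.coord j (b l) := by
  rw [← vsub_eq_sub, AffineMap.linearMap_vsub, vsub_eq_sub]

theorem coord_param (j : Fin (m + 2)) (p : ℝ × (Fin m → ℝ)) :
    b.coord j (param b p) = b.coord j (b 1) + (b.coord j).linear (paramLin b p) := by
  rw [show param b p = paramLin b p +ᵥ b 1 from add_comm _ _, AffineMap.map_vadd, vadd_eq_add,
    add_comm]

theorem coord_zero_param (p : ℝ × (Fin m → ℝ)) : b.coord 0 (param b p) = p.1 := by
  rw [coord_param, paramLin_apply]
  simp [-AffineBasis.linear_eq_sumCoords, coord_linear_vertex,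
    (Fin.succ_ne_zero _).symm]

theorem coord_succ_succ_param (i : Fin m) (p : ℝ × (Fin m → ℝ)) :
    b.coord i.succ.succ (param b p) = p.2 i := by
  rw [coord_param, paramLin_apply]
  have h1 : ¬ (i.succ.succ = (1 : Fin (m + 2))) := by
    rw [← Fin.succ_zero_eq_one, Fin.succ_inj]
    exact Fin.succ_ne_zero i
  simp [-AffineBasis.linear_eq_sumCoords, coord_linear_vertex, AffineBasis.coord_apply, h1]

theorem coord_one (x : Eu (m + 1)) :
    b.coord 1 x = 1 - b.coord 0 x - ∑ i : Fin m, b.coord i.succ.succ x := by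
  have := b.sum_coord_apply_eq_one x
  rw [Fin.sum_univ_succ, Fin.sum_univ_succ, Fin.succ_zero_eq_one] at this
  linarith

theorem param_coord (x : Eu (m + 1)) :
    param b (b.coord 0 x, fun i => b.coord i.succ.succ x) = x := by
  refine b.ext_elem fun j => ?_
  refine Fin.cases ?_ (fun j => ?_) j
  · rw [coord_zero_param]
  · refine Fin.cases ?_ (fun j => ?_) j
    · rw [Fin.succ_zero_eq_one, coord_one, coord_one, coord_zero_param]
      simp only [coord_succ_succ_param]
    · rw [coord_succ_succ_param]

theorem paramLin_injective : Function.Injective (paramLin b) := by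
  intro p q h
  have h' : param b p = param b q := by rw [param, param, h]
  ext i
  · rw [← coord_zero_param b p, h', coord_zero_param]
  · rw [← coord_succ_succ_param b i p, h', coord_succ_succ_param]

theorem continuous_param : Continuous (param b) :=
  continuous_const.add (paramLin b).continuous_of_finiteDimensional

theorem mem_hull_iff (x : Eu (m + 1)) : x ∈ hull b ↔ ∀ i, 0 ≤ b.coord i x := by
  rw [hull, b.convexHull_eq_nonneg_coord]
  rfl

theorem mem_base_iff (x : Eu (m + 1)) : x ∈ base b ↔ x ∈ hull b ∧ b.coord 0 x = 0 := by
  constructor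
  · intro hx
    refine ⟨convexHull_mono (by rintro _ ⟨i, rfl⟩; exact ⟨i.succ, rfl⟩) hx, ?_⟩
    have hc : Convex ℝ {x | b.coord 0 x = 0} :=
      (convex_singleton (0 : ℝ)).affine_preimage (b.coord 0)
    exact convexHull_min (by rintro _ ⟨i, rfl⟩; simp [(Fin.succ_ne_zero _).symm]) hc hx
  · rintro ⟨hx, h0⟩
    rw [mem_hull_iff] at hx
    have h1 := b.linear_combination_coord_eq_self x
    have h2 := b.sum_coord_apply_eq_one x
    rw [Fin.sum_univ_succ, h0, zero_add] at h2
    rw [Fin.sum_univ_succ, h0, zero_smul, zero_add] at h1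
    rw [← h1]
    exact (convex_convexHull ℝ _).sum_mem (fun i _ => hx _) h2
      fun i _ => subset_convexHull ℝ _ ⟨i, rfl⟩

theorem isCompact_hull : IsCompact (hull b) :=
  (Set.finite_range _).isCompact_convexHull ℝ

theorem isCompact_base : IsCompact (base b) :=
  (Set.finite_range _).isCompact_convexHull ℝ

theorem base_subset_hull : base b ⊆ hull b := fun x hx => ((mem_base_iff b x).1 hx).1

theorem param_mem_hull_iff (p : ℝ × (Fin m → ℝ)) : param b p ∈ hull b ↔ p ∈ refSimplex m := by
  rw [mem_hull_iff, Fin.forall_fin_succ, Fin.forall_fin_succ, Fin.succ_zero_eq_one, coord_one]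
  simp only [coord_zero_param, coord_succ_succ_param]
  constructor
  · rintro ⟨h1, h2, h3⟩
    exact ⟨h1, h3, by linarith⟩
  · rintro ⟨h1, h2, h3⟩
    exact ⟨h1, by linarith, h2⟩

theorem param_mem_base_iff (y : Fin m → ℝ) : param b (0, y) ∈ base b ↔ y ∈ refFace m := by
  rw [mem_base_iff, param_mem_hull_iff, coord_zero_param]
  simp [refSimplex, refFace]

/-- The parametrization as a linear equivalence. -/
def paramEquiv : (ℝ × (Fin m → ℝ)) ≃ₗ[ℝ] Eu (m + 1) :=
  LinearEquiv.ofBijective (paramLin b) ⟨paramLin_injective b, fun x =>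
    ⟨(b.coord 0 (b 1 + x), fun i => b.coord i.succ.succ (b 1 + x)), by
      have := param_coord b (b 1 + x)
      rw [param] at this
      exact add_left_cancel this⟩⟩

/-- Uniqueness of Haar measure up to a scalar. The factor is left abstract: it is the same in every
integral over the simplex, so it cancels from the uniform estimates. -/
theorem exists_volume_hull_eq : ∃ α : ENNReal, α ≠ 0 ∧ α ≠ ⊤ ∧
    volume.restrict (hull b) =
      α • (volume.restrict (refSimplex m)).map (param b) := by
  set ν : Measure (Eu (m + 1)) := Measure.map (paramEquiv b) volume with hν
  have hv : (volume : Measure (ℝ × (Fin m → ℝ))).IsAddHaarMeasure :=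
    Measure.prod.instIsAddHaarMeasure _ _
  have hh : ν.IsAddHaarMeasure := (inferInstance :
    (Measure.map (paramEquiv b) (volume : Measure (ℝ × (Fin m → ℝ)))).IsAddHaarMeasure)
  have hmeas : Measurable (paramEquiv b) :=
    (paramEquiv b).toLinearMap.continuous_of_finiteDimensional.measurable
  have h1 := Measure.isAddLeftInvariant_eq_smul (volume : Measure (Eu (m + 1))) ν
  set c := Measure.addHaarScalarFactor (volume : Measure (Eu (m + 1))) ν
  have hpm : Measurable (param b) := (continuous_param b).measurable
  have h2 : Measure.map (param b) volume = ν := by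
    have h3 : Measure.map (param b) volume = Measure.map (fun x => b 1 + x) ν := by
      rw [hν, Measure.map_map (by fun_prop) hmeas]
      rfl
    rw [h3, map_add_left_eq_self]
  refine ⟨c, ?_, ENNReal.coe_ne_top, ?_⟩
  · intro hc
    have hc' : c = 0 := by exact_mod_cast hc
    rw [hc', zero_smul] at h1
    exact NeZero.ne (volume : Measure (Eu (m + 1))) h1
  · have hpre : param b ⁻¹' hull b = refSimplex m := Set.ext fun p => param_mem_hull_iff b p
    rw [← hpre, ← Measure.restrict_map hpm (isCompact_hull b).isClosed.measurableSet, h2]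
    conv_lhs => rw [h1]
    rw [Measure.restrict_smul]
    rfl

/-- Uniqueness of Haar measure on the `m`-dimensional direction space of the face, carried to the
face by an isometric translation. -/
theorem exists_hausdorff_base_eq : ∃ β : ENNReal, β ≠ 0 ∧ β ≠ ⊤ ∧
    (Measure.euclideanHausdorffMeasure m).restrict (base b) =
      β • (volume.restrict (refFace m)).map (fun y => param b (0, y)) := by
  set L : (Fin m → ℝ) →ₗ[ℝ] Eu (m + 1) := (paramLin b).comp (LinearMap.inr ℝ ℝ (Fin m → ℝ)) with hL
  have hLi : Function.Injective L := (paramLin_injective b).comp LinearMap.inr_injective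
  set e := LinearEquiv.ofInjective L hLi with he
  have hfin : Module.finrank ℝ (LinearMap.range L) = m := by
    rw [← e.finrank_eq]; simp
  set ν : Measure (LinearMap.range L) := Measure.map e volume with hν
  have hh : ν.IsAddHaarMeasure := (inferInstance :
    (Measure.map e (volume : Measure (Fin m → ℝ))).IsAddHaarMeasure)
  have hH : (Measure.euclideanHausdorffMeasure m :
      Measure (LinearMap.range L)).IsAddHaarMeasure := by
    have := isAddHaarMeasure_euclideanHausdorffMeasure (E := LinearMap.range L)
    rwa [hfin] at this
  have h1 := Measure.isAddLeftInvariant_eq_smul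
    (Measure.euclideanHausdorffMeasure m : Measure (LinearMap.range L)) ν
  set c := Measure.addHaarScalarFactor
    (Measure.euclideanHausdorffMeasure m : Measure (LinearMap.range L)) ν
  have hmeas : Measurable e := e.toLinearMap.continuous_of_finiteDimensional.measurable
  set f : LinearMap.range L → Eu (m + 1) := fun x => b 1 + x with hf
  have hfi : Isometry f := (isometry_add_left (b 1)).comp isometry_subtype_coe
  have h2 := hfi.map_euclideanHausdorffMeasure (d := m)
  have hpm : Measurable fun y => param b (0, y) := by
    have := (continuous_param b).measurable
    fun_prop
  have h3 : Measure.map f ν = Measure.map (fun y => param b (0, y)) volume := by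
    rw [hν, Measure.map_map hfi.continuous.measurable hmeas]
    rfl
  have hsub : base b ⊆ Set.range f := by
    intro x hx
    refine ⟨e (fun i => b.coord i.succ.succ x), ?_⟩
    have h := param_coord b x
    rw [((mem_base_iff b x).1 hx).2] at h
    exact h
  refine ⟨c, ?_, ENNReal.coe_ne_top, ?_⟩
  · intro hc
    have hc' : c = 0 := by exact_mod_cast hc
    rw [hc', zero_smul] at h1
    exact NeZero.ne (Measure.euclideanHausdorffMeasure m : Measure (LinearMap.range L)) h1
  · have hpre : (fun y => param b (0, y)) ⁻¹' base b = refFace m :=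
      Set.ext fun p => param_mem_base_iff b p
    rw [← hpre, ← Measure.restrict_map hpm (isCompact_base b).isClosed.measurableSet, ← h3,
      ← Measure.restrict_restrict_of_subset hsub, ← h2]
    conv_lhs => rw [h1]
    rw [Measure.map_smul, Measure.restrict_smul]
    rfl

end

section

/-! ### Trace inequalities for smooth functions -/

theorem lintegral_sq_le {α : Type*} [MeasurableSpace α] (μ : Measure α) {g : α → ENNReal}
    (hg : AEMeasurable g μ) : (∫⁻ x, g x ∂μ) ^ 2 ≤ μ Set.univ * ∫⁻ x, g x ^ 2 ∂μ := by
  have h := ENNReal.lintegral_mul_le_Lp_mul_Lq μ (p := 2) (q := 2)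
    (Real.holderConjugate_iff.2 ⟨by norm_num, by norm_num⟩) (f := fun _ => 1) (g := g)
    aemeasurable_const hg
  simp only [Pi.mul_apply, one_mul, ENNReal.rpow_two] at h
  calc (∫⁻ x, g x ∂μ) ^ 2
      ≤ (μ Set.univ ^ (1 / 2 : ℝ) * (∫⁻ x, g x ^ 2 ∂μ) ^ (1 / 2 : ℝ)) ^ 2 := by
        gcongr
        simpa using h
    _ = _ := by
        rw [mul_pow, ← ENNReal.rpow_natCast, ← ENNReal.rpow_natCast, ← ENNReal.rpow_mul,
          ← ENNReal.rpow_mul]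
        norm_num

theorem enorm_sub_sq_le (x y z : ℝ) :
    ‖x - y‖ₑ ^ 2 ≤ 2 * (‖x - z‖ₑ ^ 2 + ‖y - z‖ₑ ^ 2) := by
  have e : ∀ t : ℝ, ‖t‖ₑ ^ 2 = ENNReal.ofReal (t ^ 2) := fun t => by
    rw [← ofReal_norm, ← ENNReal.ofReal_pow (norm_nonneg _), Real.norm_eq_abs, sq_abs]
  rw [e, e, e, ← ENNReal.ofReal_add (sq_nonneg _) (sq_nonneg _),
    show (2 : ENNReal) = ENNReal.ofReal 2 by simp, ← ENNReal.ofReal_mul (by norm_num)]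
  refine ENNReal.ofReal_le_ofReal ?_
  nlinarith [sq_nonneg (x - z + (y - z))]

/-- The fundamental theorem of calculus on the segment, followed by Cauchy–Schwarz. -/
theorem enorm_sq_path_le {d : ℕ} {w : Eu d → ℝ} (hw : ContDiff ℝ ∞ w) (p v : Eu d) {s : ℝ}
    (hs : 0 ≤ s) :
    ‖w p - w (p + s • v)‖ₑ ^ 2 ≤ ENNReal.ofReal s * ‖v‖ₑ ^ 2 *
      ∫⁻ τ in Set.Icc 0 s, ‖gradient w (p + τ • v)‖ₑ ^ 2 := by
  have hder : ∀ τ : ℝ, HasDerivAt (fun τ : ℝ => w (p + τ • v)) (fderiv ℝ w (p + τ • v) v) τ := by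
    intro τ
    have h1 : HasDerivAt (fun τ : ℝ => p + τ • v) v τ := by
      simpa using ((hasDerivAt_id τ).smul_const v).const_add p
    exact (hw.differentiable (by simp) (p + τ • v)).hasFDerivAt.comp_hasDerivAt τ h1
  have hcont : Continuous fun τ : ℝ => fderiv ℝ w (p + τ • v) v := by
    have := hw.continuous_fderiv (by simp)
    fun_prop
  have hgc : Continuous fun τ : ℝ => gradient w (p + τ • v) :=
    (continuous_gradient hw).comp (by fun_prop)
  have hint := intervalIntegral.integral_eq_sub_of_hasDerivAt (a := 0) (b := s)
    (fun τ _ => hder τ) (hcont.intervalIntegrable _ _)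
  rw [zero_smul, add_zero] at hint
  have h1 : ‖w p - w (p + s • v)‖ₑ ≤
      ∫⁻ τ in Set.Icc 0 s, ‖v‖ₑ * ‖gradient w (p + τ • v)‖ₑ := by
    rw [← neg_sub, enorm_neg, ← hint, intervalIntegral.integral_of_le hs,
      ← integral_Icc_eq_integral_Ioc]
    refine (enorm_integral_le_lintegral_enorm _).trans (lintegral_mono fun τ => ?_)
    rw [← inner_gradient, mul_comm, ← ofReal_norm, ← ofReal_norm, ← ofReal_norm,
      ← ENNReal.ofReal_mul (norm_nonneg _)]
    exact ENNReal.ofReal_le_ofReal (norm_inner_le_norm _ _)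
  calc ‖w p - w (p + s • v)‖ₑ ^ 2
      ≤ (∫⁻ τ in Set.Icc 0 s, ‖v‖ₑ * ‖gradient w (p + τ • v)‖ₑ) ^ 2 := by gcongr
    _ ≤ ENNReal.ofReal s * ∫⁻ τ in Set.Icc 0 s, (‖v‖ₑ * ‖gradient w (p + τ • v)‖ₑ) ^ 2 := by
        refine (lintegral_sq_le _ ?_).trans_eq ?_
        · exact (hgc.enorm.measurable.const_mul _).aemeasurable
        · simp
    _ = _ := by
        simp only [mul_pow]
        rw [lintegral_const_mul _ (hgc.enorm.measurable.pow_const 2), mul_assoc]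

variable {m : ℕ}

/-! ### The reference domains and segments in them -/

theorem isClosed_refFace : IsClosed (refFace m) := by
  simp only [refFace, Set.ofPred_and, Set.ofPred_forall]
  exact (isClosed_iInter fun i => isClosed_le continuous_const (by fun_prop)).inter
    (isClosed_le (by fun_prop) continuous_const)

theorem isClosed_refSimplex : IsClosed (refSimplex m) := by
  simp only [refSimplex, Set.ofPred_and, Set.ofPred_forall]
  exact (isClosed_le continuous_const (by fun_prop)).inter
    ((isClosed_iInter fun i => isClosed_le continuous_const (by fun_prop)).inter
    (isClosed_le (by fun_prop) continuous_const))

theorem isCompact_refFace : IsCompact (refFace m) := by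
  refine (isCompact_Icc (a := (0 : Fin m → ℝ)) (b := 1)).of_isClosed_subset isClosed_refFace
    fun y hy => ⟨fun i => hy.1 i, fun i => ?_⟩
  exact (Finset.single_le_sum (fun j _ => hy.1 j) (Finset.mem_univ i)).trans hy.2

theorem refSimplex_subset : refSimplex m ⊆ Set.Icc (0 : ℝ) 1 ×ˢ refFace m := by
  rintro p ⟨h1, h2, h3⟩
  have := Finset.sum_nonneg fun i (_ : i ∈ Finset.univ) => h2 i
  exact ⟨⟨h1, by linarith⟩, h2, by linarith⟩

theorem isCompact_refSimplex : IsCompact (refSimplex m) :=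
  (isCompact_Icc.prod isCompact_refFace).of_isClosed_subset isClosed_refSimplex refSimplex_subset

theorem box_subset_refFace :
    Set.pi Set.univ (fun _ : Fin m => Set.Ioo (0 : ℝ) (1 / (m + 1))) ⊆ refFace m := by
  intro y hy
  simp only [Set.mem_pi, Set.mem_univ, true_implies] at hy
  refine ⟨fun i => (hy i).1.le, ?_⟩
  calc ∑ i, y i ≤ ∑ _i : Fin m, (1 / (m + 1) : ℝ) := Finset.sum_le_sum fun i _ => (hy i).2.le
    _ ≤ 1 := by
        simp only [Finset.sum_const, Finset.card_univ, Fintype.card_fin, nsmul_eq_mul]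
        rw [mul_one_div, div_le_one (by positivity)]
        linarith

theorem volume_refFace_ne_zero : volume (refFace m) ≠ 0 := by
  have h : 0 < volume (Set.pi Set.univ (fun _ : Fin m => Set.Ioo (0 : ℝ) (1 / (m + 1)))) :=
    (isOpen_set_pi Set.finite_univ fun _ _ => isOpen_Ioo).measure_pos _
      ⟨fun _ => 1 / (2 * (m + 1)), fun i _ => ⟨by positivity, by
        refine one_div_lt_one_div_of_lt (by positivity) ?_
        linarith [(Nat.cast_nonneg m : (0 : ℝ) ≤ m)]⟩⟩
  exact (h.trans_le (measure_mono box_subset_refFace)).ne'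

/-- The point is the convex combination of the apex, `y` and `y'` with weights `s`, `1 - 2s`, `s`.
The range up to `1/3` lets the path end at the barycenter of the three points, which is symmetric in
`y` and `y'`, and keeps `1 - 2s ≥ 1/3`. -/
theorem path_mem_refSimplex {y y' : Fin m → ℝ} (hy : y ∈ refFace m) (hy' : y' ∈ refFace m) {s : ℝ}
    (hs : s ∈ Set.Icc (0 : ℝ) (1 / 3)) : (s, (1 - 2 * s) • y + s • y') ∈ refSimplex m := by
  obtain ⟨h0, h1⟩ := hs
  refine ⟨h0, fun i => ?_, ?_⟩
  · have := hy.1 i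
    have := hy'.1 i
    simp only [Pi.add_apply, Pi.smul_apply, smul_eq_mul]
    have : 0 ≤ 1 - 2 * s := by linarith
    positivity
  · simp only [Pi.add_apply, Pi.smul_apply, smul_eq_mul, Finset.sum_add_distrib, ← Finset.mul_sum]
    nlinarith [hy.2, hy'.2]

/-- For fixed `s` and `y'` the map `y ↦ (1 - 2s) y + s y'` is a dilation of ratio at least `1/3`
followed by a translation, so the substitution costs at most `3ᵐ`; Tonelli assembles the slices. -/
theorem lintegral_path_le {f : ℝ × (Fin m → ℝ) → ENNReal} (hf : Measurable f) {y' : Fin m → ℝ}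
    (hy' : y' ∈ refFace m) :
    ∫⁻ y in refFace m, ∫⁻ s in Set.Icc (0 : ℝ) (1 / 3), f (s, (1 - 2 * s) • y + s • y') ≤
      3 ^ m * ∫⁻ p in refSimplex m, f p := by
  set g := (refSimplex m).indicator f with hg
  have hgm : Measurable g := hf.indicator isClosed_refSimplex.measurableSet
  rw [lintegral_lintegral_swap (by
    have : Measurable fun p : (Fin m → ℝ) × ℝ => f (p.2, (1 - 2 * p.2) • p.1 + p.2 • y') :=
      hf.comp (by fun_prop)
    exact this.aemeasurable)]
  calc ∫⁻ s in Set.Icc (0 : ℝ) (1 / 3), ∫⁻ y in refFace m, f (s, (1 - 2 * s) • y + s • y')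
      ≤ ∫⁻ s in Set.Icc (0 : ℝ) (1 / 3), 3 ^ m * ∫⁻ y, g (s, y) := by
        refine setLIntegral_mono' measurableSet_Icc fun s hs => ?_
        have hpos : 1 / 3 ≤ 1 - 2 * s := by linarith [hs.2]
        calc ∫⁻ y in refFace m, f (s, (1 - 2 * s) • y + s • y')
            = ∫⁻ y in refFace m, g (s, (1 - 2 * s) • y + s • y') :=
              setLIntegral_congr_fun isClosed_refFace.measurableSet fun y hy => by
                rw [hg, Set.indicator_of_mem (path_mem_refSimplex hy hy' hs)]
          _ ≤ ∫⁻ y, g (s, (1 - 2 * s) • y + s • y') := setLIntegral_le_lintegral _ _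
          _ = ENNReal.ofReal |((1 - 2 * s) ^ m)⁻¹| * ∫⁻ y, g (s, y) := by
              have := lintegral_comp_smul_add (volume : Measure (Fin m → ℝ))
                (c := 1 - 2 * s) (by linarith) (s • y') (f := fun y => g (s, y))
                (hgm.comp (by fun_prop))
              simpa using this
          _ ≤ 3 ^ m * ∫⁻ y, g (s, y) := by
              gcongr
              rw [abs_of_pos (by positivity), ← inv_pow, ENNReal.ofReal_pow (by positivity)]
              gcongr
              refine (ENNReal.ofReal_le_ofReal (inv_anti₀ (by norm_num) hpos)).trans ?_
              norm_num
    _ ≤ ∫⁻ s, 3 ^ m * ∫⁻ y, g (s, y) := setLIntegral_le_lintegral _ _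
    _ = 3 ^ m * ∫⁻ p in refSimplex m, f p := by
        rw [lintegral_const_mul _ hgm.lintegral_prod_right', ← lintegral_indicator
          isClosed_refSimplex.measurableSet, Measure.volume_eq_prod,
          lintegral_prod _ hgm.aemeasurable]

/-! ### Oscillation and trace on a face, by integration along segments -/

variable (b : AffineBasis (Fin (m + 2)) ℝ (Eu (m + 1)))

theorem param_path (y y' : Fin m → ℝ) (s : ℝ) :
    param b (s, (1 - 2 * s) • y + s • y') = param b (0, y) + s • paramLin b (1, y' - (2 : ℝ) • y) := by
  rw [param, param, add_assoc, ← map_smul, ← map_add]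
  congr 2
  ext i
  · simp
  · simp only [Pi.add_apply, Pi.smul_apply, smul_eq_mul, Prod.smul_mk, Prod.mk_add_mk, Pi.sub_apply]
    ring

/-- The velocity of the path is the sum of the two chords from `y` to the apex and from `y` to `y'`.
-/
theorem norm_path_le {y y' : Fin m → ℝ} (hy : y ∈ refFace m) (hy' : y' ∈ refFace m) :
    ‖paramLin b (1, y' - (2 : ℝ) • y)‖ ≤ 2 * Metric.diam (hull b) := by
  have hb : Bornology.IsBounded (hull b) := (isCompact_hull b).isBounded
  have h0 : param b (1, 0) ∈ hull b := (param_mem_hull_iff b _).2 (by simp [refSimplex])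
  have h1 := base_subset_hull b ((param_mem_base_iff b y).2 hy)
  have h2 := base_subset_hull b ((param_mem_base_iff b y').2 hy')
  have e : paramLin b (1, y' - (2 : ℝ) • y) = (param b (1, 0) - param b (0, y)) +
      (param b (0, y') - param b (0, y)) := by
    simp only [param, add_sub_add_left_eq_sub, ← map_sub, ← map_add]
    congr 1
    ext i
    · simp
    · simp only [Prod.mk_sub_mk, Prod.mk_add_mk, Pi.add_apply, Pi.sub_apply, Pi.smul_apply,
        smul_eq_mul, Pi.zero_apply]
      ring
  rw [e, two_mul]
  refine (norm_add_le _ _).trans (add_le_add ?_ ?_)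
  · rw [← dist_eq_norm]; exact Metric.dist_le_diam_of_mem hb h0 h1
  · rw [← dist_eq_norm]; exact Metric.dist_le_diam_of_mem hb h2 h1

variable {b} in
theorem enorm_sq_path_param_le {w : Eu (m + 1) → ℝ} (hw : ContDiff ℝ ∞ w) {y y' : Fin m → ℝ}
    (hy : y ∈ refFace m) (hy' : y' ∈ refFace m) {s : ℝ} (hs : s ∈ Set.Icc (0 : ℝ) (1 / 3)) :
    ‖w (param b (0, y)) - w (param b (s, (1 - 2 * s) • y + s • y'))‖ₑ ^ 2 ≤
      ENNReal.ofReal (2 * Metric.diam (hull b) ^ 2) * ∫⁻ τ in Set.Icc (0 : ℝ) (1 / 3),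
        ‖gradient w (param b (τ, (1 - 2 * τ) • y + τ • y'))‖ₑ ^ 2 := by
  simp only [param_path]
  refine (enorm_sq_path_le hw _ _ hs.1).trans ?_
  refine mul_le_mul' ?_ (lintegral_mono_set (Set.Icc_subset_Icc_right hs.2))
  rw [← ofReal_norm, ← ENNReal.ofReal_pow (norm_nonneg _), ← ENNReal.ofReal_mul hs.1]
  refine ENNReal.ofReal_le_ofReal ?_
  have h1 := pow_le_pow_left₀ (norm_nonneg _) (norm_path_le b hy hy') 2
  nlinarith [hs.1, hs.2, sq_nonneg (Metric.diam (hull b))]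

/-- The paths that start at `y` and at `y'` end at the same interior point, so `w y - w y'` is
controlled by the gradient along both. Integrating over one starting point with the other fixed
already covers the simplex with bounded multiplicity, so the remaining integration costs only the
measure of the face. -/
theorem lintegral_oscillation_le {w : Eu (m + 1) → ℝ} (hw : ContDiff ℝ ∞ w) :
    ∫⁻ y in refFace m, ∫⁻ y' in refFace m, ‖w (param b (0, y)) - w (param b (0, y'))‖ₑ ^ 2 ≤
      8 * 3 ^ m * volume (refFace m) * ENNReal.ofReal (Metric.diam (hull b) ^ 2) *
        ∫⁻ p in refSimplex m, ‖gradient w (param b p)‖ₑ ^ 2 := by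
  have hpc := continuous_param b
  have hgm : Measurable fun p => ‖gradient w (param b p)‖ₑ ^ 2 :=
    ((continuous_gradient hw).comp hpc).enorm.measurable.pow_const 2
  set D := ENNReal.ofReal (2 * Metric.diam (hull b) ^ 2) with hD
  set J := ∫⁻ p in refSimplex m, ‖gradient w (param b p)‖ₑ ^ 2 with hJ
  -- The common endpoint, at `s = 1/3`, where both points of the face have weight `1/3`.
  set M : (Fin m → ℝ) → (Fin m → ℝ) → Eu (m + 1) := fun y y' =>
    param b (1 / 3, (1 - 2 * (1 / 3 : ℝ)) • y + (1 / 3 : ℝ) • y') with hM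
  have hMsymm : ∀ y y', M y y' = M y' y := fun y y' => by
    simp only [hM]
    congr 2
    rw [add_comm]
    norm_num
  have h3 : (1 / 3 : ℝ) ∈ Set.Icc (0 : ℝ) (1 / 3) := by norm_num
  have hone : ∀ y' ∈ refFace m, ∫⁻ y in refFace m, ‖w (param b (0, y)) - w (M y y')‖ₑ ^ 2 ≤
      D * (3 ^ m * J) := by
    intro y' hy'
    calc ∫⁻ y in refFace m, ‖w (param b (0, y)) - w (M y y')‖ₑ ^ 2
        ≤ ∫⁻ y in refFace m, D * ∫⁻ τ in Set.Icc (0 : ℝ) (1 / 3),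
          ‖gradient w (param b (τ, (1 - 2 * τ) • y + τ • y'))‖ₑ ^ 2 :=
          setLIntegral_mono' isClosed_refFace.measurableSet fun y hy =>
            enorm_sq_path_param_le hw hy hy' h3
      _ ≤ D * (3 ^ m * J) := by
          rw [lintegral_const_mul]
          · gcongr
            exact lintegral_path_le hgm hy'
          · refine Measurable.lintegral_prod_right' (f := fun q : (Fin m → ℝ) × ℝ =>
              ‖gradient w (param b (q.2, (1 - 2 * q.2) • q.1 + q.2 • y'))‖ₑ ^ 2) ?_
            exact hgm.comp (by fun_prop)
  obtain ⟨A, hA, hAone, hdiff⟩ : ∃ A : (Fin m → ℝ) → (Fin m → ℝ) → ENNReal,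
      Measurable (Function.uncurry A) ∧
      (∀ y' ∈ refFace m, ∫⁻ y in refFace m, A y y' ≤ D * (3 ^ m * J)) ∧
      ∀ y y', ‖w (param b (0, y)) - w (param b (0, y'))‖ₑ ^ 2 ≤ 2 * (A y y' + A y' y) := by
    refine ⟨fun y y' => ‖w (param b (0, y)) - w (M y y')‖ₑ ^ 2, ?_, hone, fun y y' => ?_⟩
    · have : Continuous fun q : (Fin m → ℝ) × (Fin m → ℝ) =>
          w (param b (0, q.1)) - w (M q.1 q.2) := by
        have := hw.continuous
        simp only [hM]
        fun_prop
      exact this.enorm.measurable.pow_const 2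
    · beta_reduce
      rw [hMsymm y' y]
      exact enorm_sub_sq_le _ _ _
  have hA' : Measurable fun q : (Fin m → ℝ) × (Fin m → ℝ) => A q.2 q.1 := hA.comp measurable_swap
  calc ∫⁻ y in refFace m, ∫⁻ y' in refFace m, ‖w (param b (0, y)) - w (param b (0, y'))‖ₑ ^ 2
      ≤ ∫⁻ y in refFace m, ∫⁻ y' in refFace m, 2 * (A y y' + A y' y) :=
        lintegral_mono fun y => lintegral_mono fun y' => hdiff y y'
    _ = ∫⁻ y in refFace m, 2 * ((∫⁻ y' in refFace m, A y y') + ∫⁻ y' in refFace m, A y' y) := by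
        refine lintegral_congr fun y => ?_
        have i1 : Measurable fun y' => A y y' := hA.comp measurable_prodMk_left
        have i2 : Measurable fun y' => A y y' + A y' y := i1.add (hA.comp measurable_prodMk_right)
        rw [lintegral_const_mul _ i2, lintegral_add_left i1]
    _ = 2 * ((∫⁻ y in refFace m, ∫⁻ y' in refFace m, A y y') +
          ∫⁻ y in refFace m, ∫⁻ y' in refFace m, A y' y) := by
        have i1 : Measurable fun y => ∫⁻ y' in refFace m, A y y' := hA.lintegral_prod_right'
        have i2 : Measurable fun y => (∫⁻ y' in refFace m, A y y') + ∫⁻ y' in refFace m, A y' y :=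
          i1.add hA'.lintegral_prod_right'
        rw [lintegral_const_mul _ i2, lintegral_add_left i1]
    _ ≤ 2 * (D * (3 ^ m * J) * volume (refFace m) + D * (3 ^ m * J) * volume (refFace m)) := by
        gcongr
        · rw [lintegral_lintegral_swap hA.aemeasurable, ← setLIntegral_const]
          exact setLIntegral_mono' isClosed_refFace.measurableSet hAone
        · rw [← setLIntegral_const]
          exact setLIntegral_mono' isClosed_refFace.measurableSet hAone
    _ = _ := by
        rw [hD, ENNReal.ofReal_mul (by norm_num), ENNReal.ofReal_ofNat]
        ring

/-- The value at the face is compared with the values along the path into the simplex and averaged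
over `s`. No second point has to be reached, so the target `y' = 0` is fixed. -/
theorem lintegral_face_le {w : Eu (m + 1) → ℝ} (hw : ContDiff ℝ ∞ w) :
    ∫⁻ y in refFace m, ‖w (param b (0, y))‖ₑ ^ 2 ≤
      6 * 3 ^ m * (1 + ENNReal.ofReal (Metric.diam (hull b) ^ 2)) *
        ∫⁻ p in refSimplex m, (‖w (param b p)‖ₑ ^ 2 + ‖gradient w (param b p)‖ₑ ^ 2) := by
  have hpc := continuous_param b
  have hgm : Measurable fun p => ‖gradient w (param b p)‖ₑ ^ 2 :=
    ((continuous_gradient hw).comp hpc).enorm.measurable.pow_const 2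
  have hwm : Measurable fun p => ‖w (param b p)‖ₑ ^ 2 :=
    (hw.continuous.comp hpc).enorm.measurable.pow_const 2
  set H := ENNReal.ofReal (Metric.diam (hull b) ^ 2) with hH
  have h0 : (0 : Fin m → ℝ) ∈ refFace m := by simp [refFace]
  have hpt : ∀ y ∈ refFace m, ‖w (param b (0, y))‖ₑ ^ 2 ≤ 6 * (1 + H) *
      ∫⁻ s in Set.Icc (0 : ℝ) (1 / 3), (‖w (param b (s, (1 - 2 * s) • y + s • 0))‖ₑ ^ 2 +
        ‖gradient w (param b (s, (1 - 2 * s) • y + s • 0))‖ₑ ^ 2) := by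
    intro y hy
    have i1 : Measurable fun s : ℝ => ‖w (param b (s, (1 - 2 * s) • y + s • 0))‖ₑ ^ 2 :=
      hwm.comp (g := fun p => ‖w (param b p)‖ₑ ^ 2)
        (f := fun s : ℝ => (s, (1 - 2 * s) • y + s • 0)) (by fun_prop)
    set J := ∫⁻ τ in Set.Icc (0 : ℝ) (1 / 3),
        ‖gradient w (param b (τ, (1 - 2 * τ) • y + τ • 0))‖ₑ ^ 2 with hJ
    have hvol : volume (Set.Icc (0 : ℝ) (1 / 3)) = ENNReal.ofReal (1 / 3) := by simp
    have hthree : 3 * ENNReal.ofReal (1 / 3) = 1 := by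
      rw [show (3 : ENNReal) = ENNReal.ofReal 3 by simp, ← ENNReal.ofReal_mul (by norm_num)]
      norm_num
    -- The factor 3 normalizes the average over an interval of length `1/3`.
    calc ‖w (param b (0, y))‖ₑ ^ 2
        = 3 * ∫⁻ _ in Set.Icc (0 : ℝ) (1 / 3), ‖w (param b (0, y))‖ₑ ^ 2 := by
          rw [setLIntegral_const, hvol, mul_left_comm, hthree, mul_one]
      _ ≤ 3 * ∫⁻ s in Set.Icc (0 : ℝ) (1 / 3), 2 * (ENNReal.ofReal (2 * Metric.diam (hull b) ^ 2) * J
            + ‖w (param b (s, (1 - 2 * s) • y + s • 0))‖ₑ ^ 2) := by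
          gcongr 3 * ?_
          refine setLIntegral_mono' measurableSet_Icc fun s hs => ?_
          have h1 := enorm_sub_sq_le (w (param b (0, y))) 0
            (w (param b (s, (1 - 2 * s) • y + s • 0)))
          rw [sub_zero, zero_sub, enorm_neg] at h1
          refine h1.trans ?_
          gcongr
          exact enorm_sq_path_param_le hw hy h0 hs
      _ = 4 * H * J * (3 * ENNReal.ofReal (1 / 3)) +
            6 * ∫⁻ s in Set.Icc (0 : ℝ) (1 / 3),
              ‖w (param b (s, (1 - 2 * s) • y + s • 0))‖ₑ ^ 2 := by
          have i2 : Measurable fun s : ℝ => ENNReal.ofReal (2 * Metric.diam (hull b) ^ 2) * J +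
              ‖w (param b (s, (1 - 2 * s) • y + s • 0))‖ₑ ^ 2 := measurable_const.add i1
          rw [lintegral_const_mul _ i2, lintegral_add_left measurable_const,
            setLIntegral_const, hvol, ENNReal.ofReal_mul (by norm_num), ENNReal.ofReal_ofNat, ← hH]
          ring
      _ ≤ 6 * (1 + H) * J + 6 * (1 + H) * ∫⁻ s in Set.Icc (0 : ℝ) (1 / 3),
              ‖w (param b (s, (1 - 2 * s) • y + s • 0))‖ₑ ^ 2 := by
          rw [hthree, mul_one]
          refine add_le_add (mul_le_mul_left (mul_le_mul' (by norm_num) le_add_self) _)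
            (mul_le_mul_left ?_ _)
          calc (6 : ENNReal) = 6 * 1 := (mul_one _).symm
            _ ≤ _ := by gcongr; exact le_self_add
      _ = _ := by
          rw [lintegral_add_left i1, ← hJ]
          ring
  calc ∫⁻ y in refFace m, ‖w (param b (0, y))‖ₑ ^ 2
      ≤ ∫⁻ y in refFace m, 6 * (1 + H) *
      ∫⁻ s in Set.Icc (0 : ℝ) (1 / 3), (‖w (param b (s, (1 - 2 * s) • y + s • 0))‖ₑ ^ 2 +
        ‖gradient w (param b (s, (1 - 2 * s) • y + s • 0))‖ₑ ^ 2) :=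
        setLIntegral_mono' isClosed_refFace.measurableSet hpt
    _ ≤ 6 * (1 + H) * (3 ^ m *
        ∫⁻ p in refSimplex m, (‖w (param b p)‖ₑ ^ 2 + ‖gradient w (param b p)‖ₑ ^ 2)) := by
        rw [lintegral_const_mul]
        · gcongr
          exact lintegral_path_le (f := fun p => ‖w (param b p)‖ₑ ^ 2 +
            ‖gradient w (param b p)‖ₑ ^ 2) (hwm.add hgm) h0
        · refine Measurable.lintegral_prod_right' (f := fun q : (Fin m → ℝ) × ℝ =>
            ‖w (param b (q.2, (1 - 2 * q.2) • q.1 + q.2 • 0))‖ₑ ^ 2 +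
            ‖gradient w (param b (q.2, (1 - 2 * q.2) • q.1 + q.2 • 0))‖ₑ ^ 2) ?_
          exact (hwm.add hgm).comp (g := fun p => ‖w (param b p)‖ₑ ^ 2 +
            ‖gradient w (param b p)‖ₑ ^ 2)
            (f := fun q : (Fin m → ℝ) × ℝ => (q.2, (1 - 2 * q.2) • q.1 + q.2 • 0)) (by fun_prop)
    _ = _ := by ring

/-- Scaling factors between the measures on a simplex and on its base, and the measures on the
reference domains. -/
theorem exists_scaling : ∃ α β : ENNReal, α ≠ 0 ∧ α ≠ ⊤ ∧ β ≠ 0 ∧ β ≠ ⊤ ∧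
    (∀ f : Eu (m + 1) → ENNReal, Measurable f →
      ∫⁻ x in hull b, f x = α * ∫⁻ p in refSimplex m, f (param b p)) ∧
    (∀ f : Eu (m + 1) → ENNReal, Measurable f →
      ∫⁻ x in base b, f x ∂(Measure.euclideanHausdorffMeasure m) =
        β * ∫⁻ y in refFace m, f (param b (0, y))) ∧
    volume (hull b) = α * volume (refSimplex m) ∧
    Measure.euclideanHausdorffMeasure m (base b) = β * volume (refFace m) := by
  obtain ⟨α, hα0, hα, hαe⟩ := exists_volume_hull_eq b
  obtain ⟨β, hβ0, hβ, hβe⟩ := exists_hausdorff_base_eq b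
  have hpm : Measurable (param b) := (continuous_param b).measurable
  have hpm' : Measurable fun y => param b (0, y) := by fun_prop
  have h1 : ∀ f : Eu (m + 1) → ENNReal, Measurable f →
      ∫⁻ x in hull b, f x = α * ∫⁻ p in refSimplex m, f (param b p) := fun f hf => by
    rw [hαe, lintegral_smul_measure, lintegral_map hf hpm, smul_eq_mul]
  have h2 : ∀ f : Eu (m + 1) → ENNReal, Measurable f →
      ∫⁻ x in base b, f x ∂(Measure.euclideanHausdorffMeasure m) =
        β * ∫⁻ y in refFace m, f (param b (0, y)) := fun f hf => by
    rw [hβe, lintegral_smul_measure, lintegral_map hf hpm', smul_eq_mul]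
  refine ⟨α, β, hα0, hα, hβ0, hβ, h1, h2, ?_, ?_⟩
  · simpa using h1 1 measurable_const
  · simpa using h2 1 measurable_const

theorem hausdorff_base_ne_zero : Measure.euclideanHausdorffMeasure m (base b) ≠ 0 := by
  obtain ⟨α, β, -, -, hβ0, -, -, -, -, h⟩ := exists_scaling b
  rw [h]
  exact mul_ne_zero hβ0 volume_refFace_ne_zero

theorem hausdorff_base_ne_top : Measure.euclideanHausdorffMeasure m (base b) ≠ ⊤ := by
  obtain ⟨α, β, -, -, -, hβ, -, -, -, h⟩ := exists_scaling b
  rw [h]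
  exact ENNReal.mul_ne_top hβ isCompact_refFace.measure_lt_top.ne

/-- This serves only to make traces of Sobolev functions well defined, so its constant may depend on
the simplex. -/
theorem exists_trace_le : ∃ C : ENNReal, C ≠ ⊤ ∧ ∀ w : Eu (m + 1) → ℝ, ContDiff ℝ ∞ w →
    ∫⁻ x in base b, ‖w x‖ₑ ^ 2 ∂(Measure.euclideanHausdorffMeasure m) ≤
      C * ∫⁻ x in hull b, (‖w x‖ₑ ^ 2 + ‖gradient w x‖ₑ ^ 2) := by
  obtain ⟨α, β, hα0, hα, hβ0, hβ, h1, h2, -, -⟩ := exists_scaling b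
  refine ⟨β * (6 * 3 ^ m * (1 + ENNReal.ofReal (Metric.diam (hull b) ^ 2))) * α⁻¹, ?_,
    fun w hw => ?_⟩
  · have : α⁻¹ ≠ ⊤ := ENNReal.inv_ne_top.2 hα0
    finiteness
  · have hm1 : Measurable fun x => ‖w x‖ₑ ^ 2 := hw.continuous.enorm.measurable.pow_const 2
    have hm2 : Measurable fun x => ‖gradient w x‖ₑ ^ 2 :=
      (continuous_gradient hw).enorm.measurable.pow_const 2
    have hm3 : Measurable fun x => ‖w x‖ₑ ^ 2 + ‖gradient w x‖ₑ ^ 2 := hm1.add hm2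
    rw [h2 _ hm1, h1 _ hm3, mul_assoc, ← mul_assoc α⁻¹, ENNReal.inv_mul_cancel hα0 hα,
      one_mul, mul_assoc]
    gcongr
    exact lintegral_face_le b hw

/-- Both sides contain the volume factor `α` once and the area factor `β` twice. Hence the
oscillation estimate on the reference domains scales with a constant that depends only on the
dimension, apart from the explicit diameter. -/
theorem volume_hull_mul_lintegral_oscillation_le {w : Eu (m + 1) → ℝ} (hw : ContDiff ℝ ∞ w) :
    volume (hull b) * ∫⁻ x in base b, ∫⁻ y in base b, ‖w x - w y‖ₑ ^ 2
      ∂(Measure.euclideanHausdorffMeasure m) ∂(Measure.euclideanHausdorffMeasure m) ≤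
      8 * 3 ^ m * volume (refSimplex m) * (volume (refFace m))⁻¹ *
        ENNReal.ofReal (Metric.diam (hull b) ^ 2) *
        Measure.euclideanHausdorffMeasure m (base b) ^ 2 *
        ∫⁻ x in hull b, ‖gradient w x‖ₑ ^ 2 := by
  obtain ⟨α, β, hα0, hα, hβ0, hβ, h1, h2, h3, h4⟩ := exists_scaling b
  have hV := volume_refFace_ne_zero (m := m)
  have hV' : volume (refFace m) ≠ ⊤ := isCompact_refFace.measure_lt_top.ne
  have hm2 : Measurable fun x => ‖gradient w x‖ₑ ^ 2 :=
    (continuous_gradient hw).enorm.measurable.pow_const 2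
  have hm3 : Measurable fun p : Eu (m + 1) × Eu (m + 1) => ‖w p.1 - w p.2‖ₑ ^ 2 := by
    have hwc := hw.continuous
    have : Continuous fun p : Eu (m + 1) × Eu (m + 1) => w p.1 - w p.2 := by fun_prop
    exact this.enorm.measurable.pow_const 2
  have hm4 : ∀ x, Measurable fun y => ‖w x - w y‖ₑ ^ 2 := fun x =>
    hm3.comp measurable_prodMk_left
  simp only [h2 _ (hm4 _)]
  rw [h2]
  · rw [lintegral_const_mul, h3, h4, h1 _ hm2]
    · calc α * volume (refSimplex m) * (β * (β * ∫⁻ y in refFace m, ∫⁻ y' in refFace m,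
            ‖w (param b (0, y)) - w (param b (0, y'))‖ₑ ^ 2))
          ≤ α * volume (refSimplex m) * (β * (β * (8 * 3 ^ m * volume (refFace m) *
            ENNReal.ofReal (Metric.diam (hull b) ^ 2) *
            ∫⁻ p in refSimplex m, ‖gradient w (param b p)‖ₑ ^ 2))) := by
            gcongr
            exact lintegral_oscillation_le b hw
        _ = 8 * 3 ^ m * volume (refSimplex m) * ((volume (refFace m))⁻¹ * volume (refFace m)) *
            ENNReal.ofReal (Metric.diam (hull b) ^ 2) * (β ^ 2 * volume (refFace m)) *
            (α * ∫⁻ p in refSimplex m, ‖gradient w (param b p)‖ₑ ^ 2) := by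
            rw [ENNReal.inv_mul_cancel hV hV']
            ring
        _ = _ := by ring
    · refine Measurable.lintegral_prod_right' (f := fun q : (Fin m → ℝ) × (Fin m → ℝ) =>
        ‖w (param b (0, q.1)) - w (param b (0, q.2))‖ₑ ^ 2) ?_
      have hp := (continuous_param b).measurable
      exact hm3.comp (g := fun p : Eu (m + 1) × Eu (m + 1) => ‖w p.1 - w p.2‖ₑ ^ 2)
        (f := fun q : (Fin m → ℝ) × (Fin m → ℝ) => (param b (0, q.1), param b (0, q.2)))
        (by fun_prop)
  · refine Measurable.const_mul ?_ β
    refine Measurable.lintegral_prod_right' (f := fun q : Eu (m + 1) × (Fin m → ℝ) =>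
        ‖w q.1 - w (param b (0, q.2))‖ₑ ^ 2) ?_
    have hp := (continuous_param b).measurable
    exact hm3.comp (g := fun p : Eu (m + 1) × Eu (m + 1) => ‖w p.1 - w p.2‖ₑ ^ 2)
        (f := fun q : Eu (m + 1) × (Fin m → ℝ) => (q.1, param b (0, q.2))) (by fun_prop)

/-- Variance bounds for the mean value. -/
theorem mean_bounds {α : Type*} [MeasurableSpace α] {μ : Measure α} [IsFiniteMeasure μ]
    (hμ : μ ≠ 0) {f : α → ℝ} (hf : MemLp f 2 μ) :
    ∃ c : ℝ, μ.real Set.univ * c ^ 2 ≤ ∫ x, f x ^ 2 ∂μ ∧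
      ∫ x, (f x - c) ^ 2 ∂μ ≤ ∫ x, f x ^ 2 ∂μ ∧
      μ.real Set.univ * ∫ x, (f x - c) ^ 2 ∂μ ≤ ∫ x, ∫ y, (f x - f y) ^ 2 ∂μ ∂μ := by
  set V := μ.real Set.univ with hV
  have hV0 : 0 < V := by
    rw [hV, measureReal_def, ENNReal.toReal_pos_iff]
    exact ⟨Measure.measure_univ_pos.2 hμ, measure_lt_top _ _⟩
  have hi : Integrable f μ := hf.integrable (by norm_num)
  have hi2 : Integrable (fun x => f x ^ 2) μ := hf.integrable_sq
  set I := ∫ x, f x ∂μ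
  set J := ∫ x, f x ^ 2 ∂μ
  have hq : ∀ c : ℝ, ∫ x, (f x - c) ^ 2 ∂μ = J - 2 * c * I + V * c ^ 2 := by
    intro c
    have e : (fun x => (f x - c) ^ 2) = fun x => (f x ^ 2 - 2 * c * f x) + c ^ 2 := by
      ext x; ring
    have i1 : Integrable (fun x => f x ^ 2 - 2 * c * f x) μ := hi2.sub (hi.const_mul _)
    rw [e, integral_add i1 (integrable_const _),
      integral_sub hi2 (hi.const_mul _), integral_const_mul, integral_const, smul_eq_mul]
  -- This is twice the total mass times the integral of the squared deviation from the mean.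
  have hd : ∫ x, ∫ y, (f x - f y) ^ 2 ∂μ ∂μ = 2 * (V * J - I ^ 2) := by
    have e : ∀ x, ∫ y, (f x - f y) ^ 2 ∂μ = (J - 2 * I * f x) + V * f x ^ 2 := fun x => by
      have : (fun y => (f x - f y) ^ 2) = fun y => (f y - f x) ^ 2 := by ext y; ring
      rw [this, hq]
      ring
    simp only [e]
    have i1 : Integrable (fun x => J - 2 * I * f x) μ := (integrable_const _).sub (hi.const_mul _)
    rw [integral_add i1 (hi2.const_mul _),
      integral_sub (integrable_const _) (hi.const_mul _), integral_const_mul, integral_const_mul,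
      integral_const, smul_eq_mul]
    ring
  have hc := hq (I / V)
  have hc0 : 0 ≤ ∫ x, (f x - I / V) ^ 2 ∂μ := integral_nonneg fun x => sq_nonneg _
  have e1 : V * (I / V) ^ 2 = I ^ 2 / V := by field_simp
  have e2 : 2 * (I / V) * I = 2 * (I ^ 2 / V) := by ring
  have e3 : V * (I ^ 2 / V) = I ^ 2 := by field_simp
  have e4 : 0 ≤ I ^ 2 / V := by positivity
  rw [e1, e2] at hc
  refine ⟨I / V, ?_, ?_, ?_⟩
  · rw [e1]; linarith
  · linarith
  · rw [hd, hc]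
    rw [hc] at hc0
    nlinarith

end

section

/-! ### Square integrals -/

section SquareIntegrals

variable {α F : Type*} [MeasurableSpace α] [NormedAddCommGroup F]

theorem toReal_eLpNorm_two_sq {μ : Measure α} {f : α → F} (hf : MemLp f 2 μ) :
    (eLpNorm f 2 μ).toReal ^ 2 = ∫ x, ‖f x‖ ^ 2 ∂μ := by
  rw [← ENNReal.toReal_pow, eLpNorm_two_sq, integral_eq_lintegral_of_nonneg_ae
    (ae_of_all _ fun x => sq_nonneg _) (hf.1.norm.pow 2)]
  congr 1
  refine lintegral_congr fun x => ?_
  rw [ENNReal.ofReal_pow (norm_nonneg _), ofReal_norm]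

theorem lintegral_enorm_sq_eq {μ : Measure α} {f : α → F} (hf : MemLp f 2 μ) :
    ∫⁻ x, ‖f x‖ₑ ^ 2 ∂μ = ENNReal.ofReal (∫ x, ‖f x‖ ^ 2 ∂μ) := by
  rw [← toReal_eLpNorm_two_sq hf, ← ENNReal.toReal_pow, eLpNorm_two_sq, ENNReal.ofReal_toReal]
  rw [← eLpNorm_two_sq]
  exact ENNReal.pow_ne_top hf.2.ne

theorem Continuous.memLp_two_of_isCompact {α : Type*} [TopologicalSpace α] [MeasurableSpace α]
    [OpensMeasurableSpace α] [T2Space α] [SecondCountableTopologyEither α F] {μ : Measure α}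
    {S : Set α} (hS : IsCompact S) (hμ : μ S ≠ ⊤) {f : α → F} (hf : Continuous f) :
    MemLp f 2 (μ.restrict S) := by
  obtain ⟨C, hC⟩ := hS.exists_bound_of_continuousOn hf.continuousOn
  have : IsFiniteMeasure (μ.restrict S) := ⟨by
    rw [Measure.restrict_apply_univ]; exact hμ.lt_top⟩
  refine MemLp.of_bound hf.aestronglyMeasurable C ?_
  filter_upwards [ae_restrict_mem hS.measurableSet] with x hx using hC x hx

end SquareIntegrals

variable {m : ℕ}

theorem volume_hull_ne_top (b : AffineBasis (Fin (m + 2)) ℝ (Eu (m + 1))) :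
    volume (hull b) ≠ ⊤ := (isCompact_hull b).measure_lt_top.ne

theorem volume_hull_pos (b : AffineBasis (Fin (m + 2)) ℝ (Eu (m + 1))) :
    0 < volume (hull b) :=
  (isOpen_interior.measure_pos volume ⟨_, b.centroid_mem_interior_convexHull⟩).trans_le
    (measure_mono interior_subset)

theorem volume_refSimplex_ne_zero (b : AffineBasis (Fin (m + 2)) ℝ (Eu (m + 1))) :
    volume (refSimplex m) ≠ 0 := by
  obtain ⟨α, β, -, -, -, -, -, -, h, -⟩ := exists_scaling b
  intro h0
  have := volume_hull_pos b
  rw [h, h0, mul_zero] at this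
  exact this.ne' rfl

/-- Means over the base of a simplex, with a Poincaré inequality. -/
theorem exists_mean_bounds (m : ℕ) : ∃ C : ℝ, 0 ≤ C ∧
    ∀ b : AffineBasis (Fin (m + 2)) ℝ (Eu (m + 1)), ∀ w : Eu (m + 1) → ℝ, ContDiff ℝ ∞ w →
      ∃ c : ℝ,
        (Measure.euclideanHausdorffMeasure m).real (base b) * c ^ 2 ≤
          ∫ x in base b, w x ^ 2 ∂(Measure.euclideanHausdorffMeasure m) ∧
        ∫ x in base b, (w x - c) ^ 2 ∂(Measure.euclideanHausdorffMeasure m) ≤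
          ∫ x in base b, w x ^ 2 ∂(Measure.euclideanHausdorffMeasure m) ∧
        volume.real (hull b) *
          ∫ x in base b, (w x - c) ^ 2 ∂(Measure.euclideanHausdorffMeasure m) ≤
          C * Metric.diam (hull b) ^ 2 * (Measure.euclideanHausdorffMeasure m).real (base b) *
            ∫ x in hull b, ‖gradient w x‖ ^ 2 := by
  set K : ENNReal := 8 * 3 ^ m * volume (refSimplex m) * (volume (refFace m))⁻¹ with hK
  have hKt : K ≠ ⊤ := by
    have h1 : volume (refSimplex m) ≠ ⊤ := isCompact_refSimplex.measure_lt_top.ne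
    have h2 : (volume (refFace m))⁻¹ ≠ ⊤ := ENNReal.inv_ne_top.2 volume_refFace_ne_zero
    finiteness
  refine ⟨K.toReal, ENNReal.toReal_nonneg, fun b w hw => ?_⟩
  set μ := (Measure.euclideanHausdorffMeasure m).restrict (base b) with hμ
  have hfin : IsFiniteMeasure μ := ⟨by
    rw [hμ, Measure.restrict_apply_univ]; exact (hausdorff_base_ne_top b).lt_top⟩
  have hμu : μ Set.univ = Measure.euclideanHausdorffMeasure m (base b) := by
    rw [hμ, Measure.restrict_apply_univ]
  have hμ0 : μ ≠ 0 := fun h => hausdorff_base_ne_zero b (by rw [← hμu, h]; rfl)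
  have hwL : MemLp w 2 μ :=
    Continuous.memLp_two_of_isCompact (isCompact_base b) (hausdorff_base_ne_top b) hw.continuous
  obtain ⟨c, h1, h2, h3⟩ := mean_bounds hμ0 hwL
  have hreal : μ.real Set.univ = (Measure.euclideanHausdorffMeasure m).real (base b) := by
    rw [measureReal_def, hμu, measureReal_def]
  rw [hreal] at h1 h3
  set A := (Measure.euclideanHausdorffMeasure m).real (base b) with hA
  have hA0 : 0 < A := ENNReal.toReal_pos (hausdorff_base_ne_zero b) (hausdorff_base_ne_top b)
  refine ⟨c, h1, h2, ?_⟩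
  have hgL : MemLp (gradient w) 2 (volume.restrict (hull b)) :=
    Continuous.memLp_two_of_isCompact (isCompact_hull b) (volume_hull_ne_top b)
      (continuous_gradient hw)
  have hosc := volume_hull_mul_lintegral_oscillation_le b hw
  rw [lintegral_enorm_sq_eq hgL, ← hK] at hosc
  have hinner : ∀ x, ∫⁻ y, ‖w x - w y‖ₑ ^ 2 ∂μ = ENNReal.ofReal (∫ y, (w x - w y) ^ 2 ∂μ) := by
    intro x
    have hd : MemLp (fun y => w x - w y) 2 μ := (memLp_const (w x)).sub hwL
    rw [lintegral_enorm_sq_eq hd]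
    simp only [Real.norm_eq_abs, sq_abs]
  have hdouble : ∫ x, ∫ y, (w x - w y) ^ 2 ∂μ ∂μ =
      (∫⁻ x, ∫⁻ y, ‖w x - w y‖ₑ ^ 2 ∂μ ∂μ).toReal := by
    simp only [hinner]
    refine integral_eq_lintegral_of_nonneg_ae (ae_of_all _ fun x => integral_nonneg fun y =>
      sq_nonneg _) ?_
    have hc : Continuous fun p : Eu (m + 1) × Eu (m + 1) => (w p.1 - w p.2) ^ 2 := by
      have := hw.continuous
      fun_prop
    exact hc.stronglyMeasurable.integral_prod_right'.aestronglyMeasurable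
  have hosc' := ENNReal.toReal_mono (by
    have := hausdorff_base_ne_top b
    finiteness) hosc
  simp only [ENNReal.toReal_mul, ENNReal.toReal_pow,
    ENNReal.toReal_ofReal (sq_nonneg (Metric.diam (hull b))),
    ENNReal.toReal_ofReal (integral_nonneg fun x => sq_nonneg ‖gradient w x‖)] at hosc'
  rw [← hdouble] at hosc'
  have hV : 0 ≤ volume.real (hull b) := measureReal_nonneg
  have h4 := (mul_le_mul_of_nonneg_left h3 hV).trans hosc'
  -- The oscillation estimate carries the area squared; one factor was spent on passing from the
  -- double integral to the deviation from the mean.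
  refine le_of_mul_le_mul_left (a := A) ?_ hA0
  calc _ = _ := by ring
    _ ≤ _ := h4
    _ = _ := by rw [hA, measureReal_def]; ring

/-! ### Lifting polynomials from the base -/

theorem totalDegree_aeval_le {σ τ : Type*} [Fintype σ] (f : σ → MvPolynomial τ ℝ)
    (hf : ∀ i, (f i).totalDegree ≤ 1) (p : MvPolynomial σ ℝ) :
    (MvPolynomial.aeval f p).totalDegree ≤ p.totalDegree := by
  rw [MvPolynomial.aeval_def, MvPolynomial.eval₂_eq']
  refine MvPolynomial.totalDegree_finsetSum_le fun d hd => ?_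
  refine (MvPolynomial.totalDegree_mul _ _).trans ?_
  rw [MvPolynomial.algebraMap_eq, MvPolynomial.totalDegree_C, zero_add]
  refine (MvPolynomial.totalDegree_finsetProd _ _).trans ?_
  refine le_trans (Finset.sum_le_sum fun i _ => (MvPolynomial.totalDegree_pow _ _).trans
    (Nat.mul_le_mul_left _ (hf i))) ?_
  simp only [mul_one]
  refine le_of_eq_of_le ?_ (MvPolynomial.le_totalDegree hd)
  rw [Finsupp.sum_fintype _ _ fun _ => rfl]

theorem totalDegree_affine_le {n : ℕ} (c : ℝ) (a : Fin n → ℝ) :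
    (MvPolynomial.C c + ∑ i, MvPolynomial.C (a i) * MvPolynomial.X i :
      MvPolynomial (Fin n) ℝ).totalDegree ≤ 1 := by
  refine (MvPolynomial.totalDegree_add _ _).trans (max_le (by simp) ?_)
  refine MvPolynomial.totalDegree_finsetSum_le fun i _ => ?_
  refine (MvPolynomial.totalDegree_mul _ _).trans ?_
  simp

theorem eval_affine {n : ℕ} (c : ℝ) (a x : Fin n → ℝ) :
    MvPolynomial.eval x (MvPolynomial.C c + ∑ i, MvPolynomial.C (a i) * MvPolynomial.X i) =
      c + ∑ i, a i * x i := by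
  simp

theorem eval_aeval {σ τ : Type*} (f : σ → MvPolynomial τ ℝ) (p : MvPolynomial σ ℝ) (x : τ → ℝ) :
    MvPolynomial.eval x (MvPolynomial.aeval f p) =
      MvPolynomial.eval (fun i => MvPolynomial.eval x (f i)) p := by
  rw [← MvPolynomial.coe_aeval_eq_eval, ← MvPolynomial.coe_aeval_eq_eval]
  simp only [RingHom.coe_coe]
  rw [← AlgHom.comp_apply, MvPolynomial.comp_aeval]

theorem contDiff_eval {n : ℕ} (p : MvPolynomial (Fin n) ℝ) :
    ContDiff ℝ ∞ fun x : Fin n → ℝ => MvPolynomial.eval x p := by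
  simp only [MvPolynomial.eval_eq']
  fun_prop

theorem contDiff_polyFun {d ℓ : ℕ} (p : Poly d ℓ) : ContDiff ℝ ∞ (polyFun p) :=
  (contDiff_eval (p : MvPolynomial (Fin d) ℝ)).comp
    (by fun_prop : ContDiff ℝ ∞ fun (x : Eu d) (i : Fin d) => x i)

/-- On the finite-dimensional range of `B` the map `D ∘ B⁻¹` is bounded. The space `V` needs no norm
of its own, since `B` induces one. -/
theorem exists_norm_le_of_injective {V H₁ H₂ : Type*} [AddCommGroup V] [Module ℝ V]
    [Module.Finite ℝ V] [NormedAddCommGroup H₁] [NormedSpace ℝ H₁] [NormedAddCommGroup H₂]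
    [NormedSpace ℝ H₂] (B : V →ₗ[ℝ] H₁) (hB : Function.Injective B) (D : V →ₗ[ℝ] H₂) :
    ∃ C : ℝ, 0 ≤ C ∧ ∀ v, ‖D v‖ ≤ C * ‖B v‖ := by
  set e := LinearEquiv.ofInjective B hB
  have : Module.Finite ℝ (LinearMap.range B) := Module.Finite.range B
  set T := (D.comp e.symm.toLinearMap).toContinuousLinearMap
  refine ⟨‖T‖, T.opNorm_nonneg, fun v => ?_⟩
  have h := T.le_opNorm (e v)
  have h1 : T (e v) = D v := by
    change D (e.symm (e v)) = D v
    rw [LinearEquiv.symm_apply_apply]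
  rw [h1] at h
  exact h

/-- The inverse inequality for polynomials on the reference face. -/
theorem exists_inverse_inequality (m ℓ : ℕ) : ∃ C : ℝ, 0 ≤ C ∧
    ∀ q ∈ MvPolynomial.restrictTotalDegree (Fin m) ℝ ℓ, ∀ i : Fin m,
      ∫ y in refFace m, (fderiv ℝ (fun y => MvPolynomial.eval y q) y (Pi.single i 1)) ^ 2 ≤
        C * ∫ y in refFace m, (MvPolynomial.eval y q) ^ 2 := by
  set ν : Measure (Fin m → ℝ) := volume.restrict (refFace m) with hν
  have hL : ∀ {f : (Fin m → ℝ) → ℝ}, Continuous f → MemLp f 2 ν := fun hf =>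
    Continuous.memLp_two_of_isCompact isCompact_refFace isCompact_refFace.measure_lt_top.ne hf
  have hc : ∀ q : MvPolynomial (Fin m) ℝ, Continuous fun y => MvPolynomial.eval y q := fun q =>
    (contDiff_eval q).continuous
  have hd : ∀ (q : MvPolynomial (Fin m) ℝ) (y : Fin m → ℝ),
      DifferentiableAt ℝ (fun y => MvPolynomial.eval y q) y := fun q y =>
    (contDiff_eval q).differentiable (by simp) y
  have hdc : ∀ (q : MvPolynomial (Fin m) ℝ) (i : Fin m), Continuous fun y =>
      fderiv ℝ (fun y => MvPolynomial.eval y q) y (Pi.single i 1) := fun q i => by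
    have := (contDiff_eval q).continuous_fderiv (by simp)
    fun_prop
  set V := MvPolynomial.restrictTotalDegree (Fin m) ℝ ℓ
  let B : V →ₗ[ℝ] Lp ℝ 2 ν :=
    { toFun := fun q => (hL (hc q)).toLp
      map_add' := fun p q => by
        rw [← MemLp.toLp_add]
        congr 1
        ext y
        simp
      map_smul' := fun c q => by
        rw [RingHom.id_apply, ← MemLp.toLp_const_smul]
        congr 1
        ext y
        simp [MvPolynomial.smul_eval] }
  let D : Fin m → V →ₗ[ℝ] Lp ℝ 2 ν := fun i =>
    { toFun := fun q => (hL (hdc q i)).toLp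
      map_add' := fun p q => by
        rw [← MemLp.toLp_add]
        congr 1
        ext y
        simp only [Submodule.coe_add, map_add, Pi.add_apply]
        rw [fderiv_fun_add (hd _ _) (hd _ _)]
        rfl
      map_smul' := fun c q => by
        rw [RingHom.id_apply, ← MemLp.toLp_const_smul]
        congr 1
        ext y
        simp only [Submodule.coe_smul, MvPolynomial.smul_eval, Pi.smul_apply]
        rw [fderiv_const_mul (hd _ _)]
        rfl }
  have hnorm : ∀ {f : (Fin m → ℝ) → ℝ} (hf : MemLp f 2 ν), ‖hf.toLp‖ ^ 2 = ∫ y, f y ^ 2 ∂ν := by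
    intro f hf
    rw [Lp.norm_toLp, toReal_eLpNorm_two_sq hf]
    simp only [Real.norm_eq_abs, sq_abs]
  -- Two polynomials equal almost everywhere on the face agree on an open box by continuity, hence
  -- are identical.
  have hB : Function.Injective B := by
    intro p q hpq
    have hae : (fun y => MvPolynomial.eval y (p : MvPolynomial (Fin m) ℝ)) =ᵐ[ν]
        fun y => MvPolynomial.eval y (q : MvPolynomial (Fin m) ℝ) :=
      (MemLp.toLp_eq_toLp_iff (hL (hc p)) (hL (hc q))).1 hpq
    set O := Set.pi Set.univ (fun _ : Fin m => Set.Ioo (0 : ℝ) (1 / (m + 1))) with hO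
    have hOo : IsOpen O := isOpen_set_pi Set.finite_univ fun _ _ => isOpen_Ioo
    have hae' := ae_mono (Measure.restrict_mono (μ := volume) (box_subset_refFace (m := m)) le_rfl) hae
    have heq := Measure.eqOn_open_of_ae_eq hae' hOo (hc p).continuousOn (hc q).continuousOn
    refine Subtype.ext (MvPolynomial.funext_set (fun _ => Set.Ioo (0 : ℝ) (1 / (m + 1)))
      (fun _ => Set.Ioo_infinite (by positivity)) fun y hy => heq hy)
  have hex : ∀ i, ∃ C : ℝ, 0 ≤ C ∧ ∀ v, ‖D i v‖ ≤ C * ‖B v‖ := fun i =>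
    exists_norm_le_of_injective B hB (D i)
  choose C hC0 hC using hex
  refine ⟨∑ i, C i ^ 2, Finset.sum_nonneg fun i _ => sq_nonneg _, fun q hq i => ?_⟩
  have h := pow_le_pow_left₀ (norm_nonneg _) (hC i ⟨q, hq⟩) 2
  have h1 := hnorm (hL (hdc q i))
  have h2 := hnorm (hL (hc q))
  rw [mul_pow] at h
  rw [← h1, ← h2]
  refine h.trans (mul_le_mul_of_nonneg_right ?_ (sq_nonneg _))
  exact Finset.single_le_sum (f := fun i => C i ^ 2) (fun j _ => sq_nonneg _) (Finset.mem_univ i)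

/-! ### Barycentric coordinates and the lifting -/

variable (b : AffineBasis (Fin (m + 2)) ℝ (Eu (m + 1)))

/-- The maximum diameter of a ball inscribed in a simplex. -/
def inDiam : ℝ := sSup {δ : ℝ | 0 ≤ δ ∧ ∃ x, Metric.closedBall x (δ / 2) ⊆ hull b}

theorem coord_mem_Icc {x : Eu (m + 1)} (hx : x ∈ hull b) (j : Fin (m + 2)) :
    b.coord j x ∈ Set.Icc (0 : ℝ) 1 := by
  rw [mem_hull_iff] at hx
  refine ⟨hx j, ?_⟩
  rw [← b.sum_coord_apply_eq_one x]
  exact Finset.single_le_sum (f := fun j => b.coord j x) (fun j _ => hx j) (Finset.mem_univ j)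

/-- A barycentric coordinate varies by at most 1 over the simplex, in particular along the diameter
of an inscribed ball in the direction of `v`. So its gradient is at most the inverse of the
inscribed diameter. -/
theorem inDiam_mul_abs_coord_le (j : Fin (m + 2)) (v : Eu (m + 1)) :
    inDiam b * |(b.coord j).linear v| ≤ ‖v‖ := by
  rcases eq_or_ne ((b.coord j).linear v) 0 with h0 | h0
  · rw [h0, abs_zero, mul_zero]; exact norm_nonneg _
  have hv : v ≠ 0 := fun h => h0 (by rw [h, map_zero])
  have hv' : 0 < ‖v‖ := norm_pos_iff.2 hv
  rw [← le_div_iff₀ (abs_pos.2 h0)]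
  refine Real.sSup_le ?_ (by positivity)
  rintro δ ⟨hδ, x, hx⟩
  rw [le_div_iff₀ (abs_pos.2 h0)]
  set w := (δ / 2 / ‖v‖) • v with hw
  have hwn : ‖w‖ = δ / 2 := by
    rw [hw, norm_smul, Real.norm_of_nonneg (by positivity), div_mul_cancel₀ _ hv'.ne']
  have h1 := coord_mem_Icc b (hx (show x + w ∈ _ by simp [hwn])) j
  have h2 := coord_mem_Icc b (hx (show x - w ∈ _ by simp [hwn])) j
  have h3 : (b.coord j).linear ((2 : ℝ) • w) = b.coord j (x + w) - b.coord j (x - w) := by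
    have := (b.coord j).linearMap_vsub (x + w) (x - w)
    rw [vsub_eq_sub, vsub_eq_sub] at this
    rw [← this]
    congr 1
    module
  have h4 : |(b.coord j).linear ((2 : ℝ) • w)| ≤ 1 := by
    rw [h3, abs_le]
    constructor <;> linarith [h1.1, h1.2, h2.1, h2.2]
  rw [hw, smul_smul, map_smul, smul_eq_mul, abs_mul, abs_of_nonneg (by positivity)] at h4
  calc δ * |(b.coord j).linear v| = ‖v‖ * (2 * (δ / 2 / ‖v‖) * |(b.coord j).linear v|) := by
        field_simp
    _ ≤ ‖v‖ * 1 := by gcongr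
    _ = ‖v‖ := mul_one _

/-- The barycentric coordinates that parametrize the base. -/
def baseCoords (x : Eu (m + 1)) : Fin m → ℝ := fun i => b.coord i.succ.succ x

/-- The linear part of the barycentric coordinates that parametrize the base. -/
def baseCoordsLin : Eu (m + 1) →L[ℝ] (Fin m → ℝ) :=
  ContinuousLinearMap.pi fun i => LinearMap.toContinuousLinearMap (b.coord i.succ.succ).linear

theorem baseCoords_eq (x : Eu (m + 1)) : baseCoords b x = baseCoords b 0 + baseCoordsLin b x := by
  ext i
  have := (b.coord i.succ.succ).map_vadd 0 x
  rw [vadd_eq_add, add_zero, vadd_eq_add] at this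
  rw [baseCoords, this, add_comm]
  rfl

theorem hasFDerivAt_baseCoords (x : Eu (m + 1)) :
    HasFDerivAt (baseCoords b) (baseCoordsLin b) x := by
  rw [funext (baseCoords_eq b)]
  exact (baseCoordsLin b).hasFDerivAt.const_add _

theorem continuous_baseCoords : Continuous (baseCoords b) := by
  rw [funext (baseCoords_eq b)]
  fun_prop

theorem baseCoords_param (p : ℝ × (Fin m → ℝ)) : baseCoords b (param b p) = p.2 :=
  funext fun i => coord_succ_succ_param b i p

theorem param_baseCoords {x : Eu (m + 1)} (hx : b.coord 0 x = 0) :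
    param b (0, baseCoords b x) = x := by
  have := param_coord b x
  rwa [hx] at this

/-- The integrand does not depend on the first reference coordinate, and the reference simplex lies
in the product of `[0, 1]` with the reference face. -/
theorem integral_hull_comp_baseCoords_le {g : (Fin m → ℝ) → ℝ} (hg : Continuous g) :
    volume.real (refSimplex m) * ((Measure.euclideanHausdorffMeasure m).real (base b) *
      ∫ x in hull b, g (baseCoords b x) ^ 2) ≤
    volume.real (refFace m) * (volume.real (hull b) *
      ∫ x in base b, g (baseCoords b x) ^ 2 ∂(Measure.euclideanHausdorffMeasure m)) := by
  obtain ⟨α, β, hα0, hα, hβ0, hβ, h1, h2, h3, h4⟩ := exists_scaling b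
  have hgc : Continuous fun x => g (baseCoords b x) := hg.comp (continuous_baseCoords b)
  have hL1 : MemLp (fun x => g (baseCoords b x)) 2 (volume.restrict (hull b)) :=
    Continuous.memLp_two_of_isCompact (isCompact_hull b) (volume_hull_ne_top b) hgc
  have hL2 : MemLp (fun x => g (baseCoords b x)) 2
      ((Measure.euclideanHausdorffMeasure m).restrict (base b)) :=
    Continuous.memLp_two_of_isCompact (isCompact_base b) (hausdorff_base_ne_top b) hgc
  have hm : Measurable fun x => ‖g (baseCoords b x)‖ₑ ^ 2 := hgc.enorm.measurable.pow_const 2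
  have hgm : Measurable fun y => ‖g y‖ₑ ^ 2 := hg.enorm.measurable.pow_const 2
  have key : ∫⁻ p in refSimplex m, ‖g p.2‖ₑ ^ 2 ≤ ∫⁻ y in refFace m, ‖g y‖ₑ ^ 2 := by
    calc ∫⁻ p in refSimplex m, ‖g p.2‖ₑ ^ 2
        ≤ ∫⁻ p in Set.Icc (0 : ℝ) 1 ×ˢ refFace m, ‖g p.2‖ₑ ^ 2 :=
          lintegral_mono_set refSimplex_subset
      _ = ∫⁻ y in refFace m, ‖g y‖ₑ ^ 2 := by
          have h : Measurable fun p : ℝ × (Fin m → ℝ) => ‖g p.2‖ₑ ^ 2 := hgm.comp measurable_snd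
          rw [Measure.volume_eq_prod, ← Measure.prod_restrict, lintegral_prod _ h.aemeasurable]
          simp
  have hmain : volume (refSimplex m) * (Measure.euclideanHausdorffMeasure m (base b) *
      ∫⁻ x in hull b, ‖g (baseCoords b x)‖ₑ ^ 2) ≤ volume (refFace m) * (volume (hull b) *
      ∫⁻ x in base b, ‖g (baseCoords b x)‖ₑ ^ 2 ∂(Measure.euclideanHausdorffMeasure m)) := by
    rw [h1 _ hm, h2 _ hm, h3, h4]
    simp only [baseCoords_param]
    calc volume (refSimplex m) * (β * volume (refFace m) * (α * ∫⁻ p in refSimplex m, ‖g p.2‖ₑ ^ 2))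
        ≤ volume (refSimplex m) * (β * volume (refFace m) * (α * ∫⁻ y in refFace m, ‖g y‖ₑ ^ 2)) := by
          gcongr
      _ = _ := by ring
  rw [lintegral_enorm_sq_eq hL1, lintegral_enorm_sq_eq hL2] at hmain
  have := ENNReal.toReal_mono (by
    have h5 : volume (refFace m) ≠ ⊤ := isCompact_refFace.measure_lt_top.ne
    have h6 := volume_hull_ne_top b
    finiteness) hmain
  simp only [ENNReal.toReal_mul, Real.norm_eq_abs, sq_abs,
    ENNReal.toReal_ofReal (integral_nonneg fun x => sq_nonneg (g (baseCoords b x)))] at this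
  exact this

theorem exists_integral_base_eq : ∃ β : ℝ, 0 ≤ β ∧ ∀ f : Eu (m + 1) → ℝ, Continuous f →
    ∫ x in base b, f x ∂(Measure.euclideanHausdorffMeasure m) =
      β * ∫ y in refFace m, f (param b (0, y)) := by
  obtain ⟨β, hβ0, hβ, h⟩ := exists_hausdorff_base_eq b
  refine ⟨β.toReal, ENNReal.toReal_nonneg, fun f hf => ?_⟩
  have hp : Continuous fun y => param b (0, y) := by
    have := continuous_param b
    fun_prop
  rw [h, integral_smul_measure, integral_map hp.measurable.aemeasurable hf.aestronglyMeasurable,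
    smul_eq_mul]

/-- A polynomial on the base of a simplex can be lifted to the simplex. -/
theorem exists_lift (m ℓ : ℕ) : ∃ C : ℝ, 0 ≤ C ∧
    ∀ b : AffineBasis (Fin (m + 2)) ℝ (Eu (m + 1)), ∀ p : Poly (m + 1) ℓ,
      ∃ r : Poly (m + 1) ℓ, (∀ x, b.coord 0 x = 0 → polyFun r x = polyFun p x) ∧
        (Measure.euclideanHausdorffMeasure m).real (base b) * ∫ x in hull b, polyFun r x ^ 2 ≤
          C * volume.real (hull b) *
            ∫ x in base b, polyFun p x ^ 2 ∂(Measure.euclideanHausdorffMeasure m) ∧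
        inDiam b ^ 2 * ((Measure.euclideanHausdorffMeasure m).real (base b) *
          ∫ x in hull b, ‖gradient (polyFun r) x‖ ^ 2) ≤
          C * volume.real (hull b) *
            ∫ x in base b, polyFun p x ^ 2 ∂(Measure.euclideanHausdorffMeasure m) := by
  obtain ⟨Ci, hCi0, hCi⟩ := exists_inverse_inequality m ℓ
  set κ := volume.real (refFace m) / volume.real (refSimplex m) with hκ
  have hκ0 : 0 ≤ κ := by positivity
  -- The summand 1 serves the `L²` bound. In the other one, one `m` comes from Cauchy–Schwarz for
  -- the sum of partial derivatives and one from adding `m` inverse inequalities.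
  refine ⟨κ * (1 + m * (m * Ci)), by positivity, fun b p => ?_⟩
  set μ := Measure.euclideanHausdorffMeasure m (X := Eu (m + 1)) with hμ
  have hK0 : 0 < volume.real (refSimplex m) :=
    ENNReal.toReal_pos (volume_refSimplex_ne_zero b) isCompact_refSimplex.measure_lt_top.ne
  set V := volume.real (hull b) with hV
  have hV0 : 0 ≤ V := measureReal_nonneg
  -- The polynomial `p` in the coordinates of the face; affine substitutions keep the degree at most
  -- `ℓ`.
  set q : MvPolynomial (Fin m) ℝ := MvPolynomial.aeval (fun j : Fin (m + 1) =>
    MvPolynomial.C (param b (0, 0) j) + ∑ i : Fin m, MvPolynomial.C ((b i.succ.succ - b 1) j) *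
      MvPolynomial.X i) (p : MvPolynomial (Fin (m + 1)) ℝ) with hq
  have hqdeg : q ∈ MvPolynomial.restrictTotalDegree (Fin m) ℝ ℓ :=
    (MvPolynomial.mem_restrictTotalDegree _ _ _).2
      ((totalDegree_aeval_le _ (fun j => totalDegree_affine_le _ _) _).trans
        ((MvPolynomial.mem_restrictTotalDegree _ _ _).1 p.2))
  have hqe : ∀ y, MvPolynomial.eval y q = polyFun p (param b (0, y)) := by
    intro y
    rw [hq, eval_aeval, polyFun]
    congr 2
    ext j
    rw [eval_affine]
    simp [param, paramLin_apply, mul_comm]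
  -- The lift extends the values on the face constantly in the direction `b 0 - b 1`, along which
  -- the coordinates of the face do not change.
  set r : MvPolynomial (Fin (m + 1)) ℝ := MvPolynomial.aeval (fun i : Fin m =>
    MvPolynomial.C (baseCoords b 0 i) + ∑ j : Fin (m + 1),
      MvPolynomial.C (baseCoordsLin b (EuclideanSpace.single j 1) i) * MvPolynomial.X j) q with hr
  have hrdeg : r ∈ Poly (m + 1) ℓ :=
    (MvPolynomial.mem_restrictTotalDegree _ _ _).2
      ((totalDegree_aeval_le _ (fun j => totalDegree_affine_le _ _) _).trans
        ((MvPolynomial.mem_restrictTotalDegree _ _ _).1 hqdeg))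
  set Q : (Fin m → ℝ) → ℝ := fun y => MvPolynomial.eval y q with hQ
  have hre : ∀ x, polyFun (⟨r, hrdeg⟩ : Poly (m + 1) ℓ) x = Q (baseCoords b x) := by
    intro x
    rw [polyFun, hQ]
    simp only [hr]
    rw [eval_aeval]
    congr 2
    ext i
    rw [eval_affine, baseCoords_eq b x, Pi.add_apply]
    congr 1
    have hx : x = ∑ j, x j • EuclideanSpace.single j (1 : ℝ) := by
      ext k
      simp [Pi.single_apply]
    conv_rhs => rw [hx, map_sum, Finset.sum_apply]
    refine Finset.sum_congr rfl fun j _ => ?_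
    rw [map_smul, Pi.smul_apply, smul_eq_mul, mul_comm]
  have hQs : ContDiff ℝ ∞ Q := contDiff_eval q
  set dQ : Fin m → (Fin m → ℝ) → ℝ := fun i y => fderiv ℝ Q y (Pi.single i 1) with hdQ
  have hdc : ∀ i, Continuous (dQ i) := fun i => by
    have := hQs.continuous_fderiv (by simp)
    simp only [hdQ]
    fun_prop
  set B := ∫ x in base b, polyFun p x ^ 2 ∂μ with hB
  have hB0 : 0 ≤ B := integral_nonneg fun x => sq_nonneg _
  have hbase : ∀ x ∈ base b, Q (baseCoords b x) = polyFun p x := fun x hx => by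
    rw [hQ]
    simp only
    rw [hqe, param_baseCoords b ((mem_base_iff b x).1 hx).2]
  have hBQ : ∫ x in base b, Q (baseCoords b x) ^ 2 ∂μ = B :=
    setIntegral_congr_fun (isCompact_base b).measurableSet fun x hx => by
      simp only [hbase x hx]
  have hscale : ∀ g : (Fin m → ℝ) → ℝ, Continuous g →
      μ.real (base b) * ∫ x in hull b, g (baseCoords b x) ^ 2 ≤
        κ * (V * ∫ x in base b, g (baseCoords b x) ^ 2 ∂μ) := by
    intro g hg
    have := integral_hull_comp_baseCoords_le b hg
    rw [hκ, div_mul_eq_mul_div, le_div_iff₀ hK0, mul_comm]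
    exact this
  have hdB : ∀ i, ∫ x in base b, dQ i (baseCoords b x) ^ 2 ∂μ ≤ Ci * B := by
    intro i
    obtain ⟨β, hβ0, hβ⟩ := exists_integral_base_eq b
    have hcc := continuous_baseCoords b
    have hQc := hQs.continuous
    have hdci := hdc i
    rw [← hBQ, hβ _ (by fun_prop), hβ _ (by fun_prop)]
    simp only [baseCoords_param]
    rw [mul_left_comm]
    exact mul_le_mul_of_nonneg_left (hCi q hqdeg i) hβ0
  refine ⟨⟨r, hrdeg⟩, fun x hx => ?_, ?_, ?_⟩
  · rw [hre, hQ]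
    simp only
    rw [hqe, param_baseCoords b hx]
  · simp only [hre]
    refine (hscale Q hQs.continuous).trans ?_
    rw [hBQ]
    have : 0 ≤ κ * (m * (m * Ci)) * (V * B) := by positivity
    linarith
  · have hgrad : ∀ x, inDiam b ^ 2 * ‖gradient (polyFun (⟨r, hrdeg⟩ : Poly (m + 1) ℓ)) x‖ ^ 2 ≤
        m * ∑ i, dQ i (baseCoords b x) ^ 2 := by
      intro x
      have hin0 : 0 ≤ inDiam b := Real.sSup_nonneg fun δ hδ => hδ.1
      have hfd : fderiv ℝ (polyFun (⟨r, hrdeg⟩ : Poly (m + 1) ℓ)) x =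
          (fderiv ℝ Q (baseCoords b x)).comp (baseCoordsLin b) := by
        rw [funext hre]
        exact ((hQs.differentiable (by simp) _).hasFDerivAt.comp x
          (hasFDerivAt_baseCoords b x)).fderiv
      -- By the chain rule the derivative is a sum of partial derivatives of `Q` times linear parts
      -- of barycentric coordinates, each of norm at most the inverse of `inDiam b`.
      have hb1 : inDiam b * ‖gradient (polyFun (⟨r, hrdeg⟩ : Poly (m + 1) ℓ)) x‖ ≤
          ∑ i, |dQ i (baseCoords b x)| := by
        rw [norm_gradient, hfd]
        rcases hin0.eq_or_lt with h0 | h0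
        · rw [← h0, zero_mul]
          exact Finset.sum_nonneg fun i _ => abs_nonneg _
        rw [mul_comm, ← le_div_iff₀ h0]
        refine ContinuousLinearMap.opNorm_le_bound _ (by positivity) fun v => ?_
        rw [ContinuousLinearMap.comp_apply, ← ContinuousLinearMap.coe_coe,
          (fderiv ℝ Q (baseCoords b x)).toLinearMap.pi_apply_eq_sum_univ, div_mul_eq_mul_div, le_div_iff₀ h0, Finset.sum_mul]
        refine (mul_le_mul_of_nonneg_right (norm_sum_le _ _) h0.le).trans ?_
        rw [Finset.sum_mul]
        refine Finset.sum_le_sum fun i _ => ?_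
        have hsingle : (fun j => if i = j then (1 : ℝ) else 0) = Pi.single i 1 := by
          ext j
          simp [Pi.single_apply, eq_comm]
        rw [norm_smul, hsingle]
        have h1 := inDiam_mul_abs_coord_le b i.succ.succ v
        calc ‖baseCoordsLin b v i‖ * ‖fderiv ℝ Q (baseCoords b x) (Pi.single i 1)‖ * inDiam b
            = |dQ i (baseCoords b x)| * (inDiam b * |(b.coord i.succ.succ).linear v|) := by
              rw [Real.norm_eq_abs, Real.norm_eq_abs, mul_comm, mul_comm |_|, mul_left_comm]
              rfl
          _ ≤ _ := by gcongr
      calc inDiam b ^ 2 * ‖gradient (polyFun (⟨r, hrdeg⟩ : Poly (m + 1) ℓ)) x‖ ^ 2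
          = (inDiam b * ‖gradient (polyFun (⟨r, hrdeg⟩ : Poly (m + 1) ℓ)) x‖) ^ 2 := by ring
        _ ≤ (∑ i, |dQ i (baseCoords b x)|) ^ 2 := by gcongr
        _ ≤ m * ∑ i, dQ i (baseCoords b x) ^ 2 := by
            have := sq_sum_le_card_mul_sum_sq (s := (Finset.univ : Finset (Fin m)))
              (f := fun i => |dQ i (baseCoords b x)|)
            simpa using this
    have hint : ∀ i, IntegrableOn (fun x => dQ i (baseCoords b x) ^ 2) (hull b) := fun i => by
      have hcc := continuous_baseCoords b
      have hdci := hdc i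
      exact (Continuous.continuousOn (by fun_prop)).integrableOn_compact (isCompact_hull b)
    have hgi : IntegrableOn (fun x => ‖gradient (polyFun (⟨r, hrdeg⟩ : Poly (m + 1) ℓ)) x‖ ^ 2)
        (hull b) := by
      have := continuous_gradient (contDiff_polyFun (⟨r, hrdeg⟩ : Poly (m + 1) ℓ))
      exact (Continuous.continuousOn (by fun_prop)).integrableOn_compact (isCompact_hull b)
    have h1 : inDiam b ^ 2 * ∫ x in hull b, ‖gradient (polyFun (⟨r, hrdeg⟩ : Poly (m + 1) ℓ)) x‖ ^ 2
        ≤ m * ∑ i, ∫ x in hull b, dQ i (baseCoords b x) ^ 2 := by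
      rw [← integral_const_mul, ← integral_finsetSum _ fun i _ => hint i, ← integral_const_mul]
      exact setIntegral_mono (hgi.const_mul _)
        ((integrable_finsetSum _ fun i _ => hint i).const_mul _) hgrad
    have hA0 : 0 ≤ μ.real (base b) := measureReal_nonneg
    calc inDiam b ^ 2 * (μ.real (base b) *
          ∫ x in hull b, ‖gradient (polyFun (⟨r, hrdeg⟩ : Poly (m + 1) ℓ)) x‖ ^ 2)
        = μ.real (base b) * (inDiam b ^ 2 *
          ∫ x in hull b, ‖gradient (polyFun (⟨r, hrdeg⟩ : Poly (m + 1) ℓ)) x‖ ^ 2) := by ring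
      _ ≤ μ.real (base b) * (m * ∑ i, ∫ x in hull b, dQ i (baseCoords b x) ^ 2) := by gcongr
      _ = m * ∑ i, μ.real (base b) * ∫ x in hull b, dQ i (baseCoords b x) ^ 2 := by
          rw [← Finset.mul_sum]; ring
      _ ≤ m * ∑ _i : Fin m, κ * (V * (Ci * B)) := by
          refine mul_le_mul_of_nonneg_left (Finset.sum_le_sum fun i _ => ?_) (Nat.cast_nonneg m)
          refine (hscale _ (hdc i)).trans ?_
          gcongr
          exact hdB i
      _ = κ * (m * (m * Ci)) * V * B := by
          simp only [Finset.sum_const, Finset.card_univ, Fintype.card_fin, nsmul_eq_mul]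
          ring
      _ ≤ κ * (1 + m * (m * Ci)) * V * B := by gcongr; linarith

end

section

variable {m : ℕ}

/-! ### Geometry of simplices -/

/-- The affine basis given by the vertices of a simplex. -/
def simplexBasis (s : Affine.Simplex ℝ (Eu (m + 1)) (m + 1)) :
    AffineBasis (Fin (m + 2)) ℝ (Eu (m + 1)) :=
  ⟨s.points, s.independent, by
    rw [s.independent.affineSpan_eq_top_iff_card_eq_finrank_add_one]; simp⟩

/-- The affine basis given by the vertices of a simplex, with the vertex of index `k` first. -/
def basisAt (s : Affine.Simplex ℝ (Eu (m + 1)) (m + 1)) (k : Fin (m + 2)) :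
    AffineBasis (Fin (m + 2)) ℝ (Eu (m + 1)) :=
  (simplexBasis s).reindex (Equiv.swap 0 k)

theorem hull_reindex (b : AffineBasis (Fin (m + 2)) ℝ (Eu (m + 1))) (e : Equiv.Perm (Fin (m + 2))) :
    hull (b.reindex e) = hull b := by
  rw [hull, hull, AffineBasis.coe_reindex, e.symm.surjective.range_comp]

theorem hull_basisAt (s : Affine.Simplex ℝ (Eu (m + 1)) (m + 1)) (k : Fin (m + 2)) :
    hull (basisAt s k) = el s := by
  rw [basisAt, hull_reindex]
  rfl

theorem base_basisAt (s : Affine.Simplex ℝ (Eu (m + 1)) (m + 1)) (k : Fin (m + 2)) :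
    base (basisAt s k) = face s k := by
  rw [base, face]
  congr 1
  have h : (fun i : Fin (m + 1) => basisAt s k i.succ) = s.points ∘ (Equiv.swap 0 k ∘ Fin.succ) := by
    ext1 i
    rw [basisAt, AffineBasis.reindex_apply, Equiv.symm_swap]
    rfl
  have h2 : Set.range (Equiv.swap 0 k ∘ Fin.succ) = {k}ᶜ := by
    rw [Set.range_comp, Fin.range_succ, Set.image_compl_eq (Equiv.swap 0 k).bijective,
      Set.image_singleton, Equiv.swap_apply_left]
  rw [h, Set.range_comp, h2]

theorem interior_hull (b : AffineBasis (Fin (m + 2)) ℝ (Eu (m + 1))) :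
    interior (hull b) = {x | ∀ i, 0 < b.coord i x} := b.interior_convexHull

theorem frontier_el_subset (s : Affine.Simplex ℝ (Eu (m + 1)) (m + 1)) :
    frontier (el s) ⊆ ⋃ k, face s k := by
  intro x hx
  have h0 : hull (simplexBasis s) = el s := rfl
  rw [← h0, (isCompact_hull _).isClosed.frontier_eq, interior_hull] at hx
  obtain ⟨hx1, hx2⟩ := hx
  simp only [Set.mem_ofPred_eq, not_forall, not_lt] at hx2
  obtain ⟨k, hk⟩ := hx2
  refine Set.mem_iUnion.2 ⟨k, ?_⟩
  rw [← base_basisAt, mem_base_iff, basisAt, hull_reindex, AffineBasis.coord_reindex,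
    Equiv.symm_swap, Equiv.swap_apply_left]
  exact ⟨hx1, le_antisymm hk ((mem_hull_iff _ x).1 hx1 k)⟩

theorem face_subset_frontier (s : Affine.Simplex ℝ (Eu (m + 1)) (m + 1)) (k : Fin (m + 2)) :
    face s k ⊆ frontier (el s) := by
  intro x hx
  rw [← base_basisAt, mem_base_iff] at hx
  rw [← hull_basisAt s k, (isCompact_hull _).isClosed.frontier_eq, interior_hull]
  exact ⟨hx.1, fun h => (h 0).ne' hx.2⟩

theorem inDiam_basisAt (s : Affine.Simplex ℝ (Eu (m + 1)) (m + 1)) (k : Fin (m + 2)) :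
    inDiam (basisAt s k) = rho s := by
  rw [inDiam, hull_basisAt, rho]

/-! ### Comparability of the areas of the faces of a simplex -/

section Areas

variable (b : AffineBasis (Fin (m + 2)) ℝ (Eu (m + 1)))

/-- The affine map that permutes the vertices of a simplex. -/
def permMap (e : Equiv.Perm (Fin (m + 2))) : Eu (m + 1) →ᵃ[ℝ] Eu (m + 1) :=
  (Fintype.linearCombination ℝ (b ∘ e)).toAffineMap.comp b.coords

theorem permMap_apply (e : Equiv.Perm (Fin (m + 2))) (x : Eu (m + 1)) :
    permMap b e x = ∑ i, b.coord i x • b (e i) := by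
  simp [permMap, Fintype.linearCombination_apply]

theorem permMap_vertex (e : Equiv.Perm (Fin (m + 2))) (j : Fin (m + 2)) :
    permMap b e (b j) = b (e j) := by
  simp [permMap_apply, AffineBasis.coord_apply]

theorem inDiam_nonneg : 0 ≤ inDiam b := Real.sSup_nonneg fun _ hδ => hδ.1

theorem inDiam_pos : 0 < inDiam b := by
  obtain ⟨x, hx⟩ : (interior (hull b)).Nonempty := ⟨_, b.centroid_mem_interior_convexHull⟩
  obtain ⟨ε, hε, hball⟩ := Metric.nhds_basis_closedBall.mem_iff.1 (mem_interior_iff_mem_nhds.1 hx)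
  -- Boundedness is essential, as the real supremum of an unbounded set is 0 by convention.
  have hbdd : BddAbove {δ : ℝ | 0 ≤ δ ∧ ∃ x, Metric.closedBall x (δ / 2) ⊆ hull b} := by
    refine ⟨Metric.diam (hull b), ?_⟩
    rintro δ ⟨hδ, y, hy⟩
    have := Metric.diam_mono hy (isCompact_hull b).isBounded
    rwa [Metric.diam_closedBall_eq _ (by positivity), mul_div_cancel₀ _ (by norm_num)] at this
  exact (by positivity : 0 < 2 * ε).trans_le (le_csSup hbdd ⟨by positivity, x, by
    rwa [mul_div_cancel_left₀ _ (by norm_num)]⟩)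

/-- Each barycentric coordinate has Lipschitz constant at most the inverse of `inDiam b`. The
coordinate differences sum to zero, so every vertex may be replaced by its difference from a fixed
one, of norm at most the diameter. -/
theorem dist_permMap_le (e : Equiv.Perm (Fin (m + 2))) (x y : Eu (m + 1)) :
    dist (permMap b e x) (permMap b e y) ≤
      (m + 2) * (Metric.diam (hull b) / inDiam b) * dist x y := by
  have hρ := inDiam_pos b
  have hl : ∀ i, (b.coord i).linear (x - y) = b.coord i x - b.coord i y := fun i =>
    (b.coord i).linearMap_vsub x y
  have h1 : permMap b e x - permMap b e y =
      ∑ i, ((b.coord i).linear (x - y)) • (b (e i) - b (e 0)) := by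
    have h0 : ∑ i, (b.coord i).linear (x - y) = 0 := by
      simp only [hl, Finset.sum_sub_distrib, b.sum_coord_apply_eq_one, sub_self]
    simp only [smul_sub, Finset.sum_sub_distrib, ← Finset.sum_smul, h0, zero_smul, sub_zero]
    simp only [hl, sub_smul, Finset.sum_sub_distrib, permMap_apply]
  rw [dist_eq_norm, h1]
  calc ‖∑ i, ((b.coord i).linear (x - y)) • (b (e i) - b (e 0))‖
      ≤ ∑ _i : Fin (m + 2), (dist x y / inDiam b) * Metric.diam (hull b) := by
        refine (norm_sum_le _ _).trans (Finset.sum_le_sum fun i _ => ?_)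
        rw [norm_smul]
        refine mul_le_mul ?_ ?_ (norm_nonneg _) (by positivity)
        · rw [le_div_iff₀ hρ, mul_comm, dist_eq_norm]
          exact inDiam_mul_abs_coord_le b i (x - y)
        · rw [← dist_eq_norm]
          exact Metric.dist_le_diam_of_mem (isCompact_hull b).isBounded
            (subset_convexHull ℝ _ ⟨_, rfl⟩) (subset_convexHull ℝ _ ⟨_, rfl⟩)
    _ = _ := by
        simp only [Finset.sum_const, Finset.card_univ, Fintype.card_fin, nsmul_eq_mul]
        push_cast
        ring

theorem permMap_image_base (e : Equiv.Perm (Fin (m + 2))) :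
    permMap b e '' base b = base (b.reindex e.symm) := by
  rw [base, AffineMap.image_convexHull, base, ← Set.range_comp]
  congr 2
  ext1 i
  simp [permMap_vertex, AffineBasis.reindex_apply]

/-- One face is the image of another under the Lipschitz affine map that permutes the vertices, and
Hausdorff measure grows at most by the `m`-th power of the Lipschitz constant. -/
theorem hausdorff_base_reindex_le {σ : ℝ} (hσ : Metric.diam (hull b) / inDiam b ≤ σ)
    (e : Equiv.Perm (Fin (m + 2))) :
    Measure.euclideanHausdorffMeasure m (base (b.reindex e)) ≤
      ENNReal.ofReal (((m + 2) * σ) ^ m) * Measure.euclideanHausdorffMeasure m (base b) := by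
  have hσ0 : 0 ≤ σ := le_trans (div_nonneg Metric.diam_nonneg (inDiam_nonneg b)) hσ
  have hL : LipschitzWith (Real.toNNReal ((m + 2) * σ)) (permMap b e.symm) :=
    LipschitzWith.of_dist_le_mul fun x y => by
      rw [Real.coe_toNNReal _ (by positivity)]
      refine (dist_permMap_le b e.symm x y).trans ?_
      gcongr
  have himg := permMap_image_base b e.symm
  rw [Equiv.symm_symm] at himg
  have h := hL.hausdorffMeasure_image_le (d := (m : ℝ)) (Nat.cast_nonneg m) (base b)
  rw [himg] at h
  simp only [Measure.euclideanHausdorffMeasure_def, Measure.smul_apply]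
  rw [ENNReal.rpow_natCast] at h
  rw [ENNReal.ofReal_pow (by positivity), mul_smul_comm]
  exact smul_le_smul_of_nonneg_left h zero_le

end Areas

theorem surf_univ_le (s : Affine.Simplex ℝ (Eu (m + 1)) (m + 1)) (k : Fin (m + 2)) {σ : ℝ}
    (hσ : Metric.diam (el s) / rho s ≤ σ) :
    surf (el s) Set.univ ≤ (m + 2) * ENNReal.ofReal (((m + 2) * σ) ^ m) *
      Measure.euclideanHausdorffMeasure m (face s k) := by
  rw [surf, Measure.restrict_apply_univ, Nat.add_sub_cancel]
  refine (measure_mono (frontier_el_subset s)).trans ((measure_iUnion_le _).trans ?_)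
  rw [tsum_fintype]
  calc ∑ j, Measure.euclideanHausdorffMeasure m (face s j)
      ≤ ∑ _j : Fin (m + 2), ENNReal.ofReal (((m + 2) * σ) ^ m) *
          Measure.euclideanHausdorffMeasure m (face s k) := by
        refine Finset.sum_le_sum fun j _ => ?_
        have hj : basisAt s j =
            (basisAt s k).reindex ((Equiv.swap 0 k).symm.trans (Equiv.swap 0 j)) := by
          refine AffineBasis.ext ?_
          ext1 i
          simp [basisAt, AffineBasis.reindex_apply]
        rw [← base_basisAt, ← base_basisAt s k, hj]
        refine hausdorff_base_reindex_le _ ?_ _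
        rwa [hull_basisAt, inDiam_basisAt]
    _ = _ := by
        simp only [Finset.sum_const, Finset.card_univ, Fintype.card_fin, nsmul_eq_mul]
        push_cast
        ring

theorem surf_univ_ne_top (s : Affine.Simplex ℝ (Eu (m + 1)) (m + 1)) :
    surf (el s) Set.univ ≠ ⊤ := by
  refine ne_top_of_le_ne_top ?_ (surf_univ_le s 0 le_rfl)
  have h := hausdorff_base_ne_top (basisAt s 0)
  rw [base_basisAt] at h
  have : (m + 2 : ENNReal) ≠ ⊤ := by finiteness
  finiteness

/-! ### Pairs of simplices with a common face -/

section Pair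

variable {b b' : AffineBasis (Fin (m + 2)) ℝ (Eu (m + 1))}

theorem AffineBasis.apply_eq_sum (b : AffineBasis (Fin (m + 2)) ℝ (Eu (m + 1)))
    (f : Eu (m + 1) →ᵃ[ℝ] ℝ) (x : Eu (m + 1)) : f x = ∑ i, b.coord i x * f (b i) := by
  have h := Finset.map_affineCombination Finset.univ b (fun i => b.coord i x)
    (b.sum_coord_apply_eq_one x) f
  rw [b.affineCombination_coord_eq_self, Finset.affineCombination_eq_linear_combination _ _ _
    (b.sum_coord_apply_eq_one x)] at h
  simpa using h

/-- The barycenter of the base of a simplex. -/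
def baseCenter (b : AffineBasis (Fin (m + 2)) ℝ (Eu (m + 1))) : Eu (m + 1) :=
  param b (0, fun _ => 1 / (m + 1))

theorem coord_zero_baseCenter : b.coord 0 (baseCenter b) = 0 := by
  rw [baseCenter, coord_zero_param]

theorem coord_baseCenter_pos {i : Fin (m + 2)} (hi : i ≠ 0) : 0 < b.coord i (baseCenter b) := by
  obtain ⟨j, rfl⟩ := Fin.exists_succ_eq.2 hi
  refine Fin.cases ?_ (fun j => ?_) j
  · rw [Fin.succ_zero_eq_one, coord_one]
    simp only [baseCenter, coord_zero_param, coord_succ_succ_param, Finset.sum_const,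
      Finset.card_univ, Fintype.card_fin, nsmul_eq_mul]
    rw [sub_zero, mul_one_div, sub_pos, div_lt_one (by positivity)]
    linarith
  · rw [baseCenter, coord_succ_succ_param]
    positivity

theorem coord_add_smul (i : Fin (m + 2)) (x v : Eu (m + 1)) (τ : ℝ) :
    b.coord i (x + τ • v) = b.coord i x + τ * (b.coord i).linear v := by
  have := (b.coord i).map_vadd x (τ • v)
  rw [vadd_eq_add, vadd_eq_add, map_smul, smul_eq_mul] at this
  rw [add_comm x, this, add_comm]

theorem exists_pos_coord_pos {x : Eu (m + 1)} (hx : ∀ i ≠ 0, 0 < b.coord i x) (v : Eu (m + 1)) :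
    ∃ τ : ℝ, 0 < τ ∧ τ < 1 ∧ ∀ i ≠ 0, 0 < b.coord i (x + τ • v) := by
  have h : ∀ᶠ τ : ℝ in 𝓝[>] 0, ∀ i ≠ 0, 0 < b.coord i (x + τ • v) := by
    refine Filter.eventually_all.2 fun i => Filter.eventually_imp_distrib_left.2 fun hi => ?_
    have hc : Continuous fun τ : ℝ => b.coord i (x + τ • v) := by
      simp only [coord_add_smul]
      fun_prop
    have h0 : 0 < b.coord i (x + (0 : ℝ) • v) := by simpa using hx i hi
    exact (hc.continuousAt.eventually_const_lt h0).filter_mono nhdsWithin_le_nhds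
  obtain ⟨τ, hτ, h1⟩ := (h.and (Ioo_mem_nhdsGT one_pos)).exists
  exact ⟨τ, h1.1, h1.2, hτ⟩

theorem mem_hull_of_forall_ne {x : Eu (m + 1)} (h0 : 0 ≤ b.coord 0 x)
    (hx : ∀ i ≠ 0, 0 < b.coord i x) : x ∈ hull b :=
  (mem_hull_iff b x).2 fun i => by
    rcases eq_or_ne i 0 with rfl | hi
    · exact h0
    · exact (hx i hi).le

theorem vertex_mem_base (b : AffineBasis (Fin (m + 2)) ℝ (Eu (m + 1))) {i : Fin (m + 2)}
    (hi : i ≠ 0) : b i ∈ base b := by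
  obtain ⟨j, rfl⟩ := Fin.exists_succ_eq.2 hi
  exact subset_convexHull ℝ _ ⟨j, rfl⟩

/-- The two bases may number the vertices of the face differently. The center can be moved slightly
away from the vertex `b' i` without leaving the face, and a vanishing `i`-th coordinate would
thereby become negative. -/
theorem coord_baseCenter_pos_of_base_eq (hb : base b = base b') {i : Fin (m + 2)} (hi : i ≠ 0) :
    0 < b'.coord i (baseCenter b) := by
  have hz : b' i ∈ base b := hb ▸ vertex_mem_base b' hi
  obtain ⟨τ, hτ0, -, hτ⟩ := exists_pos_coord_pos (b := b) (fun j hj => coord_baseCenter_pos hj)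
    (baseCenter b - b' i)
  have h0 : b.coord 0 (baseCenter b + τ • (baseCenter b - b' i)) = 0 := by
    rw [coord_add_smul, ← vsub_eq_sub (baseCenter b), AffineMap.linearMap_vsub, vsub_eq_sub,
      ((mem_base_iff b _).1 hz).2, coord_zero_baseCenter]
    ring
  have hp : baseCenter b + τ • (baseCenter b - b' i) ∈ base b' := by
    rw [← hb, mem_base_iff]
    exact ⟨mem_hull_of_forall_ne h0.ge hτ, h0⟩
  have h1 := (mem_hull_iff b' _).1 (base_subset_hull b' hp) i
  rw [coord_add_smul, ← vsub_eq_sub (baseCenter b), AffineMap.linearMap_vsub, vsub_eq_sub,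
    b'.coord_apply_eq] at h1
  nlinarith

/-- The coordinate `b.coord 0` vanishes on the common face, so it is a multiple of `b'.coord 0`. The
factor is nonzero because `b.coord 0` is not the zero function, and a positive factor would make the
simplices overlap beyond the face. -/
theorem exists_neg_coord_eq (hb : base b = hull b ∩ hull b') (hb' : base b' = hull b ∩ hull b') :
    ∃ c < 0, ∀ x, b.coord 0 x = c * b'.coord 0 x := by
  have hbb : base b = base b' := hb.trans hb'.symm
  have hrep : ∀ x, b.coord 0 x = b.coord 0 (b' 0) * b'.coord 0 x := by
    intro x
    rw [AffineBasis.apply_eq_sum b' (b.coord 0) x, Finset.sum_eq_single 0, mul_comm]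
    · intro i _ hi
      have hz : b' i ∈ base b := hbb ▸ vertex_mem_base b' hi
      rw [((mem_base_iff b _).1 hz).2, mul_zero]
    · simp
  refine ⟨b.coord 0 (b' 0), ?_, hrep⟩
  by_contra hc
  rcases (not_lt.1 hc).eq_or_lt with h0 | h0
  · have := hrep (b 0)
    rw [← h0, b.coord_apply_eq, zero_mul] at this
    exact one_ne_zero this
  -- A short step from the center of the face towards `b' 0` would lie in both simplices but off the
  -- hyperplane.
  · obtain ⟨τ, hτ0, hτ1, hτ⟩ := exists_pos_coord_pos (b := b) (fun j hj => coord_baseCenter_pos hj)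
      (b' 0 - baseCenter b)
    set p := baseCenter b + τ • (b' 0 - baseCenter b) with hp
    have hp0 : b.coord 0 p = τ * b.coord 0 (b' 0) := by
      rw [hp, coord_add_smul, ← vsub_eq_sub (b' 0), AffineMap.linearMap_vsub, vsub_eq_sub,
        coord_zero_baseCenter]
      ring
    have hpos : 0 < τ * b.coord 0 (b' 0) := mul_pos hτ0 h0
    have h1 : p ∈ hull b := mem_hull_of_forall_ne (hp0 ▸ hpos.le) hτ
    have hac : baseCenter b ∈ hull b' := by
      refine base_subset_hull b' (hbb ▸ (mem_base_iff b _).2 ⟨?_, coord_zero_baseCenter⟩)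
      exact mem_hull_of_forall_ne coord_zero_baseCenter.ge fun i hi => coord_baseCenter_pos hi
    have h2 : p ∈ hull b' := (convex_convexHull ℝ _).add_smul_sub_mem hac
      (subset_convexHull ℝ _ ⟨0, rfl⟩) ⟨hτ0.le, hτ1.le⟩
    have h3 : p ∈ base b := hb ▸ ⟨h1, h2⟩
    exact (hp0 ▸ hpos).ne' ((mem_base_iff b p).1 h3).2

theorem exists_closedBall_coord_pos {a : Eu (m + 1)} (ha : ∀ i ≠ 0, 0 < b.coord i a) :
    ∃ r > 0, ∀ x ∈ Metric.closedBall a r, ∀ i ≠ 0, 0 < b.coord i x := by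
  have h : ∀ᶠ x in 𝓝 a, ∀ i ≠ 0, 0 < b.coord i x := by
    refine Filter.eventually_all.2 fun i => Filter.eventually_imp_distrib_left.2 fun hi => ?_
    exact (AffineMap.continuous' (b.coord i)).continuousAt.eventually_const_lt (ha i hi)
  obtain ⟨r, hr, h1⟩ := Metric.nhds_basis_closedBall.mem_iff.1 h
  exact ⟨r, hr, fun x hx => h1 hx⟩

theorem mem_hull_of_coord_nonpos {c : ℝ} (hc : c < 0) (hc' : ∀ x, b.coord 0 x = c * b'.coord 0 x)
    {x : Eu (m + 1)} (h0 : b.coord 0 x ≤ 0) (hx : ∀ i ≠ 0, 0 < b'.coord i x) : x ∈ hull b' := by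
  refine mem_hull_of_forall_ne ?_ hx
  have := hc' x
  nlinarith

/-- If the segment crosses the hyperplane before parameter `t`, the crossing point is in `hull b`,
because all other coordinates stay nonnegative, hence in the common face. From there on the segment
joins two points of the convex set `hull b'`. -/
theorem lineMap_mem_hull_union {c : ℝ} (hc : c < 0) (hc' : ∀ x, b.coord 0 x = c * b'.coord 0 x)
    (hbb : base b = base b') {x y : Eu (m + 1)} (hx : x ∈ hull b)
    (hy : ∀ i ≠ 0, 0 < b.coord i y) (hy' : ∀ i ≠ 0, 0 < b'.coord i y) {t : ℝ}
    (ht : t ∈ Set.Ioo (0 : ℝ) 1) : (1 - t) • x + t • y ∈ hull b ∪ hull b' := by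
  have hlin : ∀ (s : ℝ) (i : Fin (m + 2)), b.coord i ((1 - s) • x + s • y) =
      (1 - s) * b.coord i x + s * b.coord i y := fun s i => by
    rw [show (1 - s) • x + s • y = AffineMap.lineMap x y s by
      rw [AffineMap.lineMap_apply_module], AffineMap.apply_lineMap, AffineMap.lineMap_apply_module]
    rfl
  have hx0 := (mem_hull_iff b x).1 hx
  have hseg : ∀ s ∈ Set.Ioo (0 : ℝ) 1, 0 ≤ b.coord 0 ((1 - s) • x + s • y) →
      (1 - s) • x + s • y ∈ hull b := fun s hs h0 => mem_hull_of_forall_ne h0 fun i hi => by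
    rw [hlin]
    have := mul_pos hs.1 (hy i hi)
    have := mul_nonneg (sub_nonneg.2 hs.2.le) (hx0 i)
    linarith
  rcases le_or_gt 0 (b.coord 0 ((1 - t) • x + t • y)) with h0 | h0
  · exact Or.inl (hseg t ht h0)
  · right
    have hy0 : b.coord 0 y < 0 := by
      rw [hlin] at h0
      by_contra h
      have := mul_nonneg (sub_nonneg.2 ht.2.le) (hx0 0)
      have := mul_nonneg ht.1.le (not_lt.1 h)
      linarith
    have hyh : y ∈ hull b' := mem_hull_of_coord_nonpos hc hc' hy0.le hy'
    set s := b.coord 0 x / (b.coord 0 x - b.coord 0 y) with hs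
    have hden : 0 < b.coord 0 x - b.coord 0 y := by linarith [hx0 0]
    have hs0 : 0 ≤ s := div_nonneg (hx0 0) hden.le
    have hs1 : s < 1 := (div_lt_one hden).2 (by linarith)
    have hz0 : b.coord 0 ((1 - s) • x + s • y) = 0 := by
      rw [hlin, hs]
      field_simp
      ring
    have hzh : (1 - s) • x + s • y ∈ hull b := by
      rcases hs0.eq_or_lt with h | h
      · rw [← h]; simpa using hx
      · exact hseg s ⟨h, hs1⟩ hz0.ge
    have hz' : (1 - s) • x + s • y ∈ hull b' :=
      base_subset_hull b' (hbb ▸ (mem_base_iff b _).2 ⟨hzh, hz0⟩)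
    have hst : s ≤ t := by
      rw [hlin] at h0
      rw [hs, div_le_iff₀ hden]
      nlinarith
    set κ := (t - s) / (1 - s) with hκ
    have h1s : 0 < 1 - s := by linarith
    have hκ0 : 0 ≤ κ := div_nonneg (by linarith) h1s.le
    have hκ1 : κ ≤ 1 := (div_le_one h1s).2 (by linarith [ht.2])
    have e : (1 - t) • x + t • y = (1 - κ) • ((1 - s) • x + s • y) + κ • y := by
      have e1 : (1 - κ) * (1 - s) = 1 - t := by rw [hκ]; field_simp; ring
      have e2 : (1 - κ) * s + κ = t := by rw [hκ]; field_simp; ring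
      rw [smul_add, smul_smul, smul_smul, add_assoc, ← add_smul, e1, e2]
    rw [e]
    exact (convex_convexHull ℝ _) hz' hyh (by linarith) hκ0 (by ring)

/-- The union of the two simplices need not be convex, but it is star-shaped with respect to a small
ball around the center of the common face, which is what density of smooth functions requires. The
statement about negative `b.coord 0` serves the uniqueness of neighbours. -/
theorem exists_ball_star (hb : base b = hull b ∩ hull b') (hb' : base b' = hull b ∩ hull b') :
    ∃ r > 0, Metric.closedBall (baseCenter b) r ⊆ hull b ∪ hull b' ∧
      (∀ x ∈ Metric.closedBall (baseCenter b) r, b.coord 0 x < 0 → x ∈ hull b') ∧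
      ∀ x ∈ hull b ∪ hull b', ∀ y ∈ Metric.closedBall (baseCenter b) r, ∀ t ∈ Set.Ioo (0 : ℝ) 1,
        (1 - t) • x + t • y ∈ hull b ∪ hull b' := by
  have hbb : base b = base b' := hb.trans hb'.symm
  obtain ⟨c, hc, hcoord⟩ := exists_neg_coord_eq hb hb'
  obtain ⟨r1, hr1, h1⟩ := exists_closedBall_coord_pos (b := b) (a := baseCenter b)
    fun i hi => coord_baseCenter_pos hi
  obtain ⟨r2, hr2, h2⟩ := exists_closedBall_coord_pos (b := b') (a := baseCenter b)
    fun i hi => coord_baseCenter_pos_of_base_eq hbb hi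
  have h1' : ∀ x ∈ Metric.closedBall (baseCenter b) (min r1 r2), ∀ i ≠ 0, 0 < b.coord i x :=
    fun x hx => h1 x (Metric.closedBall_subset_closedBall (min_le_left _ _) hx)
  have h2' : ∀ x ∈ Metric.closedBall (baseCenter b) (min r1 r2), ∀ i ≠ 0, 0 < b'.coord i x :=
    fun x hx => h2 x (Metric.closedBall_subset_closedBall (min_le_right _ _) hx)
  have hneg : ∀ x ∈ Metric.closedBall (baseCenter b) (min r1 r2), b.coord 0 x ≤ 0 → x ∈ hull b' :=
    fun x hx h0 => mem_hull_of_coord_nonpos hc hcoord h0 (h2' x hx)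
  refine ⟨min r1 r2, lt_min hr1 hr2, fun x hx => ?_, fun x hx h0 => hneg x hx h0.le,
    fun x hx y hy t ht => ?_⟩
  · rcases le_total 0 (b.coord 0 x) with h0 | h0
    · exact Or.inl (mem_hull_of_forall_ne h0 (h1' x hx))
    · exact Or.inr (hneg x hx h0)
  · rcases hx with hx | hx
    · exact lineMap_mem_hull_union hc hcoord hbb hx (h1' y hy) (h2' y hy) ht
    · rw [Set.union_comm]
      refine lineMap_mem_hull_union (c := c⁻¹) (inv_lt_zero.2 hc) (fun x => ?_) hbb.symm hx (h2' y hy)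
        (h1' y hy) ht
      rw [hcoord, inv_mul_cancel_left₀ hc.ne]

theorem exists_ball_star_interior (hb : base b = hull b ∩ hull b')
    (hb' : base b' = hull b ∩ hull b') :
    ∃ r > 0, ∀ x ∈ interior (hull b ∪ hull b'), ∀ y ∈ Metric.closedBall (baseCenter b) r,
      ∀ t ∈ Set.Ioo (0 : ℝ) 1, (1 - t) • x + t • y ∈ interior (hull b ∪ hull b') := by
  obtain ⟨r, hr, -, -, h⟩ := exists_ball_star hb hb'
  refine ⟨r, hr, fun x hx y hy t ht => ?_⟩
  have h1t : 1 - t ≠ 0 := by linarith [ht.2]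
  have ho : IsOpen ((fun z => (1 - t) • z + t • y) '' interior (hull b ∪ hull b')) := by
    have := ((Homeomorph.smulOfNeZero (1 - t) h1t).trans (Homeomorph.addRight (t • y))).isOpenMap
      (interior (hull b ∪ hull b')) isOpen_interior
    exact this
  refine interior_maximal ?_ ho ⟨x, hx, rfl⟩
  rintro _ ⟨z, hz, rfl⟩
  exact h z (interior_subset hz) y hy t ht

/-- Two simplices that share the same face with a third one overlap. -/
theorem not_disjoint_interior_of_common_base {b'' : AffineBasis (Fin (m + 2)) ℝ (Eu (m + 1))}
    (hb : base b = hull b ∩ hull b') (hb' : base b' = hull b ∩ hull b')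
    (hc : base b = hull b ∩ hull b'') (hc' : base b'' = hull b ∩ hull b'') :
    ¬ Disjoint (interior (hull b')) (interior (hull b'')) := by
  obtain ⟨r1, hr1, -, h1, -⟩ := exists_ball_star hb hb'
  obtain ⟨r2, hr2, -, h2, -⟩ := exists_ball_star hc hc'
  -- Half of a small ball around the center of the face, on the side away from `b 0`, lies in both
  -- neighbours.
  set O := Metric.ball (baseCenter b) (min r1 r2) ∩ {x | b.coord 0 x < 0} with hO
  have hOo : IsOpen O := Metric.isOpen_ball.inter
    (isOpen_lt (AffineMap.continuous' (b.coord 0)) continuous_const)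
  have hO1 : O ⊆ interior (hull b') := interior_maximal (fun x hx => h1 x
    (Metric.ball_subset_closedBall (Metric.ball_subset_ball (min_le_left _ _) hx.1)) hx.2) hOo
  have hO2 : O ⊆ interior (hull b'') := interior_maximal (fun x hx => h2 x
    (Metric.ball_subset_closedBall (Metric.ball_subset_ball (min_le_right _ _) hx.1)) hx.2) hOo
  have hne : O.Nonempty := by
    have hcont : Continuous fun τ : ℝ => baseCenter b + τ • (baseCenter b - b 0) := by fun_prop
    have h0 : baseCenter b + (0 : ℝ) • (baseCenter b - b 0) ∈
        Metric.ball (baseCenter b) (min r1 r2) := by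
      rw [zero_smul, add_zero]
      exact Metric.mem_ball_self (lt_min hr1 hr2)
    have hmem : ∀ᶠ τ : ℝ in 𝓝[>] 0, baseCenter b + τ • (baseCenter b - b 0) ∈
        Metric.ball (baseCenter b) (min r1 r2) :=
      (hcont.continuousAt.eventually_mem (Metric.isOpen_ball.mem_nhds h0)).filter_mono
        nhdsWithin_le_nhds
    obtain ⟨τ, h1, h2⟩ := (hmem.and self_mem_nhdsWithin).exists
    refine ⟨_, h1, ?_⟩
    rw [Set.mem_ofPred_eq, coord_add_smul, ← vsub_eq_sub (baseCenter b), AffineMap.linearMap_vsub,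
      vsub_eq_sub, b.coord_apply_eq, coord_zero_baseCenter]
    have : 0 < τ := h2
    linarith
  obtain ⟨x, hx⟩ := hne
  exact fun hd => Set.disjoint_left.1 hd (hO1 hx) (hO2 hx)

theorem volume_frontier_hull (b : AffineBasis (Fin (m + 2)) ℝ (Eu (m + 1))) :
    volume (frontier (hull b)) = 0 := (convex_convexHull ℝ _).addHaar_frontier volume

theorem restrict_interior_hull (b : AffineBasis (Fin (m + 2)) ℝ (Eu (m + 1))) :
    volume.restrict (interior (hull b)) = volume.restrict (hull b) :=
  Measure.restrict_congr_set (interior_ae_eq_of_null_frontier (volume_frontier_hull b))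

theorem coord_linear_ne_zero (b : AffineBasis (Fin (m + 2)) ℝ (Eu (m + 1))) (i : Fin (m + 2)) :
    (b.coord i).linear ≠ 0 := by
  obtain ⟨j, hj⟩ := exists_ne i
  intro h
  have := coord_linear_vertex b i i j
  rw [h, b.coord_apply_eq, b.coord_apply_ne hj.symm, LinearMap.zero_apply] at this
  norm_num at this

theorem restrict_interior_union (hb : base b = hull b ∩ hull b') :
    volume.restrict (interior (hull b ∪ hull b')) =
      volume.restrict (hull b) + volume.restrict (hull b') := by
  have h1 : volume (frontier (hull b ∪ hull b')) = 0 := by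
    refine measure_mono_null (frontier_union_subset _ _) (measure_union_null ?_ ?_)
    · exact measure_mono_null Set.inter_subset_left (volume_frontier_hull b)
    · exact measure_mono_null Set.inter_subset_right (volume_frontier_hull b')
  rw [Measure.restrict_congr_set (interior_ae_eq_of_null_frontier h1),
    Measure.restrict_union₀ ?_ (isCompact_hull b').measurableSet.nullMeasurableSet]
  rw [AEDisjoint, ← hb]
  exact measure_mono_null (fun x hx => ((mem_base_iff b x).1 hx).2)
    (volume_zeroSet (coord_linear_ne_zero b 0))

end Pair

end

section

/-! ### Convergence in `L²` -/

section Convergence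

variable {α F : Type*} [MeasurableSpace α] [NormedAddCommGroup F]

theorem tendsto_integral_norm_sq {μ : Measure α} {f : ℕ → α → F} {g : α → F}
    (hf : ∀ n, MemLp (f n) 2 μ) (hg : MemLp g 2 μ)
    (h : Tendsto (fun n => eLpNorm (fun x => f n x - g x) 2 μ) atTop (𝓝 0)) :
    Tendsto (fun n => ∫ x, ‖f n x‖ ^ 2 ∂μ) atTop (𝓝 (∫ x, ‖g x‖ ^ 2 ∂μ)) := by
  have : Fact ((1 : ENNReal) ≤ 2) := ⟨by norm_num⟩
  have h1 := ((Lp.tendsto_Lp_iff_tendsto_eLpNorm'' f hf g hg).2 h).norm.pow 2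
  simpa only [Lp.norm_toLp, toReal_eLpNorm_two_sq (hf _), toReal_eLpNorm_two_sq hg] using h1

theorem exists_tendsto_of_cauchy [CompleteSpace F] {μ : Measure α} {f : ℕ → α → F}
    (hf : ∀ n, MemLp (f n) 2 μ) {δ : ℕ → ENNReal} (hδ : Tendsto δ atTop (𝓝 0))
    (h : ∀ n k, eLpNorm (fun x => f n x - f k x) 2 μ ≤ δ n + δ k) :
    ∃ g : α → F, MemLp g 2 μ ∧
      Tendsto (fun n => eLpNorm (fun x => f n x - g x) 2 μ) atTop (𝓝 0) := by
  have : Fact ((1 : ENNReal) ≤ 2) := ⟨by norm_num⟩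
  have hc : CauchySeq fun n => (hf n).toLp (f n) := by
    refine EMetric.cauchySeq_iff.2 fun ε hε => ?_
    obtain ⟨N, hN⟩ := (hδ.eventually_lt_const (ENNReal.half_pos hε.ne')).exists_forall_of_atTop
    refine ⟨N, fun n hn k hk => ?_⟩
    rw [Lp.edist_toLp_toLp]
    exact (h n k).trans_lt ((ENNReal.add_lt_add (hN n hn) (hN k hk)).trans_eq (ENNReal.add_halves ε))
  obtain ⟨g, hg⟩ := cauchySeq_tendsto_of_complete hc
  refine ⟨g, Lp.memLp g, ((Lp.tendsto_Lp_iff_tendsto_eLpNorm'' f hf g (Lp.memLp g)).1 ?_)⟩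
  rwa [Lp.toLp_coeFn]

end Convergence

/-! ### Traces on simplices -/

variable {m : ℕ}

theorem isCompact_el (s : Affine.Simplex ℝ (Eu (m + 1)) (m + 1)) : IsCompact (el s) :=
  (Set.finite_range _).isCompact_convexHull ℝ

theorem restrict_interior_el (s : Affine.Simplex ℝ (Eu (m + 1)) (m + 1)) :
    volume.restrict (interior (el s)) = volume.restrict (el s) := by
  rw [← hull_basisAt s 0, restrict_interior_hull]

theorem Continuous.memLp_surf (s : Affine.Simplex ℝ (Eu (m + 1)) (m + 1)) {f : Eu (m + 1) → ℝ}
    (hf : Continuous f) : MemLp f 2 (surf (el s)) := by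
  refine Continuous.memLp_two_of_isCompact ?_ ?_ hf
  · exact (isCompact_el s).of_isClosed_subset isClosed_frontier (isCompact_el s).isClosed.frontier_subset
  · have := surf_univ_ne_top s
    rwa [surf, Measure.restrict_apply_univ] at this

theorem Continuous.memLp_el {F : Type*} [NormedAddCommGroup F]
    (s : Affine.Simplex ℝ (Eu (m + 1)) (m + 1)) {f : Eu (m + 1) → F}
    (hf : Continuous f) : MemLp f 2 (volume.restrict (el s)) :=
  Continuous.memLp_two_of_isCompact (isCompact_el s) (isCompact_el s).measure_lt_top.ne hf

theorem exists_eLpNorm_surf_le (s : Affine.Simplex ℝ (Eu (m + 1)) (m + 1)) :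
    ∃ C : ENNReal, C ≠ ⊤ ∧ ∀ w : Eu (m + 1) → ℝ, ContDiff ℝ ∞ w →
      eLpNorm w 2 (surf (el s)) ≤ C * (eLpNorm w 2 (volume.restrict (el s)) +
        eLpNorm (gradient w) 2 (volume.restrict (el s))) := by
  choose C hC h using fun k => exists_trace_le (basisAt s k)
  -- The added 1 allows the bound `x ≤ (x + 1)²` when square roots are taken.
  refine ⟨∑ k, C k + 1, by simp [hC], fun w hw => ?_⟩
  set a := eLpNorm w 2 (volume.restrict (el s)) with ha
  set b := eLpNorm (gradient w) 2 (volume.restrict (el s)) with hb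
  have h1 : ∫⁻ x in el s, (‖w x‖ₑ ^ 2 + ‖gradient w x‖ₑ ^ 2) = a ^ 2 + b ^ 2 := by
    rw [lintegral_add_left (hw.continuous.enorm.measurable.pow_const 2), ha, hb, eLpNorm_two_sq,
      eLpNorm_two_sq]
  have h2 : eLpNorm w 2 (surf (el s)) ^ 2 ≤ (∑ k, C k) * (a ^ 2 + b ^ 2) := by
    rw [eLpNorm_two_sq, surf, Nat.add_sub_cancel]
    refine (lintegral_mono_set (frontier_el_subset s)).trans ((lintegral_iUnion_le _ _).trans ?_)
    rw [tsum_fintype, Finset.sum_mul]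
    refine Finset.sum_le_sum fun k _ => ?_
    have := h k w hw
    rwa [hull_basisAt, base_basisAt, h1] at this
  refine (ENNReal.pow_le_pow_left_iff two_ne_zero).1 (h2.trans ?_)
  rw [mul_pow]
  refine mul_le_mul' ?_ ?_
  · rw [sq]
    exact le_self_add.trans (le_mul_of_one_le_right' le_add_self)
  · rw [add_sq]
    gcongr
    exact le_self_add

theorem eLpNorm_sub_le' {α F : Type*} [MeasurableSpace α] [NormedAddCommGroup F] {μ : Measure α}
    {f g h : α → F} (hf : MemLp f 2 μ) (hg : MemLp g 2 μ) (hh : MemLp h 2 μ) :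
    eLpNorm (fun x => f x - g x) 2 μ ≤
      eLpNorm (fun x => f x - h x) 2 μ + eLpNorm (fun x => g x - h x) 2 μ := by
  have h1 : (fun x => f x - g x) = (fun x => f x - h x) - fun x => g x - h x := by
    ext1 x; simp
  rw [h1]
  exact eLpNorm_sub_le (hf.sub hh).1 (hg.sub hh).1 (by norm_num)

/-- The trace is the limit of the boundary values of any approximating sequence of smooth
functions. -/
theorem tendsto_trace (s : Affine.Simplex ℝ (Eu (m + 1)) (m + 1)) {w : Eu (m + 1) → ℝ}
    (hw : MemH1 (interior (el s)) w) {φ : ℕ → Eu (m + 1) → ℝ} (hφ : ∀ n, ContDiff ℝ ∞ (φ n))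
    (h0 : Tendsto (fun n => eLpNorm (fun x => φ n x - w x) 2 (volume.restrict (el s))) atTop (𝓝 0))
    (h1 : Tendsto (fun n => eLpNorm (fun x => gradient (φ n) x - weakGradient (interior (el s)) w x)
      2 (volume.restrict (el s))) atTop (𝓝 0)) :
    MemLp (trace (el s) w) 2 (surf (el s)) ∧
      Tendsto (fun n => eLpNorm (fun x => φ n x - trace (el s) w x) 2 (surf (el s)))
        atTop (𝓝 0) := by
  obtain ⟨C, hC, hle⟩ := exists_eLpNorm_surf_le s
  have hwL := hw.1
  have hGL := hw.weakGradient_spec.1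
  set G := weakGradient (interior (el s)) w with hG
  rw [restrict_interior_el] at hwL hGL
  let δ : (Eu (m + 1) → ℝ) → ENNReal := fun f =>
    C * (eLpNorm (fun x => f x - w x) 2 (volume.restrict (el s)) +
      eLpNorm (fun x => gradient f x - G x) 2 (volume.restrict (el s)))
  have hδ : ∀ ψ : ℕ → Eu (m + 1) → ℝ,
      Tendsto (fun n => eLpNorm (fun x => ψ n x - w x) 2 (volume.restrict (el s))) atTop (𝓝 0) →
      Tendsto (fun n => eLpNorm (fun x => gradient (ψ n) x - G x) 2 (volume.restrict (el s)))
        atTop (𝓝 0) → Tendsto (fun n => δ (ψ n)) atTop (𝓝 0) := fun ψ h h' => by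
    have := ENNReal.Tendsto.const_mul (a := C) (h.add h') (Or.inr hC)
    simpa using this
  have hdist : ∀ f g : Eu (m + 1) → ℝ, ContDiff ℝ ∞ f → ContDiff ℝ ∞ g →
      eLpNorm (fun x => f x - g x) 2 (surf (el s)) ≤ δ f + δ g := by
    -- By linearity and the trace inequality, boundary values of smooth functions are as close as
    -- the functions are to `w` in the Sobolev norm.
    intro f g hf hg
    refine (hle _ (hf.sub hg)).trans ?_
    have hgr : gradient (fun x => f x - g x) = fun x => gradient f x - gradient g x := by
      ext1 x
      exact gradient_sub' (hf.differentiable (by simp) x) (hg.differentiable (by simp) x)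
    rw [hgr]
    have e1 := eLpNorm_sub_le' (Continuous.memLp_el s hf.continuous)
      (Continuous.memLp_el s hg.continuous) hwL
    have e2 := eLpNorm_sub_le' (Continuous.memLp_el s (continuous_gradient hf))
      (Continuous.memLp_el s (continuous_gradient hg)) hGL
    simp only [δ]
    rw [← mul_add]
    refine mul_le_mul_right ((add_le_add e1 e2).trans_eq ?_) C
    abel
  have hex : ∃ g, IsTrace (el s) w g := by
    obtain ⟨g, hg, hlim⟩ := exists_tendsto_of_cauchy
      (fun n => Continuous.memLp_surf s (hφ n).continuous) (hδ φ h0 h1)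
      fun n k => hdist _ _ (hφ n) (hφ k)
    refine ⟨g, hw, hg, φ, hφ, ?_, ?_, hlim⟩ <;> rwa [restrict_interior_el]
  have htr : IsTrace (el s) w (trace (el s) w) := by
    rw [trace, dif_pos hex]
    exact hex.choose_spec
  -- The chosen trace comes with a sequence `ψ` of its own, with which `φ` is compared on the
  -- boundary.
  obtain ⟨-, hL, ψ, hψ, h0', h1', h2'⟩ := htr
  rw [restrict_interior_el] at h0' h1'
  refine ⟨hL, ?_⟩
  have hlim := ((hδ φ h0 h1).add (hδ ψ h0' h1')).add h2'
  rw [add_zero, add_zero] at hlim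
  refine tendsto_of_tendsto_of_tendsto_of_le_of_le tendsto_const_nhds hlim
    (fun _ => zero_le) fun n => ?_
  have e : (fun x => φ n x - trace (el s) w x) =
      (fun x => φ n x - ψ n x) + fun x => ψ n x - trace (el s) w x := by
    ext1 x; simp
  rw [e]
  refine (eLpNorm_add_le ?_ ?_ (by norm_num)).trans ?_
  · exact ((hφ n).continuous.sub (hψ n).continuous).aestronglyMeasurable
  · exact ((Continuous.memLp_surf s (hψ n).continuous).sub hL).1
  · exact add_le_add (hdist _ _ (hφ n) (hψ n)) le_rfl

end

section

/-! ### Correction of a pair of polynomials to a continuous function -/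

theorem integral_norm_sub_sq_le {α F : Type*} [MeasurableSpace α] [NormedAddCommGroup F]
    {μ : Measure α} {f g : α → F} (hf : MemLp f 2 μ) (hg : MemLp g 2 μ) :
    ∫ x, ‖f x - g x‖ ^ 2 ∂μ ≤ 2 * (∫ x, ‖f x‖ ^ 2 ∂μ + ∫ x, ‖g x‖ ^ 2 ∂μ) := by
  have h1 := hf.integrable_norm_pow two_ne_zero
  have h2 := hg.integrable_norm_pow two_ne_zero
  rw [← integral_add h1 h2, ← integral_const_mul]
  refine integral_mono ((hf.sub hg).integrable_norm_pow two_ne_zero) ((h1.add h2).const_mul 2)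
    fun x => ?_
  have h := norm_sub_le (f x) (g x)
  have h' := pow_le_pow_left₀ (norm_nonneg _) h 2
  dsimp only [Pi.add_apply]
  nlinarith [sq_nonneg (‖f x‖ - ‖g x‖)]

theorem integral_sub_sq_le {α : Type*} [MeasurableSpace α] {μ : Measure α} {f g : α → ℝ}
    (hf : MemLp f 2 μ) (hg : MemLp g 2 μ) :
    ∫ x, (f x - g x) ^ 2 ∂μ ≤ 2 * (∫ x, f x ^ 2 ∂μ + ∫ x, g x ^ 2 ∂μ) := by
  simpa only [Real.norm_eq_abs, sq_abs] using integral_norm_sub_sq_le hf hg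

section Polynomials

variable {d ℓ : ℕ}

/-- Constant polynomials. -/
def constPoly (d ℓ : ℕ) (c : ℝ) : Poly d ℓ :=
  ⟨MvPolynomial.C c, by simp [MvPolynomial.mem_restrictTotalDegree]⟩

theorem polyFun_constPoly (c : ℝ) (x : Eu d) : polyFun (constPoly d ℓ c) x = c := by
  simp [polyFun, constPoly]

theorem polyFun_add (p q : Poly d ℓ) (x : Eu d) : polyFun (p + q) x = polyFun p x + polyFun q x := by
  simp [polyFun]

theorem polyFun_sub (p q : Poly d ℓ) (x : Eu d) : polyFun (p - q) x = polyFun p x - polyFun q x := by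
  simp [polyFun]

theorem differentiable_polyFun (p : Poly d ℓ) : Differentiable ℝ (polyFun p) :=
  (contDiff_polyFun p).differentiable (by simp)

theorem gradient_constPoly (c : ℝ) (x : Eu d) : gradient (polyFun (constPoly d ℓ c)) x = 0 := by
  have : polyFun (constPoly d ℓ c) = fun _ => c := funext fun x => polyFun_constPoly c x
  rw [this, gradient_fun_const]

theorem gradient_polyFun_add (p q : Poly d ℓ) (x : Eu d) :
    gradient (polyFun (p + q)) x = gradient (polyFun p) x + gradient (polyFun q) x := by
  rw [← gradient_add' (differentiable_polyFun p x) (differentiable_polyFun q x)]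
  congr 1
  exact funext fun x => polyFun_add p q x

theorem gradient_polyFun_sub (p q : Poly d ℓ) (x : Eu d) :
    gradient (polyFun (p - q)) x = gradient (polyFun p) x - gradient (polyFun q) x := by
  rw [← gradient_sub' (differentiable_polyFun p x) (differentiable_polyFun q x)]
  congr 1
  exact funext fun x => polyFun_sub p q x

end Polynomials

variable {m : ℕ}

/-- The means over the face move into the corrections as constants, which cost nothing in the
gradient. The remaining jump is a difference of two mean-free errors and is lifted into the simplex
of smaller volume, where the weight `|K₁|` of the second error is at most `|K₂|`. -/
theorem exists_base_correction (m ℓ : ℕ) (σ : ℝ) : ∃ M : ℝ, 0 ≤ M ∧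
    ∀ b b' : AffineBasis (Fin (m + 2)) ℝ (Eu (m + 1)), base b = hull b ∩ hull b' →
      base b' = hull b ∩ hull b' → volume.real (hull b) ≤ volume.real (hull b') →
      Metric.diam (hull b) ≤ σ * inDiam b → Metric.diam (hull b') ≤ σ * inDiam b →
      ∀ φ : Eu (m + 1) → ℝ, ContDiff ℝ ∞ φ → ∀ P₁ P₂ : Poly (m + 1) ℓ,
      ∃ q₁ q₂ : Poly (m + 1) ℓ,
        (∀ x, b.coord 0 x = 0 → polyFun (P₁ + q₁) x = polyFun (P₂ + q₂) x) ∧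
        (Measure.euclideanHausdorffMeasure m).real (base b) *
            ((∫ x in hull b, polyFun q₁ x ^ 2) + ∫ x in hull b', polyFun q₂ x ^ 2) ≤
          M * (volume.real (hull b) * ∫ x in base b, (φ x - polyFun P₁ x) ^ 2
              ∂(Measure.euclideanHausdorffMeasure m) +
            volume.real (hull b') * ∫ x in base b', (φ x - polyFun P₂ x) ^ 2
              ∂(Measure.euclideanHausdorffMeasure m)) ∧
        (∫ x in hull b, ‖gradient (polyFun q₁) x‖ ^ 2) +
            ∫ x in hull b', ‖gradient (polyFun q₂) x‖ ^ 2 ≤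
          M * ((∫ x in hull b, ‖gradient (fun y => φ y - polyFun P₁ y) x‖ ^ 2) +
            ∫ x in hull b', ‖gradient (fun y => φ y - polyFun P₂ y) x‖ ^ 2) := by
  obtain ⟨C, hC0, hC⟩ := exists_mean_bounds m
  obtain ⟨C', hC0', hC'⟩ := exists_lift m ℓ
  refine ⟨2 + 4 * C' + 2 * C * C' * σ ^ 2, by positivity, ?_⟩
  intro b b' hb hb' hV hd hd' φ hφ P₁ P₂
  have hbb : base b' = base b := hb'.trans hb.symm
  have hw₁ : ContDiff ℝ ∞ fun y => φ y - polyFun P₁ y := hφ.sub (contDiff_polyFun P₁)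
  have hw₂ : ContDiff ℝ ∞ fun y => φ y - polyFun P₂ y := hφ.sub (contDiff_polyFun P₂)
  obtain ⟨c₁, a1, a2, a3⟩ := hC b _ hw₁
  obtain ⟨c₂, b1, b2, b3⟩ := hC b' _ hw₂
  -- The lifted polynomial is the jump across the face after the means have been added.
  obtain ⟨r, hr, r1, r2⟩ := hC' b (P₁ + constPoly _ ℓ c₁ - (P₂ + constPoly _ ℓ c₂))
  have hcont : ∀ p : Poly (m + 1) ℓ, Continuous (polyFun p) := fun p => (contDiff_polyFun p).continuous
  refine ⟨constPoly _ ℓ c₁ - r, constPoly _ ℓ c₂, fun x hx => ?_, ?_⟩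
  · rw [polyFun_add, polyFun_sub, hr x hx]
    simp only [polyFun_sub, polyFun_add]
    ring
  rw [hbb] at b1 b2 b3 ⊢
  set μ := Measure.euclideanHausdorffMeasure m (X := Eu (m + 1)) with hμ
  -- The smooth function `φ` cancels in the jump, which makes the jump a difference of the two
  -- mean-free errors.
  have hPp : ∫ x in base b, polyFun (P₁ + constPoly _ ℓ c₁ - (P₂ + constPoly _ ℓ c₂)) x ^ 2 ∂μ ≤
      2 * (∫ x in base b, (φ x - polyFun P₂ x - c₂) ^ 2 ∂μ +
        ∫ x in base b, (φ x - polyFun P₁ x - c₁) ^ 2 ∂μ) := by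
    refine le_of_eq_of_le ?_ (integral_sub_sq_le
      (Continuous.memLp_two_of_isCompact (isCompact_base b) (hausdorff_base_ne_top b)
        (hw₂.continuous.sub continuous_const))
      (Continuous.memLp_two_of_isCompact (isCompact_base b) (hausdorff_base_ne_top b)
        (hw₁.continuous.sub continuous_const)))
    refine integral_congr_ae (ae_of_all _ fun x => ?_)
    simp only [polyFun_sub, polyFun_add, polyFun_constPoly]
    ring
  have hq₁ : ∫ x in hull b, polyFun (constPoly _ ℓ c₁ - r) x ^ 2 ≤
      2 * (volume.real (hull b) * c₁ ^ 2 + ∫ x in hull b, polyFun r x ^ 2) := by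
    have h := integral_sub_sq_le (μ := volume.restrict (hull b))
      (Continuous.memLp_two_of_isCompact (isCompact_hull b) (volume_hull_ne_top b)
        (continuous_const (y := c₁)))
      (Continuous.memLp_two_of_isCompact (isCompact_hull b) (volume_hull_ne_top b) (hcont r))
    simp only [polyFun_sub, polyFun_constPoly]
    refine h.trans_eq ?_
    rw [setIntegral_const, smul_eq_mul]
  have hq₂ : ∫ x in hull b', polyFun (constPoly (m + 1) ℓ c₂) x ^ 2 =
      volume.real (hull b') * c₂ ^ 2 := by
    simp only [polyFun_constPoly, setIntegral_const, smul_eq_mul]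
  have hg₁ : ∫ x in hull b, ‖gradient (polyFun (constPoly _ ℓ c₁ - r)) x‖ ^ 2 =
      ∫ x in hull b, ‖gradient (polyFun r) x‖ ^ 2 := by
    simp only [gradient_polyFun_sub, gradient_constPoly, zero_sub, norm_neg]
  have hg₂ : ∫ x in hull b', ‖gradient (polyFun (constPoly (m + 1) ℓ c₂)) x‖ ^ 2 = 0 := by
    simp [gradient_constPoly]
  rw [hq₂, hg₁, hg₂]
  have hA : 0 < μ.real (base b) :=
    ENNReal.toReal_pos (hausdorff_base_ne_zero b) (hausdorff_base_ne_top b)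
  have hρ := inDiam_pos b
  have hV₁ : 0 ≤ volume.real (hull b) := measureReal_nonneg
  have hJ₁ : 0 ≤ ∫ x in base b, (φ x - polyFun P₁ x - c₁) ^ 2 ∂μ :=
    integral_nonneg fun x => sq_nonneg _
  have hJ₂ : 0 ≤ ∫ x in base b, (φ x - polyFun P₂ x - c₂) ^ 2 ∂μ :=
    integral_nonneg fun x => sq_nonneg _
  have hD₁ : 0 ≤ ∫ x in hull b, ‖gradient (fun y => φ y - polyFun P₁ y) x‖ ^ 2 :=
    integral_nonneg fun x => sq_nonneg _
  have hD₂ : 0 ≤ ∫ x in hull b', ‖gradient (fun y => φ y - polyFun P₂ y) x‖ ^ 2 :=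
    integral_nonneg fun x => sq_nonneg _
  have hs₁ : Metric.diam (hull b) ^ 2 ≤ σ ^ 2 * inDiam b ^ 2 := by
    rw [← mul_pow]; exact pow_le_pow_left₀ Metric.diam_nonneg hd 2
  have hs₂ : Metric.diam (hull b') ^ 2 ≤ σ ^ 2 * inDiam b ^ 2 := by
    rw [← mul_pow]; exact pow_le_pow_left₀ Metric.diam_nonneg hd' 2
  -- What remains is arithmetic with nonnegative real numbers.
  generalize (∫ x in base b, polyFun (P₁ + constPoly _ ℓ c₁ - (P₂ + constPoly _ ℓ c₂)) x ^ 2 ∂μ) =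
    Pp at *
  generalize (∫ x in hull b, polyFun (constPoly _ ℓ c₁ - r) x ^ 2) = Q at *
  generalize (∫ x in hull b, polyFun r x ^ 2) = R at *
  generalize (∫ x in hull b, ‖gradient (polyFun r) x‖ ^ 2) = Gr at *
  generalize (∫ x in base b, (φ x - polyFun P₁ x - c₁) ^ 2 ∂μ) = J₁ at *
  generalize (∫ x in base b, (φ x - polyFun P₂ x - c₂) ^ 2 ∂μ) = J₂ at *
  generalize (∫ x in base b, (φ x - polyFun P₁ x) ^ 2 ∂μ) = I₁ at *
  generalize (∫ x in base b, (φ x - polyFun P₂ x) ^ 2 ∂μ) = I₂ at *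
  generalize (∫ x in hull b, ‖gradient (fun y => φ y - polyFun P₁ y) x‖ ^ 2) = D₁ at *
  generalize (∫ x in hull b', ‖gradient (fun y => φ y - polyFun P₂ y) x‖ ^ 2) = D₂ at *
  generalize volume.real (hull b) = V₁ at *
  generalize volume.real (hull b') = V₂ at *
  generalize μ.real (base b) = A at *
  generalize inDiam b = ρ at *
  generalize Metric.diam (hull b) = h₁ at *
  generalize Metric.diam (hull b') = h₂ at *
  have hV₂ : 0 ≤ V₂ := hV₁.trans hV
  have hI₁ : 0 ≤ I₁ := hJ₁.trans a2
  have hI₂ : 0 ≤ I₂ := hJ₂.trans b2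
  constructor
  · have e1 : V₁ * Pp ≤ 2 * (V₁ * I₁ + V₂ * I₂) := by
      have k1 : V₁ * Pp ≤ V₁ * (2 * (J₂ + J₁)) := by gcongr
      have k2 : V₁ * J₁ ≤ V₁ * I₁ := by gcongr
      have k3 : V₁ * J₂ ≤ V₂ * I₂ := by gcongr
      linarith
    have e2 : C' * V₁ * Pp ≤ C' * (2 * (V₁ * I₁ + V₂ * I₂)) := by
      rw [mul_assoc]; gcongr
    have e3 : A * Q ≤ A * (2 * (V₁ * c₁ ^ 2 + R)) := by gcongr
    have e4 : V₁ * (A * c₁ ^ 2) ≤ V₁ * I₁ := by gcongr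
    have e5 : V₂ * (A * c₂ ^ 2) ≤ V₂ * I₂ := by gcongr
    have e6 : 0 ≤ 2 * C * C' * σ ^ 2 * (V₁ * I₁ + V₂ * I₂) := by positivity
    have e7 : 0 ≤ V₂ * I₂ := by positivity
    linarith
  · have k1 : V₁ * Pp ≤ V₁ * (2 * (J₂ + J₁)) := by gcongr
    -- The place where the volume ordering enters the gradient bound; the Poincaré inequality on the
    -- second simplex carries its own volume.
    have k2 : V₁ * J₂ ≤ V₂ * J₂ := by gcongr
    have k3 : V₁ * J₁ ≤ C * (σ ^ 2 * ρ ^ 2) * A * D₁ := a3.trans (by gcongr)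
    have k4 : V₂ * J₂ ≤ C * (σ ^ 2 * ρ ^ 2) * A * D₂ := b3.trans (by gcongr)
    have k5 : C' * V₁ * Pp ≤ C' * (2 * (C * (σ ^ 2 * ρ ^ 2) * A * (D₁ + D₂))) := by
      rw [mul_assoc]
      refine mul_le_mul_of_nonneg_left ?_ hC0'
      linarith
    have k6 : ρ ^ 2 * (A * Gr) ≤ ρ ^ 2 * (A * (2 * C * C' * σ ^ 2 * (D₁ + D₂))) := by
      linarith
    have k7 : Gr ≤ 2 * C * C' * σ ^ 2 * (D₁ + D₂) :=
      le_of_mul_le_mul_left (le_of_mul_le_mul_left k6 (by positivity)) hA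
    have k8 : 0 ≤ C' * (D₁ + D₂) := by positivity
    linarith

/-- This exchanges the natural weight `|K|/|F|` of a face for `|K|/|∂K|`; their quotient is bounded
by the comparability of face areas. -/
theorem volume_mul_integral_face_le (s : Affine.Simplex ℝ (Eu (m + 1)) (m + 1)) (k : Fin (m + 2))
    {σ : ℝ} (hσ : Metric.diam (el s) / rho s ≤ σ) {f : Eu (m + 1) → ℝ} (hf : Continuous f) :
    volume.real (el s) * ∫ x in face s k, f x ^ 2 ∂(Measure.euclideanHausdorffMeasure m) ≤
      (m + 2) * ((m + 2) * σ) ^ m * (Measure.euclideanHausdorffMeasure m).real (face s k) *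
        (volume.real (el s) / (surf (el s)).real Set.univ * ∫ x, f x ^ 2 ∂(surf (el s))) := by
  set μ := Measure.euclideanHausdorffMeasure m (X := Eu (m + 1)) with hμ
  have hfin := surf_univ_ne_top s
  have hσ0 : 0 ≤ σ :=
    (div_nonneg Metric.diam_nonneg (Real.sSup_nonneg fun _ hδ => hδ.1)).trans hσ
  have hsurf : surf (el s) = μ.restrict (frontier (el s)) := by rw [surf, Nat.add_sub_cancel]
  have hA0 : μ (face s k) ≠ 0 := base_basisAt s k ▸ hausdorff_base_ne_zero (basisAt s k)
  have hA1 : μ (face s k) ≠ ⊤ := base_basisAt s k ▸ hausdorff_base_ne_top (basisAt s k)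
  have hS0 : 0 < (surf (el s)).real Set.univ := by
    refine ENNReal.toReal_pos (fun h => hA0 ?_) hfin
    rw [hsurf, Measure.restrict_apply_univ] at h
    exact measure_mono_null (face_subset_frontier s k) h
  have h1 : ∫ x in face s k, f x ^ 2 ∂μ ≤ ∫ x, f x ^ 2 ∂(surf (el s)) := by
    rw [hsurf]
    refine setIntegral_mono_set ?_ (ae_of_all _ fun x => sq_nonneg _)
      (face_subset_frontier s k).eventuallyLE
    have := (Continuous.memLp_surf s hf).integrable_sq
    rwa [hsurf] at this
  have h2 : (surf (el s)).real Set.univ ≤ (m + 2) * ((m + 2) * σ) ^ m * μ.real (face s k) := by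
    have h := ENNReal.toReal_mono (by finiteness) (surf_univ_le s k hσ)
    rw [ENNReal.toReal_mul, ENNReal.toReal_mul, ENNReal.toReal_ofReal (by positivity)] at h
    have e : (m + 2 : ENNReal).toReal = m + 2 := by
      rw [ENNReal.toReal_add (by finiteness) (by finiteness)]; simp
    rwa [e] at h
  have hI : 0 ≤ ∫ x, f x ^ 2 ∂(surf (el s)) := integral_nonneg fun x => sq_nonneg _
  calc volume.real (el s) * ∫ x in face s k, f x ^ 2 ∂μ
      ≤ volume.real (el s) * ∫ x, f x ^ 2 ∂(surf (el s)) := by gcongr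
    _ = (surf (el s)).real Set.univ * (volume.real (el s) / (surf (el s)).real Set.univ *
          ∫ x, f x ^ 2 ∂(surf (el s))) := by field_simp
    _ ≤ _ := by gcongr

theorem IsPair.symm {d : ℕ} {s t : Affine.Simplex ℝ (Eu d) d} (h : IsPair s t) : IsPair t s := by
  rw [IsPair, Set.inter_comm]
  exact ⟨h.2, h.1⟩

theorem shapePar_comm {d : ℕ} (s t : Affine.Simplex ℝ (Eu d) d) : shapePar s t = shapePar t s := by
  rw [shapePar, shapePar, max_comm, min_comm]

theorem rho_pos (s : Affine.Simplex ℝ (Eu (m + 1)) (m + 1)) : 0 < rho s :=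
  inDiam_basisAt s 0 ▸ inDiam_pos _

theorem diam_le_of_shapePar_le {s t : Affine.Simplex ℝ (Eu (m + 1)) (m + 1)} {σ : ℝ}
    (h : shapePar s t ≤ σ) : Metric.diam (el s) ≤ σ * rho s ∧ Metric.diam (el t) ≤ σ * rho s := by
  have hmin : 0 < min (rho s) (rho t) := lt_min (rho_pos s) (rho_pos t)
  have hσ0 : 0 ≤ σ :=
    (div_nonneg (Metric.diam_nonneg.trans (le_max_left _ _)) hmin.le).trans h
  rw [shapePar, div_le_iff₀ hmin] at h
  have h1 : σ * min (rho s) (rho t) ≤ σ * rho s := by gcongr; exact min_le_left _ _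
  exact ⟨(le_max_left _ _).trans (h.trans h1), (le_max_right _ _).trans (h.trans h1)⟩

/-- The hyperplane `lam = 0` separates two elements with common face; polynomials on the elements
can be corrected so that they agree on this hyperplane, at a cost that is bounded by the distance
to any smooth function. -/
theorem exists_correction (m ℓ : ℕ) (σ : ℝ) : ∃ M : ℝ, 0 ≤ M ∧
    ∀ s t : Affine.Simplex ℝ (Eu (m + 1)) (m + 1), IsPair s t → shapePar s t ≤ σ →
      ∃ lam : Eu (m + 1) →ᵃ[ℝ] ℝ, lam.linear ≠ 0 ∧ (∀ x ∈ el s, 0 ≤ lam x) ∧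
        (∀ x ∈ el t, lam x ≤ 0) ∧
        ∀ φ : Eu (m + 1) → ℝ, ContDiff ℝ ∞ φ → ∀ P₁ P₂ : Poly (m + 1) ℓ,
        ∃ q₁ q₂ : Poly (m + 1) ℓ,
          (∀ x, lam x = 0 → polyFun (P₁ + q₁) x = polyFun (P₂ + q₂) x) ∧
          (∫ x in el s, polyFun q₁ x ^ 2) + ∫ x in el t, polyFun q₂ x ^ 2 ≤
            M * (volume.real (el s) / (surf (el s)).real Set.univ *
                ∫ x, (φ x - polyFun P₁ x) ^ 2 ∂(surf (el s)) +
              volume.real (el t) / (surf (el t)).real Set.univ *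
                ∫ x, (φ x - polyFun P₂ x) ^ 2 ∂(surf (el t))) ∧
          (∫ x in el s, ‖gradient (polyFun q₁) x‖ ^ 2) +
              ∫ x in el t, ‖gradient (polyFun q₂) x‖ ^ 2 ≤
            M * ((∫ x in el s, ‖gradient (fun y => φ y - polyFun P₁ y) x‖ ^ 2) +
              ∫ x in el t, ‖gradient (fun y => φ y - polyFun P₂ y) x‖ ^ 2) := by
  obtain ⟨M, hM0, hM⟩ := exists_base_correction m ℓ σ
  set N : ℝ := (m + 2) * ((m + 2) * |σ|) ^ m with hN
  have hN0 : 0 ≤ N := by positivity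
  refine ⟨max M (M * N), le_max_of_le_left hM0, fun s t hst hσ => ?_⟩
  -- The lift goes into the smaller element. Exchanging the elements reverses the sign of the
  -- separating function.
  wlog hV : volume.real (el s) ≤ volume.real (el t) generalizing s t
  · obtain ⟨lam, h1, h2, h3, h4⟩ := this t s hst.symm (shapePar_comm s t ▸ hσ) (not_le.1 hV).le
    refine ⟨-lam, by simpa using h1, fun x hx => by simpa using h3 x hx,
      fun x hx => by simpa using h2 x hx, fun φ hφ P₁ P₂ => ?_⟩
    obtain ⟨q₂, q₁, k1, k2, k3⟩ := h4 φ hφ P₂ P₁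
    refine ⟨q₁, q₂, fun x hx => (k1 x (by simpa using hx)).symm, ?_, ?_⟩
    · rwa [add_comm (∫ x in el s, _), add_comm (volume.real (el s) / _ * _)]
    · rwa [add_comm (∫ x in el s, ‖gradient (polyFun q₁) x‖ ^ 2),
        add_comm (∫ x in el s, ‖gradient (fun y => φ y - polyFun P₁ y) x‖ ^ 2)]
  obtain ⟨⟨k, hk⟩, k', hk'⟩ := hst
  obtain ⟨hd, hd'⟩ := diam_le_of_shapePar_le hσ
  obtain ⟨he, -⟩ := diam_le_of_shapePar_le (shapePar_comm s t ▸ hσ)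
  have hb : base (basisAt s k) = hull (basisAt s k) ∩ hull (basisAt t k') := by
    rw [base_basisAt, hull_basisAt, hull_basisAt, hk]
  have hb' : base (basisAt t k') = hull (basisAt s k) ∩ hull (basisAt t k') := by
    rw [base_basisAt, hull_basisAt, hull_basisAt, hk']
  have hds : Metric.diam (el s) / rho s ≤ |σ| :=
    ((div_le_iff₀ (rho_pos s)).2 hd).trans (le_abs_self σ)
  have hdt : Metric.diam (el t) / rho t ≤ |σ| :=
    ((div_le_iff₀ (rho_pos t)).2 he).trans (le_abs_self σ)
  obtain ⟨c, hc, hcoord⟩ := exists_neg_coord_eq hb hb'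
  refine ⟨(basisAt s k).coord 0, coord_linear_ne_zero _ 0, fun x hx => ?_, fun x hx => ?_,
    fun φ hφ P₁ P₂ => ?_⟩
  · rw [← hull_basisAt s k] at hx
    exact (mem_hull_iff _ x).1 hx 0
  · rw [← hull_basisAt t k'] at hx
    rw [hcoord]
    exact mul_nonpos_of_nonpos_of_nonneg hc.le ((mem_hull_iff _ x).1 hx 0)
  obtain ⟨q₁, q₂, k1, k2, k3⟩ := hM _ _ hb hb'
    (by rwa [hull_basisAt, hull_basisAt]) (by rwa [hull_basisAt, inDiam_basisAt])
    (by rwa [hull_basisAt, inDiam_basisAt]) φ hφ P₁ P₂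
  rw [hull_basisAt, hull_basisAt] at k2 k3
  have hA : 0 < (Measure.euclideanHausdorffMeasure m).real (base (basisAt s k)) :=
    ENNReal.toReal_pos (hausdorff_base_ne_zero _) (hausdorff_base_ne_top _)
  refine ⟨q₁, q₂, k1, ?_, ?_⟩
  · have f1 := volume_mul_integral_face_le s k hds
      (hφ.continuous.sub (contDiff_polyFun P₁).continuous)
    have f2 := volume_mul_integral_face_le t k' hdt
      (hφ.continuous.sub (contDiff_polyFun P₂).continuous)
    rw [hk', ← hk] at f2
    rw [base_basisAt, base_basisAt, hk', ← hk] at k2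
    rw [base_basisAt] at hA
    refine le_of_mul_le_mul_left ?_ hA
    have hT : ∀ (r : Affine.Simplex ℝ (Eu (m + 1)) (m + 1)) (P : Poly (m + 1) ℓ),
        0 ≤ volume.real (el r) / (surf (el r)).real Set.univ *
          ∫ x, (φ x - polyFun P x) ^ 2 ∂(surf (el r)) := fun r P =>
      mul_nonneg (div_nonneg measureReal_nonneg measureReal_nonneg)
        (integral_nonneg fun x => sq_nonneg _)
    have hT1 := hT s P₁
    have hT2 := hT t P₂
    simp only [Pi.sub_apply] at f1 f2
    have hT3 := mul_le_mul_of_nonneg_left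
      (mul_le_mul_of_nonneg_right (le_max_right M (M * N)) (add_nonneg hT1 hT2)) hA.le
    have hT4 := mul_le_mul_of_nonneg_left (add_le_add f1 f2) hM0
    linarith
  · exact k3.trans (mul_le_mul_of_nonneg_right (le_max_left _ _) (by positivity))

end

section

/-! ### The reaction-diffusion norm of the error -/

variable {m ℓ : ℕ}

theorem rdNorm_nonneg {d : ℕ} (ε : ℝ) (A : Set (Eu d)) (w : Eu d → ℝ) : 0 ≤ rdNorm ε A w :=
  Real.sqrt_nonneg _

theorem rdNorm_sq {d : ℕ} {ε : ℝ} (hε : 0 ≤ ε) (A : Set (Eu d)) (w : Eu d → ℝ) :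
    rdNorm ε A w ^ 2 = (∫ x in interior A, w x ^ 2) +
      ε * ∫ x in interior A, ‖weakGradient (interior A) w x‖ ^ 2 :=
  Real.sq_sqrt (add_nonneg (integral_nonneg fun _ => sq_nonneg _)
    (mul_nonneg hε (integral_nonneg fun _ => sq_nonneg _)))

theorem memLp_two_add_measure {α F : Type*} [MeasurableSpace α] [NormedAddCommGroup F]
    {μ ν : Measure α} {f : α → F} (h1 : MemLp f 2 μ) (h2 : MemLp f 2 ν) : MemLp f 2 (μ + ν) := by
  refine ⟨h1.1.add_measure h2.1, ?_⟩
  have h3 : eLpNorm f 2 (μ + ν) ^ 2 < ⊤ := by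
    rw [eLpNorm_two_sq, lintegral_add_measure, ← eLpNorm_two_sq, ← eLpNorm_two_sq]
    exact ENNReal.add_lt_top.2 ⟨ENNReal.pow_lt_top h1.2, ENNReal.pow_lt_top h2.2⟩
  exact (ENNReal.pow_lt_top_iff.1 h3).resolve_right two_ne_zero

theorem integral_norm_sq_add_measure {α F : Type*} [MeasurableSpace α] [NormedAddCommGroup F]
    {μ ν : Measure α} {f : α → F} (h1 : MemLp f 2 μ) (h2 : MemLp f 2 ν) :
    ∫ x, ‖f x‖ ^ 2 ∂(μ + ν) = (∫ x, ‖f x‖ ^ 2 ∂μ) + ∫ x, ‖f x‖ ^ 2 ∂ν :=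
  integral_add_measure (h1.integrable_norm_pow two_ne_zero) (h2.integrable_norm_pow two_ne_zero)

/-! ### The norm of the error on a single element -/

section Element

variable (s : Affine.Simplex ℝ (Eu (m + 1)) (m + 1)) {u : Eu (m + 1) → ℝ}
  {G : Eu (m + 1) → Eu (m + 1)}

theorem weakGradient_sub_polyFun (hu : MemLp u 2 (volume.restrict (el s)))
    (hG : MemLp G 2 (volume.restrict (el s))) (h : IsWeakGradient (interior (el s)) u G)
    (p : Poly (m + 1) ℓ) :
    MemH1 (interior (el s)) (fun y => u y - polyFun p y) ∧
      weakGradient (interior (el s)) (fun y => u y - polyFun p y)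
        =ᵐ[volume.restrict (el s)] fun x => G x - gradient (polyFun p) x := by
  have hp := Continuous.memLp_el s (contDiff_polyFun p).continuous
  have hg := Continuous.memLp_el s (continuous_gradient (contDiff_polyFun p))
  -- A smooth function glued to itself has its classical gradient as weak gradient.
  have hw : IsWeakGradient (interior (el s)) (polyFun p) (gradient (polyFun p)) := by
    have := isWeakGradient_glue (coord_linear_ne_zero (basisAt s 0) 0) (contDiff_polyFun p)
      (contDiff_polyFun p) (fun _ _ => rfl) (interior (el s))
    simpa only [ite_self] using this
  rw [← restrict_interior_el] at *
  have hsub := IsWeakGradient.sub hu hp hG hg h hw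
  exact ⟨⟨hu.sub hp, _, hG.sub hg, hsub⟩, weakGradient_ae_eq isOpen_interior (hG.sub hg) hsub⟩

theorem rdNorm_sub_polyFun_sq {ε : ℝ} (hε : 0 ≤ ε) (hu : MemLp u 2 (volume.restrict (el s)))
    (hG : MemLp G 2 (volume.restrict (el s))) (h : IsWeakGradient (interior (el s)) u G)
    (p : Poly (m + 1) ℓ) :
    rdNorm ε (el s) (fun y => u y - polyFun p y) ^ 2 = (∫ x in el s, (u x - polyFun p x) ^ 2) +
      ε * ∫ x in el s, ‖G x - gradient (polyFun p) x‖ ^ 2 := by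
  rw [rdNorm_sq hε, restrict_interior_el]
  congr 2
  refine integral_congr_ae ?_
  filter_upwards [(weakGradient_sub_polyFun s hu hG h p).2] with x hx
  rw [hx]

end Element

/-! ### Continuous piecewise polynomials on a pair -/

section Glue

variable {s t : Affine.Simplex ℝ (Eu (m + 1)) (m + 1)} {lam : Eu (m + 1) →ᵃ[ℝ] ℝ}
  {Q₁ Q₂ : Poly (m + 1) ℓ} {u : Eu (m + 1) → ℝ} {G : Eu (m + 1) → Eu (m + 1)}

/-- The continuous piecewise polynomial function given by two polynomials that agree on the
hyperplane `lam = 0`. -/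
def gluePoly (lam : Eu (m + 1) →ᵃ[ℝ] ℝ) (Q₁ Q₂ : Poly (m + 1) ℓ) (x : Eu (m + 1)) : ℝ :=
  if 0 ≤ lam x then polyFun Q₁ x else polyFun Q₂ x

theorem gluePoly_of_nonneg {x : Eu (m + 1)} (hx : 0 ≤ lam x) :
    gluePoly lam Q₁ Q₂ x = polyFun Q₁ x := if_pos hx

theorem gluePoly_of_nonpos (hQ : ∀ x, lam x = 0 → polyFun Q₁ x = polyFun Q₂ x) {x : Eu (m + 1)}
    (hx : lam x ≤ 0) : gluePoly lam Q₁ Q₂ x = polyFun Q₂ x := by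
  rcases hx.eq_or_lt with h | h
  · rw [gluePoly, if_pos h.ge, hQ x h]
  · rw [gluePoly, if_neg h.not_ge]

theorem gluePoly_mem_pairSpace (hs : ∀ x ∈ el s, 0 ≤ lam x) (ht : ∀ x ∈ el t, lam x ≤ 0)
    (hQ : ∀ x, lam x = 0 → polyFun Q₁ x = polyFun Q₂ x) :
    gluePoly lam Q₁ Q₂ ∈ pairSpace ℓ s t := by
  refine ⟨(Continuous.if_le (contDiff_polyFun Q₁).continuous (contDiff_polyFun Q₂).continuous
    continuous_const (AffineMap.continuous' lam) fun x hx => hQ x hx.symm).continuousOn,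
    ⟨Q₁, fun x hx => gluePoly_of_nonneg (hs x hx)⟩, Q₂, fun x hx => gluePoly_of_nonpos hQ (ht x hx)⟩

/-- Agreement on the hyperplane means that the weak gradient has no singular part there, so the
squared norm splits into the two element contributions. -/
theorem rdNorm_sub_gluePoly_sq {ε : ℝ} (hε : 0 ≤ ε) (hlam : lam.linear ≠ 0)
    (hs : ∀ x ∈ el s, 0 ≤ lam x) (ht : ∀ x ∈ el t, lam x ≤ 0)
    (hQ : ∀ x, lam x = 0 → polyFun Q₁ x = polyFun Q₂ x)
    (hvol : volume.restrict (interior (el s ∪ el t)) =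
      volume.restrict (el s) + volume.restrict (el t))
    (hu : MemLp u 2 (volume.restrict (interior (el s ∪ el t))))
    (hG : MemLp G 2 (volume.restrict (interior (el s ∪ el t))))
    (h : IsWeakGradient (interior (el s ∪ el t)) u G) :
    rdNorm ε (el s ∪ el t) (fun x => u x - gluePoly lam Q₁ Q₂ x) ^ 2 =
      ((∫ x in el s, (u x - polyFun Q₁ x) ^ 2) + ∫ x in el t, (u x - polyFun Q₂ x) ^ 2) +
      ε * ((∫ x in el s, ‖G x - gradient (polyFun Q₁) x‖ ^ 2) +
        ∫ x in el t, ‖G x - gradient (polyFun Q₂) x‖ ^ 2) := by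
  set H : Eu (m + 1) → Eu (m + 1) :=
    fun x => if 0 ≤ lam x then gradient (polyFun Q₁) x else gradient (polyFun Q₂) x with hH
  have hms := (isCompact_el s).measurableSet
  have hmt := (isCompact_el t).measurableSet
  have v1 : gluePoly lam Q₁ Q₂ =ᵐ[volume.restrict (el s)] polyFun Q₁ := by
    filter_upwards [ae_restrict_mem hms] with x hx using gluePoly_of_nonneg (hs x hx)
  have v2 : gluePoly lam Q₁ Q₂ =ᵐ[volume.restrict (el t)] polyFun Q₂ := by
    filter_upwards [ae_restrict_mem hmt] with x hx using gluePoly_of_nonpos hQ (ht x hx)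
  have g1 : H =ᵐ[volume.restrict (el s)] gradient (polyFun Q₁) := by
    filter_upwards [ae_restrict_mem hms] with x hx using if_pos (hs x hx)
  -- On the hyperplane itself `H` takes the value from the other side, but that is a null set.
  have g2 : H =ᵐ[volume.restrict (el t)] gradient (polyFun Q₂) := by
    have h0 : ∀ᵐ x ∂(volume.restrict (el t)), lam x ≠ 0 :=
      ae_restrict_of_ae (measure_eq_zero_iff_ae_notMem.1 (volume_zeroSet hlam))
    filter_upwards [ae_restrict_mem hmt, h0] with x hx hx0
    exact if_neg (lt_of_le_of_ne (ht x hx) hx0).not_ge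
  have hv : MemLp (gluePoly lam Q₁ Q₂) 2 (volume.restrict (interior (el s ∪ el t))) := by
    rw [hvol]
    exact memLp_two_add_measure
      ((Continuous.memLp_el s (contDiff_polyFun Q₁).continuous).ae_eq v1.symm)
      ((Continuous.memLp_el t (contDiff_polyFun Q₂).continuous).ae_eq v2.symm)
  have hHL : MemLp H 2 (volume.restrict (interior (el s ∪ el t))) := by
    rw [hvol]
    exact memLp_two_add_measure
      ((Continuous.memLp_el s (continuous_gradient (contDiff_polyFun Q₁))).ae_eq g1.symm)
      ((Continuous.memLp_el t (continuous_gradient (contDiff_polyFun Q₂))).ae_eq g2.symm)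
  have hw := weakGradient_ae_eq isOpen_interior (hG.sub hHL) (IsWeakGradient.sub hu hv hG hHL h
    (isWeakGradient_glue hlam (contDiff_polyFun Q₁) (contDiff_polyFun Q₂) hQ _))
  have e1 := hu.sub hv
  have e2 := hG.sub hHL
  have hws : ∫ x in interior (el s ∪ el t),
      ‖weakGradient (interior (el s ∪ el t)) (fun x => u x - gluePoly lam Q₁ Q₂ x) x‖ ^ 2 =
      ∫ x in interior (el s ∪ el t), ‖G x - H x‖ ^ 2 := by
    refine integral_congr_ae ?_
    filter_upwards [hw] with x hx
    exact congrArg (fun z => ‖z‖ ^ 2) hx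
  rw [rdNorm_sq hε, hws]
  rw [hvol] at e1 e2 ⊢
  have a1 := integral_norm_sq_add_measure (e1.mono_measure (Measure.le_add_right le_rfl))
    (e1.mono_measure (Measure.le_add_left le_rfl))
  have a2 := integral_norm_sq_add_measure (e2.mono_measure (Measure.le_add_right le_rfl))
    (e2.mono_measure (Measure.le_add_left le_rfl))
  simp only [Pi.sub_apply, Real.norm_eq_abs, sq_abs] at a1 a2
  rw [a1, a2]
  refine congrArg₂ (· + ·) (congrArg₂ (· + ·) ?_ ?_)
    (congrArg (ε * ·) (congrArg₂ (· + ·) ?_ ?_)) <;> refine integral_congr_ae ?_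
  · filter_upwards [v1] with x hx
    rw [hx]
  · filter_upwards [v2] with x hx
    rw [hx]
  · filter_upwards [g1] with x hx
    rw [hx]
  · filter_upwards [g2] with x hx
    rw [hx]

end Glue

/-! ### The estimate for a pair of elements -/

section Pair

variable {s t : Affine.Simplex ℝ (Eu (m + 1)) (m + 1)}

theorem IsPair.exists_basis (h : IsPair s t) :
    ∃ b b' : AffineBasis (Fin (m + 2)) ℝ (Eu (m + 1)), hull b = el s ∧ hull b' = el t ∧
      base b = hull b ∩ hull b' ∧ base b' = hull b ∩ hull b' := by
  obtain ⟨⟨k, hk⟩, k', hk'⟩ := h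
  refine ⟨basisAt s k, basisAt t k', hull_basisAt s k, hull_basisAt t k', ?_, ?_⟩
  · rw [base_basisAt, hull_basisAt, hull_basisAt, hk]
  · rw [base_basisAt, hull_basisAt, hull_basisAt, hk']

theorem IsPair.restrict_interior_union (h : IsPair s t) :
    volume.restrict (interior (el s ∪ el t)) =
      volume.restrict (el s) + volume.restrict (el t) := by
  obtain ⟨b, b', h1, h2, hb, -⟩ := h.exists_basis
  rw [← h1, ← h2, TraceAug.restrict_interior_union hb]

theorem IsPair.exists_smooth_tendsto (h : IsPair s t) {u : Eu (m + 1) → ℝ}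
    {G : Eu (m + 1) → Eu (m + 1)} (hu : MemLp u 2 (volume.restrict (interior (el s ∪ el t))))
    (hG : MemLp G 2 (volume.restrict (interior (el s ∪ el t))))
    (hw : IsWeakGradient (interior (el s ∪ el t)) u G) :
    ∃ f : ℕ → Eu (m + 1) → ℝ, (∀ n, ContDiff ℝ ∞ (f n)) ∧
      Tendsto (fun n => eLpNorm (fun x => f n x - u x) 2
        (volume.restrict (interior (el s ∪ el t)))) atTop (𝓝 0) ∧
      Tendsto (fun n => eLpNorm (fun x => gradient (f n) x - G x) 2
        (volume.restrict (interior (el s ∪ el t)))) atTop (𝓝 0) := by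
  obtain ⟨b, b', h1, h2, hb, hb'⟩ := h.exists_basis
  obtain ⟨r, hr, hstar⟩ := exists_ball_star_interior hb hb'
  rw [h1, h2] at hstar
  exact MemH1.exists_smooth_tendsto isOpen_interior hr hstar hu hG hw

theorem pairError_nonneg {d : ℕ} (ε : ℝ) (ℓ : ℕ) (s t : Affine.Simplex ℝ (Eu d) d)
    (u : Eu d → ℝ) : 0 ≤ pairError ε ℓ s t u :=
  Real.iInf_nonneg fun _ => rdNorm_nonneg _ _ _

theorem pairError_le {d : ℕ} (ε : ℝ) {ℓ : ℕ} {s t : Affine.Simplex ℝ (Eu d) d}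
    (u : Eu d → ℝ) {v : Eu d → ℝ} (hv : v ∈ pairSpace ℓ s t) :
    pairError ε ℓ s t u ≤ rdNorm ε (el s ∪ el t) fun x => u x - v x :=
  ciInf_le (f := fun v : pairSpace ℓ s t => rdNorm ε (el s ∪ el t) fun x => u x - (v : Eu d → ℝ) x)
    ⟨0, by rintro _ ⟨v, rfl⟩; exact rdNorm_nonneg _ _ _⟩ ⟨v, hv⟩

/-- The boundary values of smooth approximations converge to the trace of the error. -/
theorem tendsto_boundary_error (s : Affine.Simplex ℝ (Eu (m + 1)) (m + 1)) {u : Eu (m + 1) → ℝ}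
    {G : Eu (m + 1) → Eu (m + 1)} (hu : MemLp u 2 (volume.restrict (el s)))
    (hG : MemLp G 2 (volume.restrict (el s))) (h : IsWeakGradient (interior (el s)) u G)
    {φ : ℕ → Eu (m + 1) → ℝ} (hφ : ∀ n, ContDiff ℝ ∞ (φ n))
    (h0 : Tendsto (fun n => eLpNorm (fun x => φ n x - u x) 2 (volume.restrict (el s))) atTop (𝓝 0))
    (h1 : Tendsto (fun n => eLpNorm (fun x => gradient (φ n) x - G x) 2 (volume.restrict (el s)))
      atTop (𝓝 0)) (p : Poly (m + 1) ℓ) :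
    Tendsto (fun n => ∫ x, (φ n x - polyFun p x) ^ 2 ∂(surf (el s))) atTop
        (𝓝 (∫ x, trace (el s) (fun y => u y - polyFun p y) x ^ 2 ∂(surf (el s)))) ∧
      Tendsto (fun n => ∫ x in el s, ‖gradient (fun y => φ n y - polyFun p y) x‖ ^ 2) atTop
        (𝓝 (∫ x in el s, ‖G x - gradient (polyFun p) x‖ ^ 2)) := by
  have hp := contDiff_polyFun p
  have hφp : ∀ n, ContDiff ℝ ∞ fun y => φ n y - polyFun p y := fun n => (hφ n).sub hp
  obtain ⟨hm, hae⟩ := weakGradient_sub_polyFun s hu hG h p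
  have hgr : ∀ n, gradient (fun y => φ n y - polyFun p y) =
      fun x => gradient (φ n) x - gradient (polyFun p) x := fun n => funext fun x =>
    gradient_sub' ((hφ n).differentiable (by simp) x) (differentiable_polyFun p x)
  have hg' : Tendsto (fun n => eLpNorm (fun x => gradient (fun y => φ n y - polyFun p y) x -
      (G x - gradient (polyFun p) x)) 2 (volume.restrict (el s))) atTop (𝓝 0) := by
    simpa only [hgr, sub_sub_sub_cancel_right] using h1
  obtain ⟨k1, k2⟩ := tendsto_trace s hm hφp
    (by simpa only [sub_sub_sub_cancel_right] using h0)
    (by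
      refine hg'.congr fun n => eLpNorm_congr_ae ?_
      filter_upwards [hae] with x hx
      rw [hx])
  constructor
  · simpa only [Real.norm_eq_abs, sq_abs] using tendsto_integral_norm_sq
      (fun n => Continuous.memLp_surf s (hφp n).continuous) k1 k2
  · exact tendsto_integral_norm_sq
      (fun n => Continuous.memLp_el s (continuous_gradient (hφp n)))
      (hG.sub (Continuous.memLp_el s (continuous_gradient hp))) hg'

/-- The square of the trace-augmented norm of the error of a polynomial on an element. -/
def elErrorSq (ε : ℝ) (s : Affine.Simplex ℝ (Eu (m + 1)) (m + 1)) (u : Eu (m + 1) → ℝ)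
    (p : Poly (m + 1) ℓ) : ℝ :=
  rdNorm ε (el s) (fun x => u x - polyFun p x) ^ 2 +
    volume.real (el s) / (surf (el s)).real Set.univ *
      ∫ x, trace (el s) (fun y => u y - polyFun p y) x ^ 2 ∂(surf (el s))

theorem elErrorSq_nonneg (ε : ℝ) (s : Affine.Simplex ℝ (Eu (m + 1)) (m + 1))
    (u : Eu (m + 1) → ℝ) (p : Poly (m + 1) ℓ) : 0 ≤ elErrorSq ε s u p :=
  add_nonneg (sq_nonneg _) (mul_nonneg (div_nonneg measureReal_nonneg measureReal_nonneg)
    (integral_nonneg fun _ => sq_nonneg _))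

/-- Corrections are computed for smooth approximations of `u` on the whole pair; the limit turns
their boundary values into traces of `u - Pᵢ`. -/
theorem exists_pairError_sq_le (m ℓ : ℕ) (σ : ℝ) : ∃ M : ℝ, 0 ≤ M ∧
    ∀ s t : Affine.Simplex ℝ (Eu (m + 1)) (m + 1), IsPair s t → shapePar s t ≤ σ →
      ∀ ε : ℝ, 0 < ε → ∀ u : Eu (m + 1) → ℝ, MemH1 (interior (el s ∪ el t)) u →
      ∀ P₁ P₂ : Poly (m + 1) ℓ,
        pairError ε ℓ s t u ^ 2 ≤ M * (elErrorSq ε s u P₁ + elErrorSq ε t u P₂) := by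
  obtain ⟨M, hM0, hM⟩ := exists_correction m ℓ σ
  refine ⟨2 * (1 + M), by positivity, fun s t hst hσ ε hε u hu P₁ P₂ => ?_⟩
  obtain ⟨lam, hlam, hs, ht, hcor⟩ := hM s t hst hσ
  obtain ⟨hGL, hGw⟩ := hu.weakGradient_spec
  have huL := hu.1
  set G := weakGradient (interior (el s ∪ el t)) u
  have hvol := hst.restrict_interior_union
  obtain ⟨φ, hφ, hφ0, hφ1⟩ := hst.exists_smooth_tendsto huL hGL hGw
  have hms : volume.restrict (el s) ≤ volume.restrict (interior (el s ∪ el t)) := by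
    rw [hvol]; exact Measure.le_add_right le_rfl
  have hmt : volume.restrict (el t) ≤ volume.restrict (interior (el s ∪ el t)) := by
    rw [hvol]; exact Measure.le_add_left le_rfl
  have hws := hGw.mono (interior_mono (Set.subset_union_left (s := el s) (t := el t)))
  have hwt := hGw.mono (interior_mono (Set.subset_union_right (s := el s) (t := el t)))
  have hus := huL.mono_measure hms
  have hut := huL.mono_measure hmt
  have hGs := hGL.mono_measure hms
  have hGt := hGL.mono_measure hmt
  have hlim : ∀ {ν : Measure (Eu (m + 1))} {F : Type} [NormedAddCommGroup F]
      {f : ℕ → Eu (m + 1) → F}, ν ≤ volume.restrict (interior (el s ∪ el t)) →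
      Tendsto (fun n => eLpNorm (f n) 2 (volume.restrict (interior (el s ∪ el t)))) atTop (𝓝 0) →
      Tendsto (fun n => eLpNorm (f n) 2 ν) atTop (𝓝 0) := fun hν h =>
    tendsto_of_tendsto_of_tendsto_of_le_of_le tendsto_const_nhds h (fun _ => zero_le)
      fun n => eLpNorm_mono_measure _ hν
  obtain ⟨ls, ls'⟩ := tendsto_boundary_error s hus hGs hws hφ (hlim hms hφ0) (hlim hms hφ1) P₁
  obtain ⟨lt, lt'⟩ := tendsto_boundary_error t hut hGt hwt hφ (hlim hmt hφ0) (hlim hmt hφ1) P₂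
  have e1 := rdNorm_sub_polyFun_sq s hε.le hus hGs hws P₁
  have e2 := rdNorm_sub_polyFun_sq t hε.le hut hGt hwt P₂
  have hpoly : ∀ (r : Affine.Simplex ℝ (Eu (m + 1)) (m + 1)) (P q : Poly (m + 1) ℓ),
      MemLp u 2 (volume.restrict (el r)) → MemLp G 2 (volume.restrict (el r)) →
      (∫ x in el r, (u x - polyFun (P + q) x) ^ 2) ≤
        2 * ((∫ x in el r, (u x - polyFun P x) ^ 2) + ∫ x in el r, polyFun q x ^ 2) ∧
      (∫ x in el r, ‖G x - gradient (polyFun (P + q)) x‖ ^ 2) ≤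
        2 * ((∫ x in el r, ‖G x - gradient (polyFun P) x‖ ^ 2) +
          ∫ x in el r, ‖gradient (polyFun q) x‖ ^ 2) := by
    intro r P q hur hGr
    constructor
    · simpa only [polyFun_add, sub_sub, Pi.sub_apply] using integral_sub_sq_le
        (hur.sub (Continuous.memLp_el r (contDiff_polyFun P).continuous))
        (Continuous.memLp_el r (contDiff_polyFun q).continuous)
    · simpa only [gradient_polyFun_add, sub_sub, Pi.sub_apply] using integral_norm_sub_sq_le
        (hGr.sub (Continuous.memLp_el r (continuous_gradient (contDiff_polyFun P))))
        (Continuous.memLp_el r (continuous_gradient (contDiff_polyFun q)))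
  set κs := volume.real (el s) / (surf (el s)).real Set.univ with hκs
  set κt := volume.real (el t) / (surf (el t)).real Set.univ with hκt
  have hκs0 : 0 ≤ κs := div_nonneg measureReal_nonneg measureReal_nonneg
  have hκt0 : 0 ≤ κt := div_nonneg measureReal_nonneg measureReal_nonneg
  -- The corrections change with `n` and need not converge; the bound no longer contains them.
  have key : ∀ n, pairError ε ℓ s t u ^ 2 ≤
      2 * (rdNorm ε (el s) (fun x => u x - polyFun P₁ x) ^ 2 +
        rdNorm ε (el t) (fun x => u x - polyFun P₂ x) ^ 2) +
      2 * M * ((κs * (∫ x, (φ n x - polyFun P₁ x) ^ 2 ∂(surf (el s))) +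
          κt * ∫ x, (φ n x - polyFun P₂ x) ^ 2 ∂(surf (el t))) +
        ε * ((∫ x in el s, ‖gradient (fun y => φ n y - polyFun P₁ y) x‖ ^ 2) +
          ∫ x in el t, ‖gradient (fun y => φ n y - polyFun P₂ y) x‖ ^ 2)) := by
    intro n
    obtain ⟨q₁, q₂, hq, hq1, hq2⟩ := hcor (φ n) (hφ n) P₁ P₂
    have h1 := pow_le_pow_left₀ (pairError_nonneg ε ℓ s t u)
      (pairError_le ε u (gluePoly_mem_pairSpace hs ht hq)) 2
    rw [rdNorm_sub_gluePoly_sq hε.le hlam hs ht hq hvol huL hGL hGw] at h1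
    obtain ⟨a1, a2⟩ := hpoly s P₁ q₁ hus hGs
    obtain ⟨b1, b2⟩ := hpoly t P₂ q₂ hut hGt
    have h2 := mul_le_mul_of_nonneg_left (add_le_add (add_le_add a2 b2) hq2) hε.le
    have h3 := mul_le_mul_of_nonneg_left (add_le_add a2 b2) hε.le
    have h4 := mul_le_mul_of_nonneg_left hq2 hε.le
    rw [e1, e2]
    linarith
  have hl := ((((ls.const_mul κs).add (lt.const_mul κt)).add
    ((ls'.add lt').const_mul ε)).const_mul (2 * M)).const_add
    (2 * (rdNorm ε (el s) (fun x => u x - polyFun P₁ x) ^ 2 +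
        rdNorm ε (el t) (fun x => u x - polyFun P₂ x) ^ 2))
  refine (ge_of_tendsto' hl key).trans ?_
  rw [elErrorSq, elErrorSq, ← hκs, ← hκt]
  have t1 : 0 ≤ κs * ∫ x, trace (el s) (fun y => u y - polyFun P₁ y) x ^ 2 ∂(surf (el s)) :=
    mul_nonneg hκs0 (integral_nonneg fun _ => sq_nonneg _)
  have t2 : 0 ≤ κt * ∫ x, trace (el t) (fun y => u y - polyFun P₂ y) x ^ 2 ∂(surf (el t)) :=
    mul_nonneg hκt0 (integral_nonneg fun _ => sq_nonneg _)
  have t3 : 0 ≤ M * ∫ x in el s, (u x - polyFun P₁ x) ^ 2 :=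
    mul_nonneg hM0 (integral_nonneg fun _ => sq_nonneg _)
  have t4 : 0 ≤ M * ∫ x in el t, (u x - polyFun P₂ x) ^ 2 :=
    mul_nonneg hM0 (integral_nonneg fun _ => sq_nonneg _)
  rw [e1, e2]
  linarith

theorem elError_nonneg {d : ℕ} (ε : ℝ) (ℓ : ℕ) (s : Affine.Simplex ℝ (Eu d) d)
    (u : Eu d → ℝ) : 0 ≤ elError ε ℓ s u :=
  Real.iInf_nonneg fun _ => Real.sqrt_nonneg _

/-- The square root is subadditive, and `P₁`, `P₂` are independent, so the two infima can be taken
separately. -/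
theorem exists_pairError_le (m ℓ : ℕ) (σ : ℝ) : ∃ C : ℝ, 0 ≤ C ∧
    ∀ s t : Affine.Simplex ℝ (Eu (m + 1)) (m + 1), IsPair s t → shapePar s t ≤ σ →
      ∀ ε : ℝ, 0 < ε → ∀ u : Eu (m + 1) → ℝ, MemH1 (interior (el s ∪ el t)) u →
        pairError ε ℓ s t u ≤ C * (elError ε ℓ s u + elError ε ℓ t u) := by
  obtain ⟨M, hM0, hM⟩ := exists_pairError_sq_le m ℓ σ
  refine ⟨√M, Real.sqrt_nonneg M, fun s t hst hσ ε hε u hu => ?_⟩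
  rw [mul_add]
  unfold elError
  rw [Real.mul_iInf_of_nonneg (Real.sqrt_nonneg M), Real.mul_iInf_of_nonneg (Real.sqrt_nonneg M)]
  refine le_ciInf_add_ciInf fun P₁ P₂ => ?_
  rw [← mul_add]
  refine (le_abs_self _).trans
    ((Real.abs_le_sqrt (hM s t hst hσ ε hε u hu P₁ P₂)).trans ?_)
  rw [Real.sqrt_mul hM0]
  refine mul_le_mul_of_nonneg_left ?_ (Real.sqrt_nonneg M)
  have h1 := elErrorSq_nonneg ε s u P₁
  have h2 := elErrorSq_nonneg ε t u P₂
  change √(elErrorSq ε s u P₁ + elErrorSq ε t u P₂) ≤ √(elErrorSq ε s u P₁) + √(elErrorSq ε t u P₂)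
  rw [Real.sqrt_le_left (by positivity), add_sq, Real.sq_sqrt h1, Real.sq_sqrt h2]
  linarith [show 0 ≤ 2 * √(elErrorSq ε s u P₁) * √(elErrorSq ε t u P₂) by positivity]

end Pair

end

section

/-! ### Conforming meshes -/

variable {m n : ℕ} {K : Fin n → Affine.Simplex ℝ (Eu (m + 1)) (m + 1)}

open Classical in
/-- An element of a conforming mesh has at most one neighbour at each of its faces. -/
theorem IsConforming.card_neighbours_le (hK : IsConforming K) (i : Fin n) :
    (Finset.univ.filter fun j => IsPair (K i) (K j)).card ≤ m + 2 := by
  -- Each neighbour is assigned the face it shares. This is injective, since two neighbours at one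
  -- face would have overlapping interiors.
  choose! k hk using fun (j : Fin n) (hj : IsPair (K i) (K j)) => hj.1
  have h := Finset.card_le_card_of_injOn (s := Finset.univ.filter fun j => IsPair (K i) (K j))
    (t := (Finset.univ : Finset (Fin (m + 2)))) k (fun _ _ => Finset.mem_univ _) ?_
  · simpa using h
  intro j hj j' hj' hjj
  by_contra hne
  have hp : IsPair (K i) (K j) := by simpa using hj
  have hp' : IsPair (K i) (K j') := by simpa using hj'
  obtain ⟨-, l, hl⟩ := id hp
  obtain ⟨-, l', hl'⟩ := id hp'
  refine not_disjoint_interior_of_common_base (b := basisAt (K i) (k j)) (b' := basisAt (K j) l)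
    (b'' := basisAt (K j') l') ?_ ?_ ?_ ?_ ?_
  · rw [base_basisAt, hull_basisAt, hull_basisAt, hk j hp]
  · rw [base_basisAt, hull_basisAt, hull_basisAt, hl]
  · rw [base_basisAt, hull_basisAt, hull_basisAt, hjj, hk j' hp']
  · rw [base_basisAt, hull_basisAt, hull_basisAt, hl']
  · rw [hull_basisAt, hull_basisAt]
    exact (hK j j' hne).1

/-- After enlarging to all ordered pairs, an element occurs at most `m + 2` times in each of the two
positions. -/
theorem IsConforming.sum_interFaces_le (hK : IsConforming K) {a : Fin n → ℝ} (ha : ∀ i, 0 ≤ a i) :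
    ∑ q ∈ interFaces K, (a q.1 + a q.2) ≤ 2 * (m + 2) * ∑ i, a i := by
  classical
  have h1 : ∀ i, ∑ j, (if IsPair (K i) (K j) then a i else 0) ≤ (m + 2) * a i := fun i => by
    rw [← Finset.sum_filter, Finset.sum_const, nsmul_eq_mul]
    refine mul_le_mul_of_nonneg_right ?_ (ha i)
    exact_mod_cast hK.card_neighbours_le i
  have h2 : ∑ i, ∑ j, (if IsPair (K i) (K j) then a i else 0) ≤ (m + 2) * ∑ i, a i := by
    rw [Finset.mul_sum]
    exact Finset.sum_le_sum fun i _ => h1 i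
  have h3 : ∑ i, ∑ j, (if IsPair (K i) (K j) then a j else 0) =
      ∑ i, ∑ j, (if IsPair (K i) (K j) then a i else 0) := by
    rw [Finset.sum_comm]
    refine Finset.sum_congr rfl fun i _ => Finset.sum_congr rfl fun j _ => ?_
    exact if_congr ⟨IsPair.symm, IsPair.symm⟩ rfl rfl
  calc ∑ q ∈ interFaces K, (a q.1 + a q.2)
      ≤ ∑ q : Fin n × Fin n with IsPair (K q.1) (K q.2), (a q.1 + a q.2) := by
        refine Finset.sum_le_sum_of_subset_of_nonneg (fun q hq => ?_)
          fun q _ _ => add_nonneg (ha _) (ha _)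
        simp only [interFaces, Finset.mem_filter, Finset.mem_univ, true_and] at hq ⊢
        exact hq.2
    _ = (∑ i, ∑ j, if IsPair (K i) (K j) then a i else 0) +
          ∑ i, ∑ j, if IsPair (K i) (K j) then a j else 0 := by
        rw [Finset.sum_add_distrib, Finset.sum_filter, Finset.sum_filter, Fintype.sum_prod_type,
          Fintype.sum_prod_type]
    _ ≤ 2 * (m + 2) * ∑ i, a i := by
        rw [h3]
        linarith

end

end TraceAug

end


theorem proposition6p7 (d ℓ : ℕ) (hd : 1 ≤ d) (σ : ℝ) :
    ∃ C : ℝ,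
      (∀ s t : Affine.Simplex ℝ (TraceAug.Eu d) d,
        TraceAug.IsPair s t → TraceAug.shapePar s t ≤ σ →
        ∀ ε : ℝ, 0 < ε → ∀ u : TraceAug.Eu d → ℝ,
          TraceAug.MemH1 (interior (TraceAug.el s ∪ TraceAug.el t)) u →
          TraceAug.pairError ε ℓ s t u ≤
            C * (TraceAug.elError ε ℓ s u + TraceAug.elError ε ℓ t u)) ∧
      (∀ (n : ℕ) (K : Fin n → Affine.Simplex ℝ (TraceAug.Eu d) d),
        TraceAug.IsConforming K →
        (∀ q ∈ TraceAug.interFaces K, TraceAug.shapePar (K q.1) (K q.2) ≤ σ) →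
        ∀ ε : ℝ, 0 < ε → ∀ u : TraceAug.Eu d → ℝ,
          TraceAug.MemH1 (interior (⋃ i, TraceAug.el (K i))) u →
          Real.sqrt (∑ q ∈ TraceAug.interFaces K,
              TraceAug.pairError ε ℓ (K q.1) (K q.2) u ^ 2) ≤
            C * Real.sqrt (∑ i, TraceAug.elError ε ℓ (K i) u ^ 2)) := by
  obtain ⟨m, rfl⟩ : ∃ m, d = m + 1 := ⟨d - 1, by omega⟩
  obtain ⟨C, hC0, hC⟩ := TraceAug.exists_pairError_le m ℓ σ
  -- The second entry serves the mesh: a factor 2 from squaring a sum of two terms, and `2 (m + 2)`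
  -- from the overlap of the pairs.
  refine ⟨max C √(4 * (m + 2) * C ^ 2), fun s t hst hσ ε hε u hu => ?_,
    fun n K hK hσ ε hε u hu => ?_⟩
  · exact (hC s t hst hσ ε hε u hu).trans (mul_le_mul_of_nonneg_right (le_max_left _ _)
      (add_nonneg (TraceAug.elError_nonneg _ _ _ _) (TraceAug.elError_nonneg _ _ _ _)))
  · refine le_trans ?_ (mul_le_mul_of_nonneg_right (le_max_right _ _) (Real.sqrt_nonneg _))
    rw [← Real.sqrt_mul (by positivity)]
    refine Real.sqrt_le_sqrt ?_
    have hsum := hK.sum_interFaces_le fun i => sq_nonneg (TraceAug.elError ε ℓ (K i) u)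
    have hq : ∀ q ∈ TraceAug.interFaces K, TraceAug.pairError ε ℓ (K q.1) (K q.2) u ^ 2 ≤
        2 * C ^ 2 * (TraceAug.elError ε ℓ (K q.1) u ^ 2 +
          TraceAug.elError ε ℓ (K q.2) u ^ 2) := by
      intro q hq
      have hpair : TraceAug.IsPair (K q.1) (K q.2) := by
        simp only [TraceAug.interFaces, Finset.mem_filter] at hq
        exact hq.2.2
      have hmono := hu.mono (interior_mono (Set.union_subset
        (Set.subset_iUnion (fun i => TraceAug.el (K i)) q.1)
        (Set.subset_iUnion (fun i => TraceAug.el (K i)) q.2)))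
      have h1 := pow_le_pow_left₀ (TraceAug.pairError_nonneg _ _ _ _ _)
        (hC _ _ hpair (hσ q hq) ε hε u hmono) 2
      rw [mul_pow] at h1
      refine h1.trans ?_
      rw [mul_comm (2 : ℝ), mul_assoc]
      exact mul_le_mul_of_nonneg_left add_sq_le (sq_nonneg C)
    refine (Finset.sum_le_sum hq).trans ?_
    rw [← Finset.mul_sum]
    refine (mul_le_mul_of_nonneg_left hsum (by positivity)).trans_eq ?_
    ring
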